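/- Let $D\subseteq\mathbb{R}^2$ be a bounded, open, connected set with $0\in D$, let $g$ be a positive continuous function on $\partial D$, and let $f:\mathbb{R}^2\to\mathbb{R}$ be continuous with $0<\lambda<f(x)<\Lambda$ for all $x$. For $v:\mathbb{R}^2\setminus D\to[0,\infty)$ put $\Omega(v)=\{x\in\mathbb{R}^2\setminus D: v(x)>0\}$. Call a continuous $v:\mathbb{R}^2\setminus D\to[0,\infty)$ a (viscosity) subsolution if 1. $\Delta v\ge 0$ in $\Omega(v)\setminus\overline D$ in the viscosity sense: if $x\in\Omega(v)\setminus\overline D$, $\varphi$ is $C^2$ near $x$ and $v-\varphi$ has a local maximum at $x$, then $\Delta\varphi(x)\ge 0$; 2. $v\le g$ on $\partial D$; 3. if $x_0\in\partial\Omega(v)\setminus\overline D$ and an open ball $B_s(y)$, $s>0$, with $B_s(y)\cap\Omega(v)=\emptyset$ and $|x_0-y|=s$ is given, then for $\nu=(x_0-y)/s$ and every real $\alpha$ such that $v(x)\le\alpha\langle x-x_0,\nu\rangle^+ + o(|x-x_0|)$ as $x\to x_0$, one has $\alpha\ge\sqrt{f(x_0)}$. Let $\rho>0$ with $D\subseteq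 B_\rho(0)$, let $M>0$, put $$R_0=\inf\Bigl\{R>\rho:\ \frac{M^2}{R^2\ln^2(\rho/R)}<\lambda\Bigr\},\qquad h(x)=M\Bigl(\frac{\ln(|x|/R_0)}{\ln(\rho/R_0)}\Bigr)^+,$$ and assume that $g\le h$ on $\partial D$ (which holds in particular if $g\le M$). Let $$u=\sup\{v:\ v \text{ is a subsolution and } v\le h \text{ on } \mathbb{R}^2\setminus D\}$$ be the largest subsolution. Let $x_0\in\partial\Omega(u)$ and $r>0$ with $B_r(x_0)\cap D=\emptyset$, and let $\tilde u(x)=u(x_0-rx)/r$ for $x\in B_1(0)$ be the normalization of $u$. Then for every connected component $\Gamma$ of $\{x\in B_1(0):\tilde u(x)>0\}$, the boundary $\partial\Gamma$ (taken in $\mathbb{R}^2$) has finite one-dimensional Hausdorff measure: $\mathcal{H}^1(\partial\Gamma)<+\infty$. -/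

import Mathlib

open Set Filter Topology Metric MeasureTheory

/-- The Euclidean plane. -/
abbrev Plane : Type := EuclideanSpace ℝ (Fin 2)

namespace FreeBoundary

/-- Functions on `ℝ² \ D` are represented by total functions `Plane → ℝ` whose values on `D` are
never used. This is the positivity set `Ω(v) = {x ∈ ℝ² \ D : v x > 0}`. -/
def posSet (D : Set Plane) (v : Plane → ℝ) : Set Plane := {x | x ∉ D ∧ 0 < v x}

/-- `Δ v ≥ 0` on `U` in the viscosity sense: every test function that is twice continuously
differentiable near `x ∈ U` and touches `v` from above at `x` (up to an additive constant) has
nonnegative Laplacian at `x`. -/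
def ViscositySubharmonicOn (v : Plane → ℝ) (U : Set Plane) : Prop :=
  ∀ x ∈ U, ∀ φ : Plane → ℝ, ContDiffAt ℝ 2 φ x →
    (∀ᶠ y in 𝓝 x, v y - φ y ≤ v x - φ x) → 0 ≤ Laplacian.laplacian φ x

/-- In a neighbourhood of `x₀`, `v x ≤ α ⟨x - x₀, ν⟩⁺ + o(|x - x₀|)`. -/
def BelowPlane (v : Plane → ℝ) (x₀ ν : Plane) (α : ℝ) : Prop :=
  ∀ ε > 0, ∀ᶠ x in 𝓝 x₀, v x ≤ α * max (inner ℝ (x - x₀) ν) 0 + ε * ‖x - x₀‖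

/-- Viscosity subsolutions of the one-phase free boundary problem
`Δ u = 0` in `Ω(u) \ D`, `u = g` on `∂D`, `u = 0` and `|∇u|² = f` on `∂Ω(u)`. -/
structure IsSubsolution (D : Set Plane) (f g v : Plane → ℝ) : Prop where
  continuousOn : ContinuousOn v Dᶜ
  nonneg : ∀ x ∉ D, 0 ≤ v x
  subharmonic : ViscositySubharmonicOn v (posSet D v \ closure D)
  le_boundary : ∀ x ∈ frontier D, v x ≤ g x
  /-- Free boundary condition: at a free boundary point `x₀` where a ball `B_s(y)` lying outside
  `Ω(v)` is tangent, with `ν = (x₀ - y) / s` the unit normal pointing into `Ω(v)`. -/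
  freeBoundary : ∀ x₀ ∈ frontier (posSet D v) \ closure D, ∀ (y : Plane) (s : ℝ), 0 < s →
    dist x₀ y = s → Disjoint (ball y s) (posSet D v) →
    ∀ α : ℝ, BelowPlane v x₀ (s⁻¹ • (x₀ - y)) α → √(f x₀) ≤ α

/-- The outer radius `R₀` of the barrier:
the infimum of all `R > ρ` with `M² / (R² ln² (ρ / R)) < lam`. -/
noncomputable def barrierRadius (lam ρ M : ℝ) : ℝ :=
  sInf {R : ℝ | ρ < R ∧ M ^ 2 / (R ^ 2 * Real.log (ρ / R) ^ 2) < lam}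

/-- The logarithmic barrier `h(x) = M (ln (|x| / R₀) / ln (ρ / R₀))⁺`, which equals `M` on `∂B_ρ(0)`
and has slope `√lam` on `∂B_{R₀}(0)`. -/
noncomputable def barrier (lam ρ M : ℝ) (x : Plane) : ℝ :=
  M * max (Real.log (‖x‖ / barrierRadius lam ρ M) / Real.log (ρ / barrierRadius lam ρ M)) 0

/-- The largest subsolution below `h`: `u = sup {v : v is a subsolution, v ≤ h on ℝ² \ D}`. -/
noncomputable def largestSubsolution (D : Set Plane) (f g h : Plane → ℝ) (x : Plane) : ℝ :=
  sSup {t : ℝ | ∃ v : Plane → ℝ, IsSubsolution D f g v ∧ (∀ y ∉ D, v y ≤ h y) ∧ v x = t}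

/-- The normalization of `u` that carries `B_r(x₀)` to the unit ball: `x ↦ u (x₀ - r x) / r`. -/
noncomputable def normalize (u : Plane → ℝ) (x₀ : Plane) (r : ℝ) (x : Plane) : ℝ :=
  u (x₀ - r • x) / r

end FreeBoundary

/-! Write u for the largest subsolution and S for its free boundary away from the closure of D. A
boundary point of Γ lies on the unit circle or is carried into S by x ↦ x₀ - r x, so it is enough
that S has finite length (`hausdorffMeasure_freeBoundarySet_lt_top`).

The reason is that Δu behaves like a one-dimensional measure on S: it has finite mass near the
compact set S, and at least c t of it sits around every point of S at scale t. A t-separated subset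
of a small piece of S therefore has at most C/t points. The measure Δu is never formed. It is
replaced by the excess of the circular average of u over its value; integrated against a bump, the
averaging operator passes to the bump, and disjoint balls with large excess can be counted
(`card_mul_le_of_circAvg_sub`).

A lower bound for the excess at S needs two opposite estimates. Linear growth (`largest_le_dist`)
keeps u below C δ t within δ t of S. Nondegeneracy (`exists_lt_largest`) makes u, hence its average
on a circle of radius 4t, at least c t.

Growth comes from maximality: if u were too large at a point compared with the distance to its
zeros, gluing in a logarithm of slope √Lam would give a subsolution positive at a zero of u.
Nondegeneracy at p combines maximality with the same counting. A small circle about p meets Ω(u),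
and it is not contained in the closure of Ω(u), for otherwise the harmonic replacement would be a
member positive at p. So circles of N equally spaced radii carry points at distance exactly τ from
Ω(u), with N τ comparable to s. At such points the free boundary condition forces an excess of order
τ, and counting bounds sup u from below by c s.

All of this uses that u is itself a continuous subsolution (`largest_mem_Fam`). That is a Perron
argument: Harnack and linear growth give continuity away from D, connectedness of D makes every
point of ∂D regular, and the viscosity and free boundary conditions are verified by testing them on
members of the family close to u. -/

namespace FreeBoundary

open InnerProductSpace Laplacian

/-! ### Laplacian and harmonic functions in the plane -/

section Laplacian

variable {E : Type*} [NormedAddCommGroup E] [InnerProductSpace ℝ E]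

theorem hasDerivAt_line {ψ : E → ℝ} {x e : E} {t : ℝ} (h : DifferentiableAt ℝ ψ (x + t • e)) :
    HasDerivAt (fun s : ℝ => ψ (x + s • e)) (fderiv ℝ ψ (x + t • e) e) t := by
  have h1 : HasDerivAt (fun s : ℝ => x + s • e) e t := by
    simpa using ((hasDerivAt_id t).smul_const e).const_add x
  exact h.hasFDerivAt.comp_hasDerivAt t h1

theorem deriv_deriv_line {ψ : E → ℝ} {x e : E} (h : ContDiffAt ℝ 2 ψ x) :
    deriv (deriv fun s : ℝ => ψ (x + s • e)) 0 = iteratedFDeriv ℝ 2 ψ x ![e, e] := by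
  have hc : Tendsto (fun s : ℝ => x + s • e) (𝓝 0) (𝓝 x) := by
    have : Continuous (fun s : ℝ => x + s • e) := by fun_prop
    simpa using this.tendsto 0
  have h1 : ∀ᶠ y in 𝓝 x, DifferentiableAt ℝ ψ y := by
    filter_upwards [h.eventually (by simp)] with y hy
    exact hy.differentiableAt (by simp)
  have h2 : deriv (fun s : ℝ => ψ (x + s • e)) =ᶠ[𝓝 0] fun s => fderiv ℝ ψ (x + s • e) e := by
    filter_upwards [hc.eventually h1] with s hs
    exact (hasDerivAt_line hs).deriv
  rw [h2.deriv_eq]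
  have h3 : DifferentiableAt ℝ (fderiv ℝ ψ) x :=
    (h.fderiv_right (m := 1) (by norm_num)).differentiableAt (by simp)
  have h4 : HasDerivAt (fun s : ℝ => x + s • e) e 0 := by
    simpa using ((hasDerivAt_id (0:ℝ)).smul_const e).const_add x
  have h5 : HasDerivAt (fun s : ℝ => fderiv ℝ ψ (x + s • e)) (fderiv ℝ (fderiv ℝ ψ) x e) 0 := by
    have h3' : HasFDerivAt (fderiv ℝ ψ) (fderiv ℝ (fderiv ℝ ψ) x) (x + (0:ℝ) • e) := by
      simpa using h3.hasFDerivAt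
    exact h3'.comp_hasDerivAt 0 h4
  have h6 : HasDerivAt (fun s : ℝ => fderiv ℝ ψ (x + s • e) e) (fderiv ℝ (fderiv ℝ ψ) x e e) 0 :=
    h5.clm_apply (hasDerivAt_const _ _) |>.congr_deriv (by simp)
  rw [h6.deriv, iteratedFDeriv_two_apply]
  simp

theorem iteratedFDeriv_two_nonneg_of_isLocalMin {ψ : E → ℝ} {x : E} (h : ContDiffAt ℝ 2 ψ x)
    (hmin : IsLocalMin ψ x) (e : E) : 0 ≤ iteratedFDeriv ℝ 2 ψ x ![e, e] := by
  by_contra! hneg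
  rw [← deriv_deriv_line h] at hneg
  set g : ℝ → ℝ := fun s => ψ (x + s • e) with hg
  have hc : Tendsto (fun s : ℝ => x + s • e) (𝓝 0) (𝓝 x) := by
    have : Continuous (fun s : ℝ => x + s • e) := by fun_prop
    simpa using this.tendsto 0
  have hgmin : IsLocalMin g 0 := by
    have := hc.eventually hmin
    filter_upwards [this] with s hs
    simpa [hg] using hs
  have hgc : ContinuousAt g 0 := by
    have : ContinuousAt ψ (x + (0:ℝ) • e) := by simpa using h.continuousAt
    exact ContinuousAt.comp (f := fun s : ℝ => x + s • e) this (by fun_prop)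
  -- A negative second derivative makes 0 a local maximum as well; then g is constant near 0 and its
  -- second derivative vanishes.
  have hmax : IsLocalMax g 0 := isLocalMax_of_deriv_deriv_neg hneg hgmin.deriv_eq_zero hgc
  have hconst : g =ᶠ[𝓝 0] fun _ => g 0 := by
    filter_upwards [hgmin, hmax] with s h1 h2
    exact le_antisymm h2 h1
  have h1 : deriv g =ᶠ[𝓝 0] fun _ => 0 := by
    have := hconst.deriv
    filter_upwards [this] with s hs
    rw [hs]; simp
  rw [h1.deriv_eq] at hneg
  simp at hneg

theorem contDiff_norm_sub_sq (c : E) : ContDiff ℝ 2 fun x : E => ‖x - c‖ ^ 2 :=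
  (contDiff_id.sub contDiff_const).norm_sq ℝ

theorem iteratedFDeriv_two_norm_sub_sq (c x e : E) :
    iteratedFDeriv ℝ 2 (fun x : E => ‖x - c‖ ^ 2) x ![e, e] = 2 * ‖e‖ ^ 2 := by
  rw [← deriv_deriv_line (contDiff_norm_sub_sq c).contDiffAt]
  have : (fun s : ℝ => ‖x + s • e - c‖ ^ 2) =
      fun s => ‖x - c‖ ^ 2 + 2 * s * inner ℝ (x - c) e + s ^ 2 * ‖e‖ ^ 2 := by
    funext s
    have h : x + s • e - c = (x - c) + s • e := by abel
    rw [h, norm_add_sq_real, inner_smul_right, norm_smul, mul_pow, Real.norm_eq_abs, sq_abs]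
    ring
  rw [this]
  have h1 : (deriv fun s : ℝ => ‖x - c‖ ^ 2 + 2 * s * inner ℝ (x - c) e + s ^ 2 * ‖e‖ ^ 2) =
      fun s => 2 * inner ℝ (x - c) e + 2 * s * ‖e‖ ^ 2 := by
    funext s
    have : HasDerivAt (fun s : ℝ => ‖x - c‖ ^ 2 + 2 * s * inner ℝ (x - c) e + s ^ 2 * ‖e‖ ^ 2)
        (0 + (2 * 1) * inner ℝ (x - c) e + (2 * s ^ 1 * 1) * ‖e‖ ^ 2) s :=
      (((hasDerivAt_const _ _).add (((hasDerivAt_id s).const_mul 2).mul_const _))).add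
        (((hasDerivAt_id s).pow 2).mul_const _)
    rw [this.deriv]; ring
  rw [h1]
  have : HasDerivAt (fun s : ℝ => 2 * inner ℝ (x - c) e + 2 * s * ‖e‖ ^ 2)
      (0 + (2 * 1) * ‖e‖ ^ 2) 0 :=
    (hasDerivAt_const _ _).add (((hasDerivAt_id _).const_mul 2).mul_const _)
  rw [this.deriv]; ring

variable [FiniteDimensional ℝ E]

theorem laplacian_nonneg_of_isLocalMin {ψ : E → ℝ} {x : E} (h : ContDiffAt ℝ 2 ψ x)
    (hmin : IsLocalMin ψ x) : 0 ≤ Laplacian.laplacian ψ x := by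
  rw [laplacian_eq_iteratedFDeriv_stdOrthonormalBasis]
  exact Finset.sum_nonneg fun i _ => iteratedFDeriv_two_nonneg_of_isLocalMin h hmin _

theorem laplacian_comp_isometry {F : Type*} [NormedAddCommGroup F] [InnerProductSpace ℝ F]
    [FiniteDimensional ℝ F] (L : F ≃ₗᵢ[ℝ] E) (f : E → ℝ) (z : F) :
    Laplacian.laplacian (f ∘ L) z = Laplacian.laplacian f (L z) := by
  rw [laplacian_eq_iteratedFDeriv_stdOrthonormalBasis,
    laplacian_eq_iteratedFDeriv_orthonormalBasis f ((stdOrthonormalBasis ℝ F).map L)]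
  refine Finset.sum_congr rfl fun i _ => ?_
  have := L.toContinuousLinearEquiv.iteratedFDerivWithin_comp_right f uniqueDiffOn_univ
    (x := z) (mem_univ _) 2
  simp only [preimage_univ, iteratedFDerivWithin_univ] at this
  have h2 : (f ∘ L) = (f ∘ L.toContinuousLinearEquiv) := rfl
  rw [h2, this]
  simp only [ContinuousMultilinearMap.compContinuousLinearMap_apply]
  congr 1
  funext j
  fin_cases j <;> simp

theorem harmonicAt_comp_isometry {F : Type*} [NormedAddCommGroup F] [InnerProductSpace ℝ F]
    [FiniteDimensional ℝ F] (L : F ≃ₗᵢ[ℝ] E) {f : E → ℝ} {z : F} (h : HarmonicAt f (L z)) :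
    HarmonicAt (f ∘ L) z := by
  refine ⟨h.1.comp z L.contDiff.contDiffAt, ?_⟩
  have h2 := (L.continuous.tendsto z).eventually h.2
  filter_upwards [h2] with y hy
  rw [laplacian_comp_isometry, hy]; rfl

theorem HarmonicAt.laplacian_eq_zero {f : E → ℝ} {x : E} (h : HarmonicAt f x) :
    Laplacian.laplacian f x = 0 := h.2.self_of_nhds

end Laplacian

theorem laplacian_norm_sub_sq (c x : Plane) :
    Laplacian.laplacian (fun x : Plane => ‖x - c‖ ^ 2) x = 4 := by
  rw [laplacian_eq_iteratedFDeriv_stdOrthonormalBasis]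
  simp only [iteratedFDeriv_two_norm_sub_sq]
  simp
  norm_num

/-- The standard isometry between `ℂ` and the Euclidean plane. -/
noncomputable def toPlane : ℂ ≃ₗᵢ[ℝ] Plane := Complex.orthonormalBasisOneI.repr

/-- In ℂ this is the logarithm of the modulus of a nonvanishing analytic function; the isometry with
the plane carries it over. -/
theorem harmonicAt_log_norm_sub {z x : Plane} (h : x ≠ z) :
    HarmonicAt (fun y : Plane => Real.log ‖y - z‖) x := by
  have h1 : HarmonicAt (fun w : ℂ => Real.log ‖w - toPlane.symm z‖) (toPlane.symm x) := by
    apply AnalyticAt.harmonicAt_log_norm (f := fun w : ℂ => w - toPlane.symm z)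
    · fun_prop
    · simpa [sub_eq_zero] using h
  have h2 := harmonicAt_comp_isometry toPlane.symm h1
  convert h2 using 1
  funext y
  simp only [Function.comp_apply, ← map_sub, LinearIsometryEquiv.norm_map]

/-! ### Comparison -/

theorem ViscositySubharmonicOn.mono {v : Plane → ℝ} {U V : Set Plane}
    (h : ViscositySubharmonicOn v U) (hVU : V ⊆ U) : ViscositySubharmonicOn v V :=
  fun x hx => h x (hVU hx)

theorem viscositySubharmonicOn_of_harmonic {v : Plane → ℝ} {U : Set Plane}
    (h : ∀ x ∈ U, HarmonicAt v x) : ViscositySubharmonicOn v U := by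
  intro x hx φ hφ hmax
  have h1 : ContDiffAt ℝ 2 (φ - v) x := hφ.sub (h x hx).1
  have h2 : IsLocalMin (φ - v) x := by
    filter_upwards [hmax] with y hy
    simp only [Pi.sub_apply]; linarith
  have h3 := laplacian_nonneg_of_isLocalMin h1 h2
  rwa [hφ.laplacian_sub (h x hx).1, HarmonicAt.laplacian_eq_zero (h x hx), sub_zero] at h3

/-- Comparison of a viscosity subharmonic function with a smooth superharmonic one. -/
theorem ViscositySubharmonicOn.le_of_frontier {O : Set Plane} (hO : IsOpen O)
    (hb : Bornology.IsBounded O) {v w : Plane → ℝ} (hv : ContinuousOn v (closure O))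
    (hw : ContinuousOn w (closure O)) (hsub : ViscositySubharmonicOn v {x ∈ O | w x < v x})
    (hw2 : ∀ x ∈ O, ContDiffAt ℝ 2 w x) (hΔ : ∀ x ∈ O, Laplacian.laplacian w x ≤ 0)
    (hfr : ∀ x ∈ frontier O, v x ≤ w x) : ∀ x ∈ closure O, v x ≤ w x := by
  intro x hx
  by_contra! hlt
  have hK : IsCompact (closure O) := hb.isCompact_closure
  obtain ⟨B, hB⟩ := hK.isBounded.exists_norm_le
  have hB0 : 0 ≤ B := (norm_nonneg x).trans (hB x hx)
  set m := v x - w x with hm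
  have hm0 : 0 < m := sub_pos.2 hlt
  -- Since η B² < m, the maximum of v - w + η|z|² still lies where v > w, hence inside O. There w -
  -- η|z|² is a test function with Laplacian at most -4η.
  set η := m / (2 * (B ^ 2 + 1)) with hη
  have hη0 : 0 < η := by positivity
  have hηB : η * B ^ 2 < m := by
    rw [hη, div_mul_eq_mul_div, div_lt_iff₀ (by positivity)]
    nlinarith [sq_nonneg B]
  obtain ⟨y, hy, hymax⟩ := hK.exists_isMaxOn ⟨x, hx⟩
    (f := fun z => v z - w z + η * ‖z - 0‖ ^ 2) (by fun_prop)
  have hy1 : m ≤ v y - w y + η * ‖y - 0‖ ^ 2 := by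
    have := hymax hx
    simp only [Set.mem_ofPred_eq] at this
    nlinarith [sq_nonneg ‖x - 0‖]
  have hyB : ‖y - 0‖ ^ 2 ≤ B ^ 2 := by
    rw [sub_zero]
    exact pow_le_pow_left₀ (norm_nonneg _) (hB y hy) 2
  have hpos : w y < v y := by nlinarith
  have hyO : y ∈ O := by
    by_contra hn
    have : y ∈ frontier O := by
      rw [hO.frontier_eq]; exact ⟨hy, hn⟩
    linarith [hfr y this]
  have hq : ContDiffAt ℝ 2 (fun z : Plane => η • (‖z - 0‖ ^ 2)) y :=
    ((contDiff_norm_sub_sq (0 : Plane)).const_smul η).contDiffAt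
  have hφ : ContDiffAt ℝ 2 (w - fun z : Plane => η • (‖z - 0‖ ^ 2)) y := (hw2 y hyO).sub hq
  have h0 := hsub y ⟨hyO, hpos⟩ _ hφ (by
    filter_upwards [hO.mem_nhds hyO] with z hz
    have := hymax (subset_closure hz)
    simp only [Set.mem_ofPred_eq] at this
    simp only [Pi.sub_apply, smul_eq_mul]; linarith)
  rw [(hw2 y hyO).laplacian_sub hq] at h0
  have h4 : Laplacian.laplacian (fun z : Plane => η • (‖z - 0‖ ^ 2)) y = η * 4 := by
    have := laplacian_smul η (contDiff_norm_sub_sq (0 : Plane)).contDiffAt (x := y)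
    rw [laplacian_norm_sub_sq] at this
    exact this
  rw [h4] at h0
  linarith [hΔ y hyO]

end FreeBoundary

namespace FreeBoundary

open InnerProductSpace Laplacian

/-! ### The Dirichlet problem on discs -/

section Poisson

open Real

variable {R : ℝ} {φ : ℂ → ℝ}

theorem continuousOn_poissonKernel_mul (hφ : ContinuousOn φ (sphere 0 R)) {w : ℂ}
    (hw : w ∈ ball (0 : ℂ) R) :
    ContinuousOn (poissonKernel 0 w • φ) (sphere 0 R) := by
  have h1 : ContinuousOn (poissonKernel 0 w) (sphere 0 R) := by
    have : ∀ z ∈ sphere (0 : ℂ) R, ‖z - 0 - (w - 0)‖ ^ 2 ≠ 0 := by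
      intro z hz h
      have h2 : z = w := by simpa [sub_eq_zero] using h
      subst h2
      simp only [mem_sphere, mem_ball] at hz hw
      linarith
    unfold poissonKernel
    fun_prop (disch := assumption)
  exact h1.smul hφ

theorem circleAverage_poissonKernel {w : ℂ} (hw : w ∈ ball (0 : ℂ) R) (a : ℝ) :
    circleAverage (poissonKernel 0 w • fun _ => a) 0 R = a :=
  HarmonicOnNhd.circleAverage_poissonKernel_smul (f := fun _ => a)
    (fun _ _ => harmonicAt_const a) hw

theorem harmonicAt_poissonIntegral (hφ : ContinuousOn φ (sphere 0 R)) {w : ℂ}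
    (hw : w ∈ ball (0 : ℂ) R) :
    HarmonicAt (fun w => circleAverage (poissonKernel 0 w • φ) 0 R) w := by
  have hR : 0 < R := pos_of_mem_ball hw
  have hci : CircleIntegrable φ 0 R := hφ.circleIntegrable hR.le
  have hci' : CircleIntegrable (fun z => (φ z : ℂ)) 0 R :=
    ContinuousOn.circleIntegrable hR.le (Complex.continuous_ofReal.comp_continuousOn hφ)
  have h1 := analyticOnNhd_circleAverage_herglotzRieszKernel_smul hci' w hw
  have h2 := h1.harmonicAt_re
  refine (harmonicAt_congr_nhds ?_).1 h2
  filter_upwards [isOpen_ball.mem_nhds hw] with y hy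
  rw [re_circleAverage_herglotzRieszKernel_smul hci hy, poissonKernel_eq_re_herglotzRieszKernel]

theorem poissonKernel_nonneg {w z : ℂ} (hw : w ∈ ball (0 : ℂ) R) (hz : z ∈ sphere (0 : ℂ) R) :
    0 ≤ poissonKernel 0 w z := by
  rw [poissonKernel_def]
  simp only [mem_ball, mem_sphere, dist_zero_right, sub_zero] at *
  apply div_nonneg _ (by positivity)
  rw [hz]
  nlinarith [norm_nonneg w]

/-- The Poisson kernel is an approximate identity. On the arc within δ of ζ the data vary by at most
ε and the kernel has mean 1; elsewhere |z - w| ≥ δ/2, which bounds the kernel by a quantity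
vanishing as |w| → R. -/
theorem abs_poissonIntegral_sub_le (hφ : ContinuousOn φ (sphere 0 R)) {B : ℝ}
    (hB : ∀ z ∈ sphere (0 : ℂ) R, |φ z| ≤ B) {ζ : ℂ} (hζ : ζ ∈ sphere (0 : ℂ) R) {ε δ : ℝ}
    (hε : 0 ≤ ε) (hδ : 0 < δ) (hζδ : ∀ z ∈ sphere (0 : ℂ) R, dist z ζ < δ → |φ z - φ ζ| ≤ ε)
    {w : ℂ} (hw : w ∈ ball (0 : ℂ) R) (hwζ : dist w ζ ≤ δ / 2) :
    |circleAverage (poissonKernel 0 w • φ) 0 R - φ ζ| ≤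
      ε + (R ^ 2 - ‖w‖ ^ 2) / (δ / 2) ^ 2 * (2 * B) := by
  have hR : 0 < R := pos_of_mem_ball hw
  have hB0 : 0 ≤ B := (abs_nonneg _).trans (hB ζ hζ)
  have hw' : ‖w‖ < R := by simpa using hw
  have hRw : 0 ≤ R ^ 2 - ‖w‖ ^ 2 := by nlinarith [norm_nonneg w]
  have hcont : ∀ a : ℝ, ContinuousOn (poissonKernel 0 w • fun _ : ℂ => a) (sphere 0 R) :=
    fun a => continuousOn_poissonKernel_mul continuousOn_const hw
  have hcφ := continuousOn_poissonKernel_mul hφ hw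
  have hcd : ContinuousOn (poissonKernel 0 w • fun z => φ z - φ ζ) (sphere 0 R) :=
    continuousOn_poissonKernel_mul (hφ.sub continuousOn_const) hw
  have h1 : circleAverage (poissonKernel 0 w • φ) 0 R - φ ζ =
      circleAverage (poissonKernel 0 w • fun z => φ z - φ ζ) 0 R := by
    conv_lhs => rw [← circleAverage_poissonKernel hw (φ ζ)]
    rw [← circleAverage_sub (hcφ.circleIntegrable hR.le) ((hcont _).circleIntegrable hR.le)]
    congr 1
    funext z
    simp [mul_sub]
  rw [h1]
  set C := (R ^ 2 - ‖w‖ ^ 2) / (δ / 2) ^ 2 * (2 * B) with hC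
  have hC0 : 0 ≤ C := by positivity
  have h2 : |circleAverage (poissonKernel 0 w • fun z => φ z - φ ζ) 0 R| ≤
      circleAverage ((poissonKernel 0 w • fun _ : ℂ => ε) + fun _ => C) 0 R := by
    refine abs_circleAverage_le_circleAverage_abs.trans ?_
    refine circleAverage_mono (hcd.abs.circleIntegrable hR.le)
      (((hcont ε).add continuousOn_const).circleIntegrable hR.le) fun z hz => ?_
    rw [abs_of_pos hR] at hz
    have hP := poissonKernel_nonneg hw hz
    change |poissonKernel 0 w z * (φ z - φ ζ)| ≤ poissonKernel 0 w z * ε + C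
    rw [abs_mul, abs_of_nonneg hP]
    by_cases hzd : dist z ζ < δ
    · nlinarith [hζδ z hz hzd]
    · have hzw : δ / 2 ≤ ‖z - w‖ := by
        rw [← dist_eq_norm]
        have := dist_triangle z w ζ
        push Not at hzd
        linarith
      have h3 : poissonKernel 0 w z ≤ (R ^ 2 - ‖w‖ ^ 2) / (δ / 2) ^ 2 := by
        rw [poissonKernel_def]
        simp only [mem_sphere, dist_zero_right] at hz
        simp only [sub_zero, hz]
        gcongr
      have h4 : |φ z - φ ζ| ≤ 2 * B := by
        have := abs_sub (φ z) (φ ζ)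
        linarith [hB z hz, hB ζ hζ]
      have h5 : poissonKernel 0 w z * |φ z - φ ζ| ≤ C := by
        rw [hC]
        exact mul_le_mul h3 h4 (abs_nonneg _) (hP.trans h3)
      nlinarith
  refine h2.trans ?_
  rw [circleAverage_add ((hcont ε).circleIntegrable hR.le)
    (continuousOn_const.circleIntegrable hR.le), circleAverage_poissonKernel hw,
    circleAverage_const]

theorem exists_dirichlet_complex (hφ : ContinuousOn φ (sphere 0 R)) :
    ∃ H : ℂ → ℝ, ContinuousOn H (closedBall 0 R) ∧ (∀ w ∈ ball (0 : ℂ) R, HarmonicAt H w) ∧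
      ∀ z ∈ sphere (0 : ℂ) R, H z = φ z := by
  classical
  set P : ℂ → ℝ := fun w => circleAverage (poissonKernel 0 w • φ) 0 R with hP
  set H : ℂ → ℝ := fun w => if w ∈ ball (0 : ℂ) R then P w else φ w with hH
  have hHP : ∀ w ∈ ball (0 : ℂ) R, HarmonicAt H w := by
    intro w hw
    refine (harmonicAt_congr_nhds ?_).1 (harmonicAt_poissonIntegral hφ hw)
    filter_upwards [isOpen_ball.mem_nhds hw] with y hy
    simp only [hH, if_pos hy, hP]
  have hHs : ∀ z ∈ sphere (0 : ℂ) R, H z = φ z := by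
    intro z hz
    have : z ∉ ball (0 : ℂ) R := by
      simp only [mem_sphere, mem_ball] at *; linarith
    simp only [hH, if_neg this]
  refine ⟨H, ?_, hHP, hHs⟩
  intro ζ hζ
  rcases (mem_closedBall.1 hζ).lt_or_eq with hlt | heq
  · exact (hHP ζ hlt).1.continuousAt.continuousWithinAt
  have hζs : ζ ∈ sphere (0 : ℂ) R := heq
  obtain ⟨B, hB⟩ := (isCompact_sphere (0 : ℂ) R).exists_bound_of_continuousOn hφ
  simp only [Real.norm_eq_abs] at hB
  have hB0 : 0 ≤ B := (abs_nonneg _).trans (hB ζ hζs)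
  rw [Metric.continuousWithinAt_iff]
  intro ε hε
  obtain ⟨δ, hδ, hδφ⟩ := Metric.continuousWithinAt_iff.1 (hφ ζ hζs) (ε / 2) (by positivity)
  have hcont : Continuous fun w : ℂ => (R ^ 2 - ‖w‖ ^ 2) / (δ / 2) ^ 2 * (2 * B) := by fun_prop
  have h0 : (R ^ 2 - ‖ζ‖ ^ 2) / (δ / 2) ^ 2 * (2 * B) = 0 := by
    have : ‖ζ‖ = R := by simpa using hζs
    rw [this]; simp
  obtain ⟨δ', hδ', hδ'w⟩ := Metric.continuousAt_iff.1 (hcont.continuousAt (x := ζ)) (ε / 2)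
    (by positivity)
  rw [h0] at hδ'w
  refine ⟨min (δ / 2) δ', by positivity, fun {w} hw hwd => ?_⟩
  rw [hHs ζ hζs]
  rcases (mem_closedBall.1 hw).lt_or_eq with hlt | heq'
  · have hwb : w ∈ ball (0 : ℂ) R := hlt
    have h1 := abs_poissonIntegral_sub_le hφ hB hζs (ε := ε / 2) (by positivity) hδ
      (fun z hz hzd => by
        have := hδφ hz hzd
        rw [Real.dist_eq] at this; exact this.le) hwb
      (hwd.le.trans (min_le_left _ _))
    have h2 := hδ'w (hwd.trans_le (min_le_right _ _))
    rw [Real.dist_eq, sub_zero] at h2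
    have h3 := le_abs_self ((R ^ 2 - ‖w‖ ^ 2) / (δ / 2) ^ 2 * (2 * B))
    simp only [hH, if_pos hwb, Real.dist_eq, hP]
    linarith
  · rw [hHs w heq']
    have := hδφ (show w ∈ sphere (0 : ℂ) R from heq')
      (hwd.trans_le ((min_le_left _ _).trans (by linarith)))
    linarith

end Poisson

theorem harmonicAt_comp_sub {f : Plane → ℝ} {x c : Plane} (h : HarmonicAt f (x - c)) :
    HarmonicAt (fun y => f (y - c)) x := by
  have hc : Tendsto (fun y : Plane => y - c) (𝓝 x) (𝓝 (x - c)) :=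
    (continuous_id.sub continuous_const).tendsto x
  refine ⟨h.1.comp x (by fun_prop), ?_⟩
  filter_upwards [hc.eventually h.2] with y hy
  rw [laplacian_eq_iteratedFDeriv_stdOrthonormalBasis] at hy ⊢
  simp only [iteratedFDeriv_comp_sub]
  simpa using hy

theorem exists_dirichlet (c : Plane) {R : ℝ} (hR : 0 < R) {φ : Plane → ℝ}
    (hφ : ContinuousOn φ (sphere c R)) :
    ∃ H : Plane → ℝ, ContinuousOn H (closedBall c R) ∧ (∀ w ∈ ball c R, HarmonicAt H w) ∧
      ∀ z ∈ sphere c R, H z = φ z := by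
  obtain ⟨H, h1, h2, h3⟩ := exists_dirichlet_complex (φ := fun z => φ (c + toPlane z))
    (hφ.comp (by fun_prop) fun z hz => by simpa using hz)
  have hn : ∀ x : Plane, ‖toPlane.symm (x - c)‖ = dist x c := fun x => by
    rw [LinearIsometryEquiv.norm_map, dist_eq_norm]
  refine ⟨fun x => H (toPlane.symm (x - c)), ?_, ?_, ?_⟩
  · refine h1.comp (by fun_prop) fun x hx => ?_
    rw [mem_closedBall, dist_zero_right, hn]; exact hx
  · intro w hw
    refine harmonicAt_comp_sub (f := H ∘ toPlane.symm) (harmonicAt_comp_isometry toPlane.symm ?_)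
    apply h2
    rw [mem_ball, dist_zero_right, hn]; exact hw
  · intro z hz
    change H (toPlane.symm (z - c)) = φ z
    rw [h3]
    · simp
    · rw [mem_sphere, dist_zero_right, hn]; exact hz

/-! ### Circle averages -/

/-- The unit vector at angle `θ`. -/
noncomputable def dir (θ : ℝ) : Plane := toPlane (Complex.exp (θ * Complex.I))

theorem norm_dir (θ : ℝ) : ‖dir θ‖ = 1 := by
  rw [dir, LinearIsometryEquiv.norm_map, Complex.norm_exp_ofReal_mul_I]

theorem continuous_dir : Continuous dir := by
  unfold dir; fun_prop

theorem dir_add_pi (θ : ℝ) : dir (θ + Real.pi) = -dir θ := by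
  unfold dir
  rw [← map_neg]
  congr 1
  push_cast
  rw [add_mul, Complex.exp_add, Complex.exp_pi_mul_I]; ring

/-- The average of `v` over the circle of radius `t` about `x`. -/
noncomputable def circAvg (v : Plane → ℝ) (x : Plane) (t : ℝ) : ℝ :=
  (2 * Real.pi)⁻¹ * ∫ θ in (0 : ℝ)..2 * Real.pi, v (x + t • dir θ)

theorem circAvg_eq_circleAverage (v : Plane → ℝ) (x : Plane) (t : ℝ) :
    circAvg v x t = Real.circleAverage (v ∘ toPlane) (toPlane.symm x) t := by
  rw [circAvg, Real.circleAverage_def, smul_eq_mul]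
  congr 2
  funext θ
  simp only [Function.comp_apply, circleMap, map_add, LinearIsometryEquiv.apply_symm_apply, dir]
  rw [← map_smul, Complex.real_smul]

theorem add_smul_dir_mem_sphere (x : Plane) {t : ℝ} (ht : 0 ≤ t) (θ : ℝ) :
    x + t • dir θ ∈ sphere x t := by
  rw [mem_sphere, dist_eq_norm, add_sub_cancel_left, norm_smul, norm_dir, mul_one,
    Real.norm_of_nonneg ht]

theorem circAvg_congr {v w : Plane → ℝ} {x : Plane} {t : ℝ} (ht : 0 ≤ t)
    (h : ∀ y ∈ sphere x t, v y = w y) : circAvg v x t = circAvg w x t := by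
  unfold circAvg
  congr 2
  funext θ
  exact h _ (add_smul_dir_mem_sphere x ht θ)

/-! ### Harnack's inequality and harmonic majorants -/

section Harnack

variable {H : Plane → ℝ} {c : Plane} {R : ℝ}

theorem harmonicContOnCl_comp_toPlane (hc : ContinuousOn H (closedBall c R))
    (hh : ∀ x ∈ ball c R, HarmonicAt H x) :
    HarmonicContOnCl (H ∘ toPlane) (ball (toPlane.symm c) R) := by
  have hd : ∀ z : ℂ, dist (toPlane z) c = dist z (toPlane.symm c) := fun z => by
    conv_lhs => rw [← toPlane.apply_symm_apply c]
    exact toPlane.dist_map _ _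
  refine HarmonicContOnCl.mk_ball (fun z hz => ?_) ?_
  · exact harmonicAt_comp_isometry toPlane (hh _ (by rw [mem_ball, hd]; exact hz))
  · exact hc.comp toPlane.continuous.continuousOn fun z hz => by
      rw [mem_closedBall, hd]; exact hz

theorem circAvg_eq_of_harmonic (hR : 0 < R) (hc : ContinuousOn H (closedBall c R))
    (hh : ∀ x ∈ ball c R, HarmonicAt H x) : circAvg H c R = H c := by
  rw [circAvg_eq_circleAverage]
  have h := harmonicContOnCl_comp_toPlane hc hh
  rw [← abs_of_pos hR] at h
  have h2 := h.circleAverage_eq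
  simpa using h2

/-- Harnack's inequality for functions that are harmonic in a disc and continuous up to its
boundary. -/
theorem harnack (hc : ContinuousOn H (closedBall c R)) (hh : ∀ x ∈ ball c R, HarmonicAt H x)
    (h0 : ∀ x ∈ sphere c R, 0 ≤ H x) {w : Plane} (hw : w ∈ ball c R) :
    (R - dist w c) / (R + dist w c) * circAvg H c R ≤ H w ∧
      H w ≤ (R + dist w c) / (R - dist w c) * circAvg H c R := by
  have hR : 0 < R := pos_of_mem_ball hw
  have hH := harmonicContOnCl_comp_toPlane hc hh
  set c' := toPlane.symm c with hc'
  set w' := toPlane.symm w with hw'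
  have hd : ‖w' - c'‖ = dist w c := by
    rw [hw', hc', ← map_sub, LinearIsometryEquiv.norm_map, dist_eq_norm]
  have hwb : w' ∈ ball c' R := by rw [mem_ball, dist_eq_norm, hd]; exact hw
  have h1 := hH.circleAverage_re_herglotzRieszKernel_smul hwb
  have hHw : (H ∘ toPlane) w' = H w := by simp [hw']
  rw [hHw] at h1
  have hs : ∀ z ∈ sphere c' R, 0 ≤ (H ∘ toPlane) z := fun z hz => h0 _ (by
    rw [mem_sphere] at hz ⊢
    conv_lhs => rw [← toPlane.apply_symm_apply c]
    rw [toPlane.dist_map]; exact hz)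
  have hcs : ContinuousOn (H ∘ toPlane) (sphere c' R) :=
    hH.continuousOn_ball.mono sphere_subset_closedBall
  have hk : ContinuousOn ((Complex.re ∘ herglotzRieszKernel c' w') • (H ∘ toPlane))
      (sphere c' R) := by
    have := continuousOn_herglotzRieszKernel_sphere hwb
    rw [abs_of_pos hR] at this
    exact (Complex.continuous_re.comp_continuousOn this).smul hcs
  rw [circAvg_eq_circleAverage, ← h1]
  constructor
  · rw [← smul_eq_mul, ← Real.circleAverage_smul]
    refine Real.circleAverage_mono ((hcs.const_smul _).circleIntegrable hR.le)
      (hk.circleIntegrable hR.le) fun z hz => ?_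
    rw [abs_of_pos hR] at hz
    have := le_re_herglotzRieszKernel hz hwb
    rw [hd] at this
    simp only [Pi.smul_apply, Pi.smul_apply', smul_eq_mul, Function.comp_apply,
      herglotzRieszKernel_def]
    exact mul_le_mul_of_nonneg_right this (hs z hz)
  · rw [← smul_eq_mul, ← Real.circleAverage_smul]
    refine Real.circleAverage_mono (hk.circleIntegrable hR.le)
      ((hcs.const_smul _).circleIntegrable hR.le) fun z hz => ?_
    rw [abs_of_pos hR] at hz
    have := re_herglotzRieszKernel_le hz hwb
    rw [hd] at this
    simp only [Pi.smul_apply, Pi.smul_apply', smul_eq_mul, Function.comp_apply,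
      herglotzRieszKernel_def]
    exact mul_le_mul_of_nonneg_right this (hs z hz)

/-- A nonnegative continuous function that is viscosity subharmonic where it is positive is
dominated by its harmonic replacement. -/
theorem exists_harmonic_majorant {v : Plane → ℝ} (hR : 0 < R) (hc : ContinuousOn v (closedBall c R))
    (hv0 : ∀ x ∈ closedBall c R, 0 ≤ v x)
    (hsub : ViscositySubharmonicOn v {x ∈ ball c R | 0 < v x}) :
    ∃ H : Plane → ℝ, ContinuousOn H (closedBall c R) ∧ (∀ w ∈ ball c R, HarmonicAt H w) ∧
      (∀ z ∈ sphere c R, H z = v z) ∧ (∀ z ∈ closedBall c R, v z ≤ H z) ∧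
      circAvg H c R = circAvg v c R := by
  obtain ⟨H, h1, h2, h3⟩ := exists_dirichlet c hR (hc.mono sphere_subset_closedBall)
  have havg := circAvg_congr hR.le h3
  refine ⟨H, h1, h2, h3, ?_, havg⟩
  have hs : ∀ x ∈ sphere c R, 0 ≤ H x := fun x hx => by
    rw [h3 x hx]; exact hv0 x (sphere_subset_closedBall hx)
  have hA : 0 ≤ circAvg H c R := by
    rw [circAvg]
    exact mul_nonneg (by positivity) (intervalIntegral.integral_nonneg (by positivity)
      fun θ _ => hs _ (add_smul_dir_mem_sphere c hR.le θ))
  -- Because H is nonnegative, v is positive wherever it exceeds H, so subharmonicity on {v > 0}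
  -- suffices for the comparison.
  have hH0 : ∀ x ∈ ball c R, 0 ≤ H x := fun x hx => by
    have hx' : dist x c < R := hx
    exact le_trans (mul_nonneg (div_nonneg (by linarith) (by positivity)) hA)
      (harnack h1 h2 hs hx).1
  have h4 := ViscositySubharmonicOn.le_of_frontier (O := ball c R) (v := v) (w := H) isOpen_ball
    isBounded_ball (by rwa [closure_ball c hR.ne']) (by rwa [closure_ball c hR.ne'])
    (hsub.mono fun x hx => ⟨hx.1, (hH0 x hx.1).trans_lt hx.2⟩) (fun x hx => (h2 x hx).1)
    (fun x hx => (HarmonicAt.laplacian_eq_zero (h2 x hx)).le)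
    (by rw [frontier_ball c hR.ne']; exact fun x hx => (h3 x hx).ge)
  rwa [closure_ball c hR.ne'] at h4

theorem subharmonic_le_circAvg {v : Plane → ℝ} (hR : 0 < R) (hc : ContinuousOn v (closedBall c R))
    (hv0 : ∀ x ∈ closedBall c R, 0 ≤ v x)
    (hsub : ViscositySubharmonicOn v {x ∈ ball c R | 0 < v x}) {w : Plane} (hw : w ∈ ball c R) :
    v w ≤ (R + dist w c) / (R - dist w c) * circAvg v c R := by
  obtain ⟨H, h1, h2, h3, h4, h5⟩ := exists_harmonic_majorant hR hc hv0 hsub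
  rw [← h5]
  exact (h4 w (ball_subset_closedBall hw)).trans (harnack h1 h2 (fun x hx => by
    rw [h3 x hx]; exact hv0 x (sphere_subset_closedBall hx)) hw).2

end Harnack

end FreeBoundary

namespace FreeBoundary

open InnerProductSpace Laplacian

/-! ### The family of subsolutions below a barrier -/

/-- The standing assumptions on the domain, the data and the barrier `h`. -/
structure Admissible (D : Set Plane) (f g h : Plane → ℝ) (lam Lam : ℝ) : Prop where
  isOpen : IsOpen D
  isConnected : IsConnected D
  lam_pos : 0 < lam
  f_cont : Continuous f
  lam_lt : ∀ x, lam < f x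
  lt_Lam : ∀ x, f x < Lam
  g_cont : ContinuousOn g (frontier D)
  g_pos : ∀ x ∈ frontier D, 0 < g x
  g_le_h : ∀ x ∈ frontier D, g x ≤ h x
  h_nonneg : ∀ x, 0 ≤ h x
  h_cont : ContinuousOn h Dᶜ
  h_harm : ∀ x ∉ closure D, 0 < h x → HarmonicAt h x
  h_bdd : ∃ B, ∀ x ∉ D, h x ≤ B
  h_supp : ∃ R, ∀ x, R ≤ ‖x‖ → h x = 0
  h_slope : ∀ x ∉ closure D, h x = 0 → ∃ (y : Plane) (s : ℝ), 0 < s ∧ dist x y = s ∧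
    Disjoint (ball y s) {z | 0 < h z} ∧ BelowPlane h x (s⁻¹ • (x - y)) √lam

/-- The subsolutions below `h`. -/
def Fam (D : Set Plane) (f g h : Plane → ℝ) : Set (Plane → ℝ) :=
  {v | IsSubsolution D f g v ∧ ∀ y ∉ D, v y ≤ h y}

variable {D : Set Plane} {f g h v w : Plane → ℝ} {lam Lam : ℝ}

theorem BelowPlane.mono {x ν : Plane} {α : ℝ} (hb : BelowPlane v x ν α)
    (hw : ∀ᶠ y in 𝓝 x, w y ≤ v y) : BelowPlane w x ν α := fun ε hε => by
  filter_upwards [hb ε hε, hw] with y h1 h2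
  exact h2.trans h1

theorem BelowPlane.mono_slope {x ν : Plane} {α β : ℝ} (hb : BelowPlane v x ν α) (h : α ≤ β) :
    BelowPlane v x ν β := fun ε hε => by
  filter_upwards [hb ε hε] with y h1
  have : α * max (inner ℝ (y - x) ν) 0 ≤ β * max (inner ℝ (y - x) ν) 0 := by gcongr
  linarith

/-- The slope of a plane lying above a function bounds each of its directional derivatives. -/
theorem BelowPlane.hasDerivAt_le {x ν e : Plane} {α G : ℝ} (hb : BelowPlane w x ν α)
    (hν : ‖ν‖ ≤ 1) (he : ‖e‖ = 1) (hw0 : w x = 0) (hG : 0 < G)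
    (hd : HasDerivAt (fun t : ℝ => w (x + t • e)) G 0) : G ≤ α := by
  have key : G ≤ α * max (inner ℝ e ν) 0 := by
    refine le_of_forall_pos_le_add fun ε hε => ?_
    have h1 := hd.tendsto_slope_zero_right
    have hc : Tendsto (fun s : ℝ => x + s • e) (𝓝[>] 0) (𝓝 x) := by
      have : Continuous (fun s : ℝ => x + s • e) := by fun_prop
      simpa using (this.tendsto 0).mono_left nhdsWithin_le_nhds
    refine le_of_tendsto h1 ?_
    filter_upwards [hc.eventually (hb ε hε), self_mem_nhdsWithin] with t h2 ht
    have ht' : (0 : ℝ) < t := ht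
    simp only [zero_add, zero_smul, add_zero, hw0, sub_zero, smul_eq_mul]
    simp only [add_sub_cancel_left, norm_smul, he, mul_one, Real.norm_of_nonneg ht'.le,
      inner_smul_left] at h2
    have h3 : max (t * inner ℝ e ν) 0 = t * max (inner ℝ e ν) 0 := by
      rw [mul_max_of_nonneg _ _ ht'.le, mul_zero]
    simp only [conj_trivial] at h2
    rw [h3] at h2
    rw [inv_mul_le_iff₀ ht']
    linarith
  have h1 : inner ℝ e ν ≤ 1 := by
    have := real_inner_le_norm e ν
    rw [he, one_mul] at this
    linarith
  have h2 : max (inner ℝ e ν) 0 ≤ (1 : ℝ) := max_le h1 zero_le_one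
  have h3 : (0 : ℝ) ≤ max (inner ℝ e ν) 0 := le_max_right _ _
  have hα : 0 ≤ α := by
    by_contra! hα
    nlinarith
  nlinarith

theorem compl_mem_nhds_of_notMem_closure {x : Plane} (hx : x ∉ closure D) : Dᶜ ∈ 𝓝 x :=
  mem_of_superset (isClosed_closure.isOpen_compl.mem_nhds hx)
    (compl_subset_compl.2 subset_closure)

theorem notMem_of_mem_frontier (hD : IsOpen D) {x : Plane} (hx : x ∈ frontier D) : x ∉ D := by
  rw [hD.frontier_eq] at hx
  exact hx.2

theorem mem_frontier_of (hD : IsOpen D) {x : Plane} (hx : x ∉ D) (hx' : x ∈ closure D) :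
    x ∈ frontier D := by
  rw [hD.frontier_eq]
  exact ⟨hx', hx⟩

theorem eventually_mem_posSet {x : Plane} (hv : ContinuousOn v Dᶜ) (hx : x ∉ closure D)
    (h0 : 0 < v x) : ∀ᶠ y in 𝓝 x, y ∈ posSet D v := by
  have h1 := compl_mem_nhds_of_notMem_closure hx
  filter_upwards [h1, (hv.continuousAt h1).eventually (lt_mem_nhds h0)] with y h2 h3
  exact ⟨h2, h3⟩

theorem notMem_posSet_of_mem_frontier {x : Plane} (hv : ContinuousOn v Dᶜ) (hx : x ∉ closure D)
    (hfr : x ∈ frontier (posSet D v)) : x ∉ posSet D v := fun hmem =>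
  hfr.2 (mem_interior_iff_mem_nhds.2 (eventually_mem_posSet hv hx hmem.2))

theorem zero_mem_Fam (A : Admissible D f g h lam Lam) : (fun _ => 0) ∈ Fam D f g h := by
  have hempty : posSet D (fun _ => 0) = ∅ := by
    ext x; simp [posSet]
  refine ⟨⟨continuousOn_const, fun _ _ => le_rfl, ?_, fun x hx => (A.g_pos x hx).le, ?_⟩,
    fun y _ => A.h_nonneg y⟩
  · intro x hx; rw [hempty] at hx; simp at hx
  · intro x hx; rw [hempty] at hx; simp at hx

/-- Gluing a function `w`, defined on an open set `O`, to a subsolution by taking the maximum. -/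
theorem glue_mem_Fam {O : Set Plane} [∀ x, Decidable (x ∈ O)] (hO : IsOpen O)
    (hv : v ∈ Fam D f g h)
    (hwc : ContinuousOn w (closure O \ D)) (hfr : ∀ x ∈ frontier O, x ∉ D → w x ≤ v x)
    (hg : ∀ x ∈ O, x ∈ frontier D → w x ≤ g x) (hh : ∀ x ∈ O, x ∉ D → w x ≤ h x)
    (hsub : ViscositySubharmonicOn w {x ∈ O | x ∉ closure D ∧ 0 < w x})
    (hout : ∀ x ∈ frontier O, x ∉ closure D → w x < 0 ∨ x ∈ closure (posSet D v))
    (hfb : ∀ x ∈ O, x ∉ closure D → x ∉ closure (posSet D v) → w x = 0 →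
      x ∈ closure {z ∈ O | z ∉ D ∧ 0 < w z} →
      ∀ (y : Plane) (s : ℝ), 0 < s → dist x y = s →
        Disjoint (ball y s) {z ∈ O | z ∉ D ∧ 0 < w z} →
        ∀ α : ℝ, BelowPlane w x (s⁻¹ • (x - y)) α → √(f x) ≤ α) :
    (fun x => if x ∈ O then max (v x) (w x) else v x) ∈ Fam D f g h := by
  set v' : Plane → ℝ := fun x => if x ∈ O then max (v x) (w x) else v x with hv'
  have hle : ∀ x, v x ≤ v' x := fun x => by
    simp only [hv']; split_ifs
    · exact le_max_left _ _
    · exact le_rfl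
  have hlew : ∀ x ∈ O, w x ≤ v' x := fun x hx => by
    simp only [hv', if_pos hx]; exact le_max_right _ _
  have hcont : ContinuousOn v' Dᶜ := by
    refine ContinuousOn.if (p := fun x => x ∈ O) ?_ ?_ ?_
    · rintro a ⟨ha, ha'⟩
      exact max_eq_left (hfr a ha' ha)
    · refine ContinuousOn.sup (hv.1.continuousOn.mono inter_subset_left) (hwc.mono ?_)
      rintro x ⟨h1, h2⟩
      exact ⟨h2, h1⟩
    · exact hv.1.continuousOn.mono inter_subset_left
  refine ⟨⟨hcont, fun x hx => (hv.1.nonneg x hx).trans (hle x), ?_, ?_, ?_⟩, ?_⟩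
  · rintro x ⟨⟨hxD, hx0⟩, hxc⟩ φ hφ hmax
    by_cases hcase : v' x = v x
    · refine hv.1.subharmonic x ⟨⟨hxD, hcase ▸ hx0⟩, hxc⟩ φ hφ ?_
      filter_upwards [hmax] with y hy
      linarith [hle y]
    · have hxO : x ∈ O := by
        by_contra hn
        exact hcase (by simp only [hv', if_neg hn])
      have hxw : v' x = w x := by
        simp only [hv', if_pos hxO] at hcase ⊢
        exact (max_choice (v x) (w x)).resolve_left hcase
      refine hsub x ⟨hxO, hxc, hxw ▸ hx0⟩ φ hφ ?_
      filter_upwards [hmax, hO.mem_nhds hxO] with y hy hyO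
      linarith [hlew y hyO]
  · intro x hx
    simp only [hv']; split_ifs with hxO
    · exact max_le (hv.1.le_boundary x hx) (hg x hxO hx)
    · exact hv.1.le_boundary x hx
  · rintro x ⟨hxfr, hxc⟩ y s hs hxy hdisj α hb
    have hxn : x ∉ posSet D v' := notMem_posSet_of_mem_frontier hcont hxc hxfr
    have hsubset : posSet D v ⊆ posSet D v' := fun z hz => ⟨hz.1, hz.2.trans_le (hle z)⟩
    have hsubset' : {z ∈ O | z ∉ D ∧ 0 < w z} ⊆ posSet D v' :=
      fun z hz => ⟨hz.2.1, hz.2.2.trans_le (hlew z hz.1)⟩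
    have hxD : x ∉ D := fun h => hxc (subset_closure h)
    -- If x is a limit of Ω(v), both the tangent ball and the plane pass from the glued function to
    -- v, whose own condition applies. Otherwise x is a limit of positivity points of w in O; `hfb`
    -- treats x ∈ O, and `hout` excludes x ∈ ∂O.
    by_cases hxv : x ∈ closure (posSet D v)
    · exact hv.1.freeBoundary x ⟨⟨hxv, fun hi => hxn (hsubset (interior_subset hi))⟩, hxc⟩ y s hs
        hxy (hdisj.mono_right hsubset) α (hb.mono (Eventually.of_forall hle))
    have hcover : posSet D v' ⊆ posSet D v ∪ {z ∈ O | z ∉ D ∧ 0 < w z} := by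
      rintro z ⟨hzD, hz0⟩
      by_cases hzO : z ∈ O
      · simp only [hv', if_pos hzO, lt_max_iff] at hz0
        exact hz0.imp (fun h => ⟨hzD, h⟩) fun h => ⟨hzO, hzD, h⟩
      · simp only [hv', if_neg hzO] at hz0
        exact Or.inl ⟨hzD, hz0⟩
    have hxW : x ∈ closure {z ∈ O | z ∉ D ∧ 0 < w z} := by
      have := closure_mono hcover hxfr.1
      rw [closure_union] at this
      exact this.resolve_left hxv
    have hxclO : x ∈ closure O := closure_mono (fun z hz => hz.1) hxW
    have hw0 : 0 ≤ w x := by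
      by_contra! hneg
      have h1 := (hwc x ⟨hxclO, hxD⟩).eventually (gt_mem_nhds hneg)
      have h2 : ∃ᶠ z in 𝓝[closure O \ D] x, z ∈ {z ∈ O | z ∉ D ∧ 0 < w z} := by
        rw [mem_closure_iff_frequently] at hxW
        rw [nhdsWithin, frequently_inf_principal]
        exact hxW.mono fun z hz => ⟨⟨subset_closure hz.1, hz.2.1⟩, hz⟩
      obtain ⟨z, hz1, hz2⟩ := (h2.and_eventually h1).exists
      exact absurd hz1.2.2 (not_lt.2 hz2.le)
    by_cases hxO : x ∈ O
    · have hw0' : w x = 0 := le_antisymm (not_lt.1 fun hlt => hxn (hsubset' ⟨hxO, hxD, hlt⟩)) hw0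
      refine hfb x hxO hxc hxv hw0' hxW y s hs hxy (hdisj.mono_right hsubset') α (hb.mono ?_)
      filter_upwards [hO.mem_nhds hxO] with z hz using hlew z hz
    · have hxfrO : x ∈ frontier O := by rw [hO.frontier_eq]; exact ⟨hxclO, hxO⟩
      rcases hout x hxfrO hxc with h1 | h1
      · linarith
      · exact absurd h1 hxv
  · intro x hx
    simp only [hv']; split_ifs with hxO
    · exact max_le (hv.2 x hx) (hh x hxO hx)
    · exact hv.2 x hx

theorem max_mem_Fam (hv : v ∈ Fam D f g h) (hw : w ∈ Fam D f g h) :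
    (fun x => max (v x) (w x)) ∈ Fam D f g h := by
  classical
  have := glue_mem_Fam (O := univ) isOpen_univ hv (w := w)
    (hw.1.continuousOn.mono fun x hx => hx.2) (by simp) (fun x _ hx => hw.1.le_boundary x hx)
    (fun x _ hx => hw.2 x hx)
    (hw.1.subharmonic.mono fun x hx => ⟨⟨fun h => hx.2.1 (subset_closure h), hx.2.2⟩, hx.2.1⟩)
    (by simp) (by
      intro x _ hxc _ hx0 hxcl y s hs hxy hdisj α hb
      have heq : {z | z ∈ (univ : Set Plane) ∧ z ∉ D ∧ 0 < w z} = posSet D w := by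
        ext z; simp [posSet]
      rw [heq] at hxcl hdisj
      refine hw.1.freeBoundary x ⟨⟨hxcl, fun hi => ?_⟩, hxc⟩ y s hs hxy hdisj α hb
      have := (interior_subset hi).2
      linarith)
  simpa using this

/-- A subsolution that is harmonic near the part of its support lying on the sphere may be replaced
by its harmonic extension in a disc away from `D`. -/
theorem exists_harmonic_replacement (A : Admissible D f g h lam Lam) (hv : v ∈ Fam D f g h)
    {c : Plane} {R : ℝ} (hR : 0 < R) (hdisj : Disjoint (closedBall c R) (closure D))
    (hpos : ∀ x ∈ closedBall c R, 0 < h x)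
    (hs : ∀ x ∈ sphere c R, x ∈ closure (posSet D v)) :
    ∃ v' ∈ Fam D f g h, (∀ x ∉ D, v x ≤ v' x) ∧ ContinuousOn v' (closedBall c R) ∧
      (∀ x ∈ ball c R, HarmonicAt v' x) ∧ (∀ x ∈ sphere c R, v' x = v x) ∧
      circAvg v' c R = circAvg v c R := by
  classical
  have hnD : ∀ x ∈ closedBall c R, x ∉ closure D := fun x hx h => hdisj.ne_of_mem hx h rfl
  have hnD' : closedBall c R ⊆ Dᶜ := fun x hx h => hnD x hx (subset_closure h)
  have hvc : ContinuousOn v (closedBall c R) := hv.1.continuousOn.mono hnD'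
  obtain ⟨H, h1, h2, h3, h4, h5⟩ := exists_harmonic_majorant hR hvc
    (fun x hx => hv.1.nonneg x (hnD' hx)) (hv.1.subharmonic.mono fun x hx =>
      ⟨⟨hnD' (ball_subset_closedBall hx.1), hx.2⟩, hnD x (ball_subset_closedBall hx.1)⟩)
  have hH0 : ∀ x ∈ closedBall c R, 0 ≤ H x := fun x hx => (hv.1.nonneg x (hnD' hx)).trans (h4 x hx)
  have hHs0 : ∀ x ∈ sphere c R, 0 ≤ H x := fun x hx => hH0 x (sphere_subset_closedBall hx)
  have hHh : ∀ x ∈ closedBall c R, H x ≤ h x := by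
    have := ViscositySubharmonicOn.le_of_frontier (O := ball c R) (v := H) (w := h) isOpen_ball
      isBounded_ball (by rwa [closure_ball c hR.ne'])
      (by rw [closure_ball c hR.ne']; exact A.h_cont.mono hnD')
      (viscositySubharmonicOn_of_harmonic fun x hx => h2 x hx.1)
      (fun x hx => (A.h_harm x (hnD x (ball_subset_closedBall hx))
        (hpos x (ball_subset_closedBall hx))).1)
      (fun x hx => (HarmonicAt.laplacian_eq_zero (A.h_harm x (hnD x (ball_subset_closedBall hx))
        (hpos x (ball_subset_closedBall hx)))).le)
      (by
        rw [frontier_ball c hR.ne']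
        intro x hx
        rw [h3 x hx]
        exact hv.2 x (hnD' (sphere_subset_closedBall hx)))
    rwa [closure_ball c hR.ne'] at this
  have hmem := glue_mem_Fam (O := ball c R) isOpen_ball hv (w := H)
    (by rw [closure_ball c hR.ne']; exact h1.mono sdiff_subset)
    (by rw [frontier_ball c hR.ne']; exact fun x hx _ => (h3 x hx).le)
    (fun x hx hx' => absurd (frontier_subset_closure hx') (hnD x (ball_subset_closedBall hx)))
    (fun x hx _ => hHh x (ball_subset_closedBall hx))
    (viscositySubharmonicOn_of_harmonic fun x hx => h2 x hx.1)
    (by rw [frontier_ball c hR.ne']; exact fun x hx _ => Or.inr (hs x hx))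
    (by
      intro x hx _ _ hx0 hxcl
      -- By Harnack a zero of H inside the disc forces the circular average, and then H, to vanish
      -- throughout, so no free boundary is created in the disc.
      exfalso
      have hx' : dist x c < R := hx
      have hlow := (harnack h1 h2 hHs0 hx).1
      rw [hx0] at hlow
      have hk : 0 < (R - dist x c) / (R + dist x c) := div_pos (by linarith) (by positivity)
      have hA : circAvg H c R ≤ 0 := by
        by_contra! hn
        nlinarith [mul_pos hk hn]
      have hempty : {z | z ∈ ball c R ∧ z ∉ D ∧ 0 < H z} = ∅ := by
        ext z
        simp only [Set.mem_ofPred_eq, mem_empty_iff_false, iff_false, not_and, not_lt]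
        intro hz _
        have hz' : dist z c < R := hz
        refine (harnack h1 h2 hHs0 hz).2.trans (mul_nonpos_of_nonneg_of_nonpos
          (div_nonneg (by positivity) (by linarith)) hA)
      rw [hempty] at hxcl
      simp at hxcl)
  have heq : ∀ x ∈ closedBall c R,
      (fun x => if x ∈ ball c R then max (v x) (H x) else v x) x = H x := by
    intro x hx
    by_cases hxb : x ∈ ball c R
    · simp only [if_pos hxb]; exact max_eq_right (h4 x hx)
    · have hxs : x ∈ sphere c R := by
        rw [← closedBall_sdiff_ball]; exact ⟨hx, hxb⟩
      simp only [if_neg hxb]; exact (h3 x hxs).symm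
  refine ⟨_, hmem, ?_, h1.congr heq, ?_, ?_, ?_⟩
  · intro x _
    split_ifs
    · exact le_max_left _ _
    · exact le_rfl
  · intro x hx
    refine (harmonicAt_congr_nhds ?_).1 (h2 x hx)
    filter_upwards [isOpen_ball.mem_nhds hx] with y hy
    exact (heq y (ball_subset_closedBall hy)).symm
  · intro x hx
    exact (heq x (sphere_subset_closedBall hx)).trans (h3 x hx)
  · rw [← h5]
    exact circAvg_congr hR.le fun y hy => heq y (sphere_subset_closedBall hy)

end FreeBoundary

namespace FreeBoundary

open InnerProductSpace Laplacian

/-! ### The largest subsolution away from `D` -/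

variable {D : Set Plane} {f g h v w : Plane → ℝ} {lam Lam : ℝ}

theorem hasDerivAt_log_norm_line {x z : Plane} (hxz : x ≠ z) (e : Plane) :
    HasDerivAt (fun t : ℝ => Real.log ‖x + t • e - z‖) (inner ℝ (x - z) e / ‖x - z‖ ^ 2) 0 := by
  have h1 : HasDerivAt (fun t : ℝ => x + t • e - z) e 0 := by
    simpa using (((hasDerivAt_id (0 : ℝ)).smul_const e).const_add x).sub_const z
  have h2 := h1.norm_sq
  have hne : ‖x + (0 : ℝ) • e - z‖ ^ 2 ≠ 0 := by
    simpa [sub_eq_zero] using hxz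
  have h3 := (h2.log hne).const_mul (1 / 2 : ℝ)
  have h4 : (fun t : ℝ => Real.log ‖x + t • e - z‖) =
      fun t : ℝ => 1 / 2 * Real.log (‖x + t • e - z‖ ^ 2) := by
    funext t
    rw [Real.log_pow]; push_cast; ring
  rw [h4]
  refine h3.congr_deriv ?_
  simp only [zero_smul, add_zero]
  ring

local notation "𝓤" => largestSubsolution

theorem bddAbove_values (x : Plane) (hx : x ∉ D) :
    BddAbove {t : ℝ | ∃ v : Plane → ℝ, IsSubsolution D f g v ∧ (∀ y ∉ D, v y ≤ h y) ∧ v x = t} :=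
  ⟨h x, by rintro t ⟨v, _, h2, rfl⟩; exact h2 x hx⟩

theorem le_largest (hv : v ∈ Fam D f g h) {x : Plane} (hx : x ∉ D) : v x ≤ 𝓤 D f g h x :=
  le_csSup (bddAbove_values x hx) ⟨v, hv.1, hv.2, rfl⟩

theorem largest_le (A : Admissible D f g h lam Lam) {x : Plane} {b : ℝ}
    (hb : ∀ v ∈ Fam D f g h, v x ≤ b) : 𝓤 D f g h x ≤ b := by
  have h0 := zero_mem_Fam A
  refine csSup_le ⟨0, _, h0.1, h0.2, rfl⟩ ?_
  rintro t ⟨v, h1, h2, rfl⟩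
  exact hb v ⟨h1, h2⟩

theorem largest_le_barrier (A : Admissible D f g h lam Lam) {x : Plane} (hx : x ∉ D) :
    𝓤 D f g h x ≤ h x := largest_le A fun _ hv => hv.2 x hx

theorem largest_nonneg (A : Admissible D f g h lam Lam) {x : Plane} (hx : x ∉ D) :
    0 ≤ 𝓤 D f g h x := le_largest (zero_mem_Fam A) hx

theorem exists_lt_of_lt_largest (A : Admissible D f g h lam Lam) {x : Plane} {b : ℝ}
    (hb : b < 𝓤 D f g h x) : ∃ v ∈ Fam D f g h, b < v x := by
  by_contra! hn
  exact absurd (largest_le A hn) (not_le.2 hb)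

theorem posSet_subset_largest (hv : v ∈ Fam D f g h) : posSet D v ⊆ posSet D (𝓤 D f g h) :=
  fun _ hx => ⟨hx.1, hx.2.trans_le (le_largest hv hx.1)⟩

theorem eventually_mem_posSet_largest (A : Admissible D f g h lam Lam) {x : Plane}
    (hx : x ∉ closure D) (h0 : 0 < 𝓤 D f g h x) : ∀ᶠ y in 𝓝 x, y ∈ posSet D (𝓤 D f g h) := by
  obtain ⟨v, hv, hv0⟩ := exists_lt_of_lt_largest A h0
  filter_upwards [eventually_mem_posSet hv.1.continuousOn hx hv0] with y hy
  exact posSet_subset_largest hv hy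

/-- Compactness: each point of K has a neighbourhood on which some member is positive, finitely many
of these cover K, and maxima stay in the family. -/
theorem exists_mem_Fam_posSet (A : Admissible D f g h lam Lam) (hv : v ∈ Fam D f g h)
    {K : Set Plane} (hK : IsCompact K) (hKD : Disjoint K (closure D))
    (hKu : K ⊆ posSet D (𝓤 D f g h)) :
    ∃ w ∈ Fam D f g h, (∀ x, v x ≤ w x) ∧ K ⊆ posSet D w := by
  refine hK.induction_on (p := fun K => ∃ w ∈ Fam D f g h, (∀ x, v x ≤ w x) ∧ K ⊆ posSet D w)
    ?_ ?_ ?_ ?_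
  · exact ⟨v, hv, fun _ => le_rfl, empty_subset _⟩
  · rintro s t hst ⟨w, h1, h2, h3⟩
    exact ⟨w, h1, h2, hst.trans h3⟩
  · rintro s t ⟨w, h1, h2, h3⟩ ⟨w', h1', h2', h3'⟩
    refine ⟨_, max_mem_Fam h1 h1', fun x => (h2 x).trans (le_max_left _ _), ?_⟩
    rintro x (hx | hx)
    · exact ⟨(h3 hx).1, (h3 hx).2.trans_le (le_max_left _ _)⟩
    · exact ⟨(h3' hx).1, (h3' hx).2.trans_le (le_max_right _ _)⟩
  · intro x hx
    obtain ⟨w, hw, hw0⟩ := exists_lt_of_lt_largest A (hKu hx).2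
    have hm := max_mem_Fam hv hw
    refine ⟨posSet D w, ?_, _, hm, fun x => le_max_left _ _, ?_⟩
    · exact mem_nhdsWithin_of_mem_nhds (eventually_mem_posSet hw.1.continuousOn
        (fun h => hKD.ne_of_mem hx h rfl) hw0)
    · exact fun y hy => ⟨hy.1, hy.2.trans_le (le_max_right _ _)⟩

/-- In a disc where `u` is positive every subsolution lies below a harmonic one. -/
theorem exists_harmonic_in_disc (A : Admissible D f g h lam Lam) (hv : v ∈ Fam D f g h)
    {c : Plane} {R : ℝ} (hR : 0 < R) (hdisj : Disjoint (closedBall c R) (closure D))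
    (hu : closedBall c R ⊆ posSet D (𝓤 D f g h)) :
    ∃ w ∈ Fam D f g h, (∀ x ∉ D, v x ≤ w x) ∧ ∀ y ∈ ball c R,
      (R - dist y c) / (R + dist y c) * w c ≤ w y ∧
      (R - dist y c) / (R + dist y c) * w y ≤ w c := by
  obtain ⟨v1, h1, h2, h3⟩ := exists_mem_Fam_posSet A hv (isCompact_closedBall c R) hdisj hu
  obtain ⟨w, hw, hvw, hwc, hwh, hws, -⟩ := exists_harmonic_replacement A h1 hR hdisj
    (fun x hx => (h3 hx).2.trans_le (h1.2 x (h3 hx).1))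
    (fun x hx => subset_closure (h3 (sphere_subset_closedBall hx)))
  refine ⟨w, hw, fun x hx => (h2 x).trans (hvw x hx), fun y hy => ?_⟩
  have hy' : dist y c < R := hy
  have := harnack hwc hwh (fun x hx => by
    rw [hws x hx]; exact (h3 (sphere_subset_closedBall hx)).2.le) hy
  rw [circAvg_eq_of_harmonic hR hwc hwh] at this
  refine ⟨this.1, ?_⟩
  have hpos : 0 < R + dist y c := by positivity
  rw [div_mul_eq_mul_div, div_le_iff₀ hpos]
  have := this.2
  rw [div_mul_eq_mul_div, le_div_iff₀ (by linarith)] at this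
  linarith

/-- The constants of `exists_harmonic_in_disc` do not depend on the member, so they survive the
supremum. -/
theorem largest_harnack (A : Admissible D f g h lam Lam) {c : Plane} {R : ℝ} (hR : 0 < R)
    (hdisj : Disjoint (closedBall c R) (closure D))
    (hu : closedBall c R ⊆ posSet D (𝓤 D f g h)) {y : Plane} (hy : y ∈ ball c R) :
    (R - dist y c) / (R + dist y c) * 𝓤 D f g h c ≤ 𝓤 D f g h y ∧
      (R - dist y c) / (R + dist y c) * 𝓤 D f g h y ≤ 𝓤 D f g h c := by
  have hy' : dist y c < R := hy
  have hk : 0 < (R - dist y c) / (R + dist y c) := div_pos (by linarith) (by positivity)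
  have hcD : c ∉ D := (hu (mem_closedBall_self hR.le)).1
  have hyD : y ∉ D := (hu (ball_subset_closedBall hy)).1
  constructor
  · rw [mul_comm, ← le_div_iff₀ hk]
    refine largest_le A fun v hv => ?_
    obtain ⟨w, hw, hvw, hwk⟩ := exists_harmonic_in_disc A hv hR hdisj hu
    rw [le_div_iff₀ hk, mul_comm]
    have h1 := (hwk y hy).1
    have h2 := le_largest hw hyD
    nlinarith [hvw c hcD]
  · rw [mul_comm, ← le_div_iff₀ hk]
    refine largest_le A fun v hv => ?_
    obtain ⟨w, hw, hvw, hwk⟩ := exists_harmonic_in_disc A hv hR hdisj hu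
    rw [le_div_iff₀ hk, mul_comm]
    have h1 := (hwk y hy).2
    have h2 := le_largest hw hcD
    nlinarith [hvw y hyD]

theorem disjoint_ball_closure {x : Plane} {r : ℝ} (hd : Disjoint (ball x r) D) :
    Disjoint (ball x r) (closure D) :=
  hd.closure_right isOpen_ball

theorem log_sixteen_lt : Real.log 16 < 2.8 := by
  have : (16 : ℝ) = 2 ^ 4 := by norm_num
  rw [this, Real.log_pow]
  have := Real.log_two_lt_d9
  push_cast
  linarith

/-- A subsolution that is large at the centre of an annulus can be enlarged by a logarithm. -/
theorem exists_pos_of_large (A : Admissible D f g h lam Lam) {x : Plane} {e : ℝ} (he : 0 < e)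
    (hD : Disjoint (ball x (4 * e)) D) (hh : ∀ y ∈ ball x (3 * e), 6 * √Lam * e ≤ h y)
    (hv : v ∈ Fam D f g h)
    (hlow : ∀ y ∈ closedBall x (e / 8), 6 * √Lam * e ≤ v y) :
    ∃ v' ∈ Fam D f g h, ∀ y ∈ ball x (2 * e), e / 8 < dist y x → 0 < v' y := by
  classical
  have hLam : 0 < Lam := A.lam_pos.trans ((A.lam_lt 0).trans (A.lt_Lam 0))
  have hsL : 0 < √Lam := Real.sqrt_pos.2 hLam
  have hDc := disjoint_ball_closure hD
  set O : Set Plane := ball x (3 * e) \ closedBall x (e / 8) with hO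
  have hOo : IsOpen O := isOpen_ball.sdiff isClosed_closedBall
  -- The slope on the zero circle |y - x| = 2e is √Lam, enough for the free boundary condition. At
  -- radius e/8 the value is 2e√Lam ln 16 < 6√Lam e, so w stays below v on the inner circle.
  set w : Plane → ℝ := fun y => 2 * e * √Lam * (Real.log (2 * e) - Real.log ‖y - x‖) with hw
  have hclO : ∀ y ∈ closure O, e / 8 ≤ dist y x ∧ dist y x ≤ 3 * e := by
    have hcl : IsClosed ((fun y : Plane => dist y x) ⁻¹' Icc (e / 8) (3 * e)) :=
      isClosed_Icc.preimage (by fun_prop)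
    refine closure_minimal (t := (fun y : Plane => dist y x) ⁻¹' Icc (e / 8) (3 * e)) ?_ hcl
    rintro y ⟨h1, h2⟩
    simp only [mem_ball, mem_closedBall, not_le] at h1 h2
    exact ⟨h2.le, h1.le⟩
  have hfrO : ∀ y ∈ frontier O, dist y x = e / 8 ∨ dist y x = 3 * e := by
    intro y hy
    rw [hOo.frontier_eq] at hy
    obtain ⟨h1, h2⟩ := hclO y hy.1
    by_contra! hn
    exact hy.2 ⟨lt_of_le_of_ne h2 hn.2, not_le.2 (lt_of_le_of_ne h1 (Ne.symm hn.1))⟩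
  have hnD : ∀ y, dist y x ≤ 3 * e → y ∉ closure D := fun y hy hyD =>
    hDc.ne_of_mem (show y ∈ ball x (4 * e) by rw [mem_ball]; linarith) hyD rfl
  have hne : ∀ y, e / 8 ≤ dist y x → y ≠ x := by
    rintro y hy rfl
    rw [dist_self] at hy; linarith
  have hwle : ∀ y, e / 8 ≤ dist y x → w y ≤ 6 * √Lam * e := by
    intro y hy
    have h1 : Real.log (2 * e) - Real.log ‖y - x‖ ≤ Real.log 16 := by
      rw [← dist_eq_norm, ← Real.log_div (by positivity) (by linarith)]
      apply Real.log_le_log (div_pos (by positivity) (by linarith))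
      rw [div_le_iff₀ (by linarith)]
      linarith
    have h2 := log_sixteen_lt
    have h3 : w y ≤ 2 * e * √Lam * 2.8 := by
      simp only [hw]
      apply mul_le_mul_of_nonneg_left (by linarith) (by positivity)
    nlinarith [mul_pos he hsL]
  have hmem := glue_mem_Fam (O := O) hOo hv (w := w) ?_ ?_ ?_ ?_ ?_ ?_ ?_
  · refine ⟨_, hmem, fun y hy hy' => ?_⟩
    have hyO : y ∈ O := by
      refine ⟨?_, ?_⟩
      · rw [mem_ball] at hy ⊢; linarith
      · rw [mem_closedBall]; linarith
    simp only [if_pos hyO, lt_max_iff]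
    right
    simp only [hw]
    rw [mem_ball, dist_eq_norm] at hy
    rw [dist_eq_norm] at hy'
    have : Real.log ‖y - x‖ < Real.log (2 * e) := Real.log_lt_log (by linarith) hy
    have h1 : 0 < Real.log (2 * e) - Real.log ‖y - x‖ := by linarith
    positivity
  · have : ContinuousOn w {y | y ≠ x} := by
      simp only [hw]
      refine continuousOn_const.mul (continuousOn_const.sub (ContinuousOn.log (by fun_prop) ?_))
      intro y hy
      simpa [sub_eq_zero] using hy
    exact this.mono fun y hy => hne y (hclO y hy.1).1
  · intro y hy hyD
    rcases hfrO y hy with h1 | h1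
    · exact (hwle y h1.ge).trans (hlow y h1.le)
    · refine le_trans ?_ (hv.1.nonneg y hyD)
      simp only [hw, ← dist_eq_norm, h1]
      have : Real.log (2 * e) ≤ Real.log (3 * e) := Real.log_le_log (by positivity) (by linarith)
      exact mul_nonpos_of_nonneg_of_nonpos (by positivity) (by linarith)
  · intro y hy hyD
    exact absurd (frontier_subset_closure hyD) (hnD y (hclO y (subset_closure hy)).2)
  · intro y hy _
    exact (hwle y (hclO y (subset_closure hy)).1).trans (hh y hy.1)
  · refine viscositySubharmonicOn_of_harmonic fun y hy => ?_
    have h1 := harmonicAt_log_norm_sub (hne y (hclO y (subset_closure hy.1)).1)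
    exact ((harmonicAt_const (Real.log (2 * e))).sub h1).const_smul (c := 2 * e * √Lam)
  · intro y hy hyD
    rcases hfrO y hy with h1 | h1
    · right
      apply subset_closure
      refine ⟨fun h => hyD (subset_closure h), lt_of_lt_of_le ?_ (hlow y h1.le)⟩
      positivity
    · left
      simp only [hw, ← dist_eq_norm, h1]
      have : Real.log (2 * e) < Real.log (3 * e) := Real.log_lt_log (by positivity) (by linarith)
      exact mul_neg_of_pos_of_neg (by positivity) (by linarith)
  · intro y hy _ _ hy0 _ z s hs hyz _ α hb
    have hyx := hne y (hclO y (subset_closure hy)).1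
    have hn0 : 0 < ‖y - x‖ := norm_pos_iff.2 (sub_ne_zero.2 hyx)
    have hnorm : ‖y - x‖ = 2 * e := by
      simp only [hw, mul_eq_zero, sub_eq_zero] at hy0
      rcases hy0 with h1 | h1
      · exfalso
        rcases h1 with (h1 | h1) | h1
        · norm_num at h1
        · exact he.ne' h1
        · exact hsL.ne' h1
      · exact Real.log_injOn_pos hn0 (show (0 : ℝ) < 2 * e by positivity) h1.symm
    have hd := ((hasDerivAt_log_norm_line hyx (-(‖y - x‖⁻¹ • (y - x)))).const_sub
      (Real.log (2 * e))).const_mul (2 * e * √Lam)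
    have hG : 2 * e * √Lam * -(inner ℝ (y - x) (-(‖y - x‖⁻¹ • (y - x))) / ‖y - x‖ ^ 2) = √Lam := by
      rw [inner_neg_right, inner_smul_right, real_inner_self_eq_norm_sq, hnorm]
      field_simp
    rw [hG] at hd
    have := hb.hasDerivAt_le (e := -(‖y - x‖⁻¹ • (y - x))) (G := √Lam) (by
      rw [norm_smul, norm_inv, Real.norm_of_nonneg hs.le, ← dist_eq_norm, hyz,
        inv_mul_cancel₀ hs.ne']) (by
      rw [norm_neg, norm_smul, norm_inv, norm_norm, inv_mul_cancel₀ hn0.ne']) hy0 hsL hd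
    exact (Real.sqrt_le_sqrt (A.lt_Lam y).le).trans this

/-- Linear growth of the largest subsolution away from its zero set. -/
theorem largest_le_dist (A : Admissible D f g h lam Lam) {x z : Plane}
    (hz : z ∉ posSet D (𝓤 D f g h)) (hD : Disjoint (ball x (4 * dist x z)) D) (hx : x ∉ D)
    (hh : ∀ y ∈ ball x (3 * dist x z), 6 * √Lam * dist x z ≤ h y) :
    𝓤 D f g h x ≤ 10 * √Lam * dist x z := by
  by_contra! hlt
  set u := 𝓤 D f g h with hu
  have hu0 : 0 < u x := lt_of_le_of_lt (by positivity) hlt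
  have hzx : 0 < dist x z := by
    rw [dist_pos]; rintro rfl
    exact hz ⟨hx, hu0⟩
  have hDc := disjoint_ball_closure hD
  have hxc : x ∉ closure D := fun h => hDc.ne_of_mem (mem_ball_self (by positivity)) h rfl
  -- Distances are measured to the nearest zeros: since e ≤ dist x z, the assumed largeness of u x
  -- holds with e in place of dist x z.
  set e := infDist x (posSet D u)ᶜ with he
  have hne : ((posSet D u)ᶜ).Nonempty := ⟨z, hz⟩
  have hez : e ≤ dist x z := infDist_le_dist_of_mem hz
  have hball : ∀ y, dist y x < e → y ∈ posSet D u := by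
    intro y hy
    by_contra hn
    have : e ≤ dist x y := infDist_le_dist_of_mem hn
    rw [dist_comm] at this
    linarith
  have he0 : 0 < e := by
    obtain ⟨ε, hε, hεb⟩ := Metric.eventually_nhds_iff_ball.1 (eventually_mem_posSet_largest A hxc hu0)
    refine lt_of_lt_of_le hε ((le_infDist hne).2 fun y hy => ?_)
    by_contra! hn
    exact hy (hεb y (by rwa [mem_ball, dist_comm]))
  obtain ⟨z', hz', hzd⟩ := (infDist_lt_iff hne).1 (show infDist x (posSet D u)ᶜ < 2 * e by
    rw [← he]; linarith)
  obtain ⟨v, hv, hvx⟩ := exists_lt_of_lt_largest A hlt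
  have hdisj : Disjoint (closedBall x (e / 2)) (closure D) :=
    hDc.mono_left (closedBall_subset_ball (by linarith))
  obtain ⟨w, hw, hvw, hwk⟩ := exists_harmonic_in_disc A hv (half_pos he0) hdisj
    (fun y hy => hball y (by rw [mem_closedBall] at hy; linarith))
  have hsL : 0 ≤ √Lam := Real.sqrt_nonneg _
  obtain ⟨v', hv', hpos⟩ := exists_pos_of_large A he0
    (hD.mono_left (ball_subset_ball (by linarith)))
    (fun y hy => le_trans (by gcongr) (hh y (ball_subset_ball (by linarith) hy))) hw (by
      intro y hy
      rw [mem_closedBall] at hy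
      have h1 := (hwk y (by rw [mem_ball]; linarith)).1
      -- Harnack in the disc of radius e/2 loses a factor 3/5 at distance e/8, and 10 · 3/5 = 6 is
      -- the height that `exists_pos_of_large` requires.
      have h2 : 3 / 5 ≤ (e / 2 - dist y x) / (e / 2 + dist y x) := by
        rw [div_le_div_iff₀ (by norm_num) (by positivity)]
        linarith
      have h3 : 10 * √Lam * e ≤ w x := by
        refine le_trans ?_ (hvx.le.trans (hvw x hx))
        gcongr
      have h4 : 0 ≤ w x := le_trans (by positivity) h3
      nlinarith)
  -- The enlarged member is positive at the zero z', whose distance from x lies in [e, 2e).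
  refine hz' ?_
  have hge : e ≤ dist z' x := by
    rw [dist_comm]; exact infDist_le_dist_of_mem hz'
  refine posSet_subset_largest hv' ⟨fun hzD => ?_, hpos z' ?_ ?_⟩
  · exact hD.ne_of_mem (show z' ∈ ball x (4 * dist x z) by rw [mem_ball, dist_comm]; linarith) hzD rfl
  · rw [mem_ball, dist_comm]; exact hzd
  · linarith

/-- Where u is positive, Harnack squeezes u y between multiples of u x whose factors tend to 1. At a
zero of u with h > 0 linear growth applies, and at a zero of h the bound u ≤ h does. -/
theorem continuousAt_largest (A : Admissible D f g h lam Lam) {x : Plane} (hx : x ∉ closure D) :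
    ContinuousAt (𝓤 D f g h) x := by
  set u := 𝓤 D f g h with hu
  have hxD : x ∉ D := fun h => hx (subset_closure h)
  rcases (largest_nonneg A hxD).lt_or_eq with hpos | hzero
  · have hopen : IsOpen (closure D)ᶜ := isClosed_closure.isOpen_compl
    obtain ⟨ε, hε, hεb⟩ := Metric.eventually_nhds_iff_ball.1
      ((eventually_mem_posSet_largest A hx hpos).and (hopen.mem_nhds hx))
    have hr : 0 < ε / 2 := half_pos hε
    have hsub : closedBall x (ε / 2) ⊆ ball x ε := closedBall_subset_ball (by linarith)
    have key : ∀ y ∈ ball x (ε / 2), _ := fun y hy => largest_harnack A hr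
      (disjoint_left.2 fun y hy => (hεb y (hsub hy)).2) (fun y hy => (hεb y (hsub hy)).1) hy
    have hk : Tendsto (fun y => (ε / 2 - dist y x) / (ε / 2 + dist y x)) (𝓝 x) (𝓝 1) := by
      have : ContinuousAt (fun y => (ε / 2 - dist y x) / (ε / 2 + dist y x)) x := by
        apply ContinuousAt.div (by fun_prop) (by fun_prop)
        rw [dist_self]; linarith
      have h1 := this.tendsto
      rwa [dist_self, sub_zero, add_zero, div_self hr.ne'] at h1
    have hlow : Tendsto (fun y => (ε / 2 - dist y x) / (ε / 2 + dist y x) * u x) (𝓝 x) (𝓝 (u x)) := by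
      simpa using hk.mul_const (u x)
    have hup : Tendsto (fun y => ((ε / 2 - dist y x) / (ε / 2 + dist y x))⁻¹ * u x) (𝓝 x)
        (𝓝 (u x)) := by
      simpa using (hk.inv₀ one_ne_zero).mul_const (u x)
    refine tendsto_of_tendsto_of_tendsto_of_le_of_le' hlow hup ?_ ?_
    · filter_upwards [ball_mem_nhds x hr] with y hy using (key y hy).1
    · filter_upwards [ball_mem_nhds x hr] with y hy
      have hy' : dist y x < ε / 2 := hy
      rw [le_inv_mul_iff₀ (div_pos (by linarith) (by positivity))]
      exact (key y hy).2
  · have hux : u x = 0 := hzero.symm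
    have hnp : x ∉ posSet D u := fun h => h.2.ne hzero
    have hDn : ∀ᶠ y in 𝓝 x, y ∉ D := compl_mem_nhds_of_notMem_closure hx
    have hhc : ContinuousAt h x := A.h_cont.continuousAt (compl_mem_nhds_of_notMem_closure hx)
    have hnn : ∀ᶠ y in 𝓝 x, 0 ≤ u y := hDn.mono fun y hy => largest_nonneg A hy
    rcases (A.h_nonneg x).lt_or_eq with hhpos | hh0
    · obtain ⟨ε, hε, hεb⟩ := Metric.eventually_nhds_iff_ball.1
        (hDn.and (hhc.eventually (lt_mem_nhds (half_lt_self hhpos))))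
      have hlin : Tendsto (fun y => 10 * √Lam * dist y x) (𝓝 x) (𝓝 (u x)) := by
        have : Continuous fun y => 10 * √Lam * dist y x := by fun_prop
        have h1 := this.tendsto x
        rwa [dist_self, mul_zero, ← hux] at h1
      have hsm : ∀ᶠ y in 𝓝 x, 6 * √Lam * dist y x < h x / 2 := by
        have : Continuous fun y => 6 * √Lam * dist y x := by fun_prop
        have h1 := this.tendsto x
        rw [dist_self, mul_zero] at h1
        exact h1.eventually (gt_mem_nhds (half_pos hhpos))
      refine tendsto_of_tendsto_of_tendsto_of_le_of_le' (g := fun _ => u x) tendsto_const_nhds hlin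
        (by rwa [hux]) ?_
      filter_upwards [hsm, ball_mem_nhds x (show 0 < ε / 5 by positivity), hDn] with y h1 h2 h3
      rw [mem_ball] at h2
      have hsub : ball y (4 * dist y x) ⊆ ball x ε := by
        intro z hz
        rw [mem_ball] at hz ⊢
        linarith [dist_triangle z y x]
      refine largest_le_dist A hnp (disjoint_left.2 fun z hz => (hεb z (hsub hz)).1) h3 ?_
      intro z hz
      have := (hεb z (hsub (ball_subset_ball (by linarith [dist_nonneg (x := y) (y := x)]) hz))).2
      linarith
    · have hht : Tendsto h (𝓝 x) (𝓝 (u x)) := by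
        rw [hux, hh0]; exact hhc
      refine tendsto_of_tendsto_of_tendsto_of_le_of_le' (g := fun _ => u x) tendsto_const_nhds hht
        (by rwa [hux]) (hDn.mono fun y hy => largest_le_barrier A hy)

end FreeBoundary

namespace FreeBoundary

open InnerProductSpace Laplacian

/-! ### Behaviour near `∂D` -/

/-- The terms with 1 ≤ j ≤ n add up to n ln n - ln n!, which is at most n because nⁿ/n! ≤ eⁿ. The
others vanish, the term j = 0 by the conventions n/0 = 0 and ln 0 = 0. -/
theorem sum_log_div_le (n : ℕ) (J : Finset ℕ) :
    ∑ j ∈ J, max (Real.log (n / j)) 0 ≤ n := by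
  rcases Nat.eq_zero_or_pos n with rfl | hn
  · simp
  have hn' : (0 : ℝ) < n := by exact_mod_cast hn
  have h1 : ∑ j ∈ J, max (Real.log (n / j)) 0 ≤ ∑ j ∈ Finset.Icc 1 n, max (Real.log (n / j)) 0 := by
    have h2 : ∑ j ∈ J, max (Real.log (n / j)) 0 =
        ∑ j ∈ J with j ∈ Finset.Icc 1 n, max (Real.log (n / j)) 0 := by
      rw [Finset.sum_filter_of_ne]
      intro j _ hj
      by_contra hjn
      apply hj
      rw [Finset.mem_Icc, not_and_or, not_le, not_le] at hjn
      apply max_eq_right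
      rcases hjn with h | h
      · have : j = 0 := by omega
        simp [this]
      · have hj0 : (0 : ℝ) < j := by exact_mod_cast (by omega : 0 < j)
        apply Real.log_nonpos (by positivity)
        rw [div_le_one hj0]
        exact_mod_cast h.le
    rw [h2]
    refine Finset.sum_le_sum_of_subset_of_nonneg (fun j hj => (Finset.mem_filter.1 hj).2) ?_
    intro j _ _
    exact le_max_right _ _
  refine h1.trans ?_
  have h3 : ∑ j ∈ Finset.Icc 1 n, max (Real.log (n / j)) 0 = n * Real.log n - Real.log n.factorial := by
    have h4 : ∀ j ∈ Finset.Icc 1 n, max (Real.log (n / j)) 0 = Real.log n - Real.log j := by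
      intro j hj
      rw [Finset.mem_Icc] at hj
      have hj0 : (0 : ℝ) < j := by exact_mod_cast hj.1
      rw [max_eq_left, Real.log_div hn'.ne' hj0.ne']
      apply Real.log_nonneg
      rw [le_div_iff₀ hj0, one_mul]
      exact_mod_cast hj.2
    rw [Finset.sum_congr rfl h4, Finset.sum_sub_distrib, Finset.sum_const, Nat.card_Icc,
      ← Finset.prod_Ico_id_eq_factorial, Finset.Ico_add_one_right_eq_Icc, Nat.cast_prod,
      Real.log_prod]
    · simp
    · intro j hj
      rw [Finset.mem_Icc] at hj
      have : (0 : ℝ) < j := by exact_mod_cast hj.1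
      exact this.ne'
  rw [h3]
  have h5 := Real.pow_div_factorial_le_exp (n : ℝ) hn'.le n
  have h6 : (0 : ℝ) < (n : ℝ) ^ n / n.factorial := by positivity
  have h7 := Real.log_le_log h6 h5
  rwa [Real.log_exp, Real.log_div (by positivity) (by positivity), Real.log_pow] at h7

/-- A sum of logarithmic singularities at equally spaced distances is bounded. -/
theorem sum_le_of_spaced {N : ℕ} {ρ T : ℝ} {F : ℕ → ℝ} (hT : 0 ≤ T) (hFT : ∀ i < N, F i ≤ T)
    (hF : ∀ i < N, (i : ℝ) ≠ ρ → F i ≤ Real.log (8 * N / |ρ - i|)) :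
    ∑ i ∈ Finset.range N, F i ≤ 2 * T + 16 * N := by
  set k := ⌊ρ⌋₊ with hk
  have hk1 : ρ < k + 1 := Nat.lt_floor_add_one ρ
  set L : ℕ → ℝ := fun j => max (Real.log ((8 * N : ℕ) / j)) 0 with hL
  have hL0 : ∀ j, 0 ≤ L j := fun j => le_max_right _ _
  have hlog : ∀ i < N, ∀ j : ℕ, 0 < j → (j : ℝ) ≤ |ρ - i| → F i ≤ L j := by
    intro i hi j hj hji
    have hN : 0 < N := by omega
    have hj' : (0 : ℝ) < j := by exact_mod_cast hj
    have hne : (i : ℝ) ≠ ρ := by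
      rintro h; rw [h, sub_self, abs_zero] at hji; linarith
    refine (hF i hi hne).trans (le_trans ?_ (le_max_left _ _))
    apply Real.log_le_log
    · apply div_pos (by positivity) (hj'.trans_le hji)
    · push_cast
      gcongr
  -- Only the two indices k and k + 1 use the crude bound T. Every other i is at distance at least k
  -- - i or i - k - 1 from ρ, and each such integer occurs at most once on either side.
  have key : ∀ i ∈ Finset.range N, F i ≤ (if i = k then T else 0) + (if i = k + 1 then T else 0) +
      (if i < k then L (k - i) else 0) + (if k + 1 < i then L (i - k - 1) else 0) := by
    intro i hi
    rw [Finset.mem_range] at hi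
    have hT1 : (0 : ℝ) ≤ if i = k then T else 0 := by split_ifs <;> simp [hT]
    have hT2 : (0 : ℝ) ≤ if i = k + 1 then T else 0 := by split_ifs <;> simp [hT]
    have hT3 : (0 : ℝ) ≤ if i < k then L (k - i) else 0 := by split_ifs <;> simp [hL0]
    have hT4 : (0 : ℝ) ≤ if k + 1 < i then L (i - k - 1) else 0 := by split_ifs <;> simp [hL0]
    rcases lt_trichotomy i k with h | h | h
    · have hkρ : (k : ℝ) ≤ ρ := Nat.floor_le (by
        by_contra! hn
        rw [hk, Nat.floor_of_nonpos hn.le] at h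
        omega)
      have h1 := hlog i hi (k - i) (by omega) (by
        rw [Nat.cast_sub h.le]
        exact (by linarith : (k : ℝ) - i ≤ ρ - i).trans (le_abs_self _))
      rw [if_pos h]
      rw [if_pos h] at hT3
      linarith
    · have h1 := hFT i hi
      rw [if_pos h]
      linarith
    · rcases (show i = k + 1 ∨ k + 1 < i by omega) with h' | h'
      · have h1 := hFT i hi
        rw [if_pos h']
        linarith
      · have h1 := hlog i hi (i - k - 1) (by omega) (by
          rw [Nat.sub_sub, Nat.cast_sub h'.le]
          push_cast
          refine le_trans ?_ (neg_le_abs _)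
          linarith)
        rw [if_pos h']
        linarith
  refine (Finset.sum_le_sum key).trans ?_
  rw [Finset.sum_add_distrib, Finset.sum_add_distrib, Finset.sum_add_distrib]
  have h1 : ∀ m, ∑ i ∈ Finset.range N, (if i = m then T else 0) ≤ T := by
    intro m
    rw [Finset.sum_ite_eq']
    split_ifs <;> simp [hT]
  have h2 : ∑ i ∈ Finset.range N, (if i < k then L (k - i) else 0) ≤ (8 * N : ℕ) := by
    rw [← Finset.sum_filter]
    rw [← Finset.sum_image (s := {i ∈ Finset.range N | i < k}) (g := fun i => k - i) (f := L)]
    · exact sum_log_div_le _ _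
    · intro a ha b hb hab
      simp only [Finset.coe_filter, Set.mem_ofPred_eq] at ha hb hab
      omega
  have h3 : ∑ i ∈ Finset.range N, (if k + 1 < i then L (i - k - 1) else 0) ≤ (8 * N : ℕ) := by
    rw [← Finset.sum_filter]
    rw [← Finset.sum_image (s := {i ∈ Finset.range N | k + 1 < i}) (g := fun i => i - k - 1) (f := L)]
    · exact sum_log_div_le _ _
    · intro a ha b hb hab
      simp only [Finset.coe_filter, Set.mem_ofPred_eq] at ha hb hab
      omega
  have h4 := h1 k
  have h5 := h1 (k + 1)
  push_cast at h2 h3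
  linarith

/-- A connected open set that approaches `p` and leaves a disc about `p` carries a probability
measure whose logarithmic potential is bounded independently of the set. -/
theorem exists_spaced_points {D : Set Plane} (hD : IsOpen D) (hDc : IsConnected D) {p q : Plane}
    (hp : p ∈ closure D) (hq : q ∈ D) {δ : ℝ} (hδ : 0 < δ) (hqp : δ ≤ dist q p) :
    ∃ (N : ℕ) (y : ℕ → Plane), 0 < N ∧ (∀ i < N, y i ∈ D ∧ dist (y i) p ≤ δ) ∧
      ∀ x ∉ D, ∑ i ∈ Finset.range N, (Real.log (4 * δ) - Real.log ‖x - y i‖) ≤ 17 * N := by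
  -- A path in D from a point close to p to q crosses every circle about p with radius in [δ/2, δ].
  -- This is where connectedness of D replaces any regularity of ∂D.
  obtain ⟨p', hp', hpp'⟩ := Metric.mem_closure_iff.1 hp (δ / 2) (by positivity)
  have hpath := (hD.isConnected_iff_isPathConnected).1 hDc
  obtain ⟨γ, hγ⟩ := hpath.joinedIn p' hp' q hq
  have hK : IsCompact (range γ) := isCompact_range γ.continuous
  obtain ⟨t, ht, htD⟩ := hK.exists_thickening_subset_open hD (range_subset_iff.2 hγ)
  have hsel : ∀ s ∈ Icc (δ / 2) δ, ∃ y ∈ range γ, dist y p = s := by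
    intro s hs
    have hc : Continuous fun τ => dist (γ τ) p := by fun_prop
    have h0 : dist (γ 0) p ≤ s := by
      rw [γ.source, dist_comm]; exact hpp'.le.trans hs.1
    have h1 : s ≤ dist (γ 1) p := by
      rw [γ.target]; exact hs.2.trans hqp
    obtain ⟨τ, hτ⟩ := mem_range_of_exists_le_of_exists_ge hc ⟨0, h0⟩ ⟨1, h1⟩
    exact ⟨γ τ, mem_range_self _, hτ⟩
  -- The path stays at distance t from the complement of D, so a single logarithm is at most T,
  -- which depends on the path. Taking N > 2T absorbs it: 2T + 16N ≤ 17N.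
  set T := max (Real.log (4 * δ / t)) 0 with hT
  obtain ⟨N, hN⟩ := exists_nat_gt (2 * T)
  have hT0 : 0 ≤ T := le_max_right _ _
  have hN0 : (0 : ℝ) < N := by linarith
  have hN1 : 0 < N := by exact_mod_cast hN0
  set a := δ / (2 * N) with ha
  have ha0 : 0 < a := by positivity
  have hs : ∀ i < N, δ / 2 + i * a ∈ Icc (δ / 2) δ := by
    intro i hi
    have hi' : (i : ℝ) ≤ N := by exact_mod_cast hi.le
    refine ⟨by nlinarith [mul_nonneg (Nat.cast_nonneg (α := ℝ) i) ha0.le], ?_⟩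
    have : (N : ℝ) * a = δ / 2 := by rw [ha]; field_simp
    nlinarith
  have hex : ∀ i : ℕ, ∃ y : Plane, i < N → y ∈ range γ ∧ dist y p = δ / 2 + i * a := by
    intro i
    by_cases hi : i < N
    · obtain ⟨y, h1, h2⟩ := hsel _ (hs i hi)
      exact ⟨y, fun _ => ⟨h1, h2⟩⟩
    · exact ⟨p, fun h => absurd h hi⟩
  choose y hy using hex
  refine ⟨N, y, hN1, fun i hi => ⟨?_, ?_⟩, fun x hx => ?_⟩
  · obtain ⟨τ, hτ⟩ := (hy i hi).1
    rw [← hτ]; exact hγ τ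
  · rw [(hy i hi).2]; exact (hs i hi).2
  · have hxt : ∀ i < N, t ≤ ‖x - y i‖ := by
      intro i hi
      by_contra! hn
      apply hx
      apply htD
      rw [mem_thickening_iff]
      exact ⟨y i, (hy i hi).1, by rwa [dist_eq_norm]⟩
    have := sum_le_of_spaced (N := N) (ρ := (dist x p - δ / 2) / a) (T := T)
      (F := fun i => Real.log (4 * δ) - Real.log ‖x - y i‖) hT0 ?_ ?_
    · linarith
    · intro i hi
      refine le_trans ?_ (le_max_left _ _)
      rw [← Real.log_div (by positivity) (ht.trans_le (hxt i hi)).ne']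
      apply Real.log_le_log
      · exact div_pos (by positivity) (ht.trans_le (hxt i hi))
      · have := hxt i hi
        gcongr
    · intro i hi hne
      have hpos : 0 < |(dist x p - δ / 2) / a - i| := abs_pos.2 (sub_ne_zero.2 hne.symm)
      -- Since y i is at distance δ/2 + i a from p, the difference of distances to p already
      -- separates x from y i.
      have h1 : a * |(dist x p - δ / 2) / a - i| ≤ ‖x - y i‖ := by
        have h2 : a * |(dist x p - δ / 2) / a - i| = |dist x p - dist (y i) p| := by
          rw [(hy i hi).2, ← abs_of_pos ha0, ← abs_mul, abs_of_pos ha0]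
          congr 1
          field_simp
          ring
        rw [h2, ← dist_eq_norm]
        exact abs_dist_sub_le _ _ _
      have hxy0 := ht.trans_le (hxt i hi)
      change Real.log (4 * δ) - Real.log ‖x - y i‖ ≤ _
      rw [← Real.log_div (by positivity) hxy0.ne']
      apply Real.log_le_log (by positivity)
      rw [div_le_div_iff₀ hxy0 hpos]
      have h3 : 8 * N * a = 4 * δ := by rw [ha]; field_simp; norm_num
      nlinarith

/-- The mean of the logarithmic potentials of the points `y i`, `i < N`, vanishing at distance
`4 δ`. -/
noncomputable def pot (N : ℕ) (y : ℕ → Plane) (δ : ℝ) (x : Plane) : ℝ :=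
  (N : ℝ)⁻¹ * ∑ i ∈ Finset.range N, (Real.log (4 * δ) - Real.log ‖x - y i‖)

section pot

variable {N : ℕ} {y : ℕ → Plane} {δ : ℝ} {p x : Plane}

theorem le_pot (hN : 0 < N) {b : ℝ}
    (h : ∀ i < N, b ≤ Real.log (4 * δ) - Real.log ‖x - y i‖) : b ≤ pot N y δ x := by
  have hN' : (0 : ℝ) < N := by exact_mod_cast hN
  rw [pot, le_inv_mul_iff₀ hN']
  have := Finset.card_nsmul_le_sum (Finset.range N) _ b fun i hi => h i (Finset.mem_range.1 hi)
  simpa using this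

theorem pot_le (hN : 0 < N) {b : ℝ}
    (h : ∀ i < N, Real.log (4 * δ) - Real.log ‖x - y i‖ ≤ b) : pot N y δ x ≤ b := by
  have hN' : (0 : ℝ) < N := by exact_mod_cast hN
  rw [pot, inv_mul_le_iff₀ hN']
  have := Finset.sum_le_card_nsmul (Finset.range N) _ b fun i hi => h i (Finset.mem_range.1 hi)
  simpa using this

theorem harmonicAt_pot (h : ∀ i < N, x ≠ y i) : HarmonicAt (pot N y δ) x := by
  have hs : ∀ s : Finset ℕ, (∀ i ∈ s, i < N) →
      HarmonicAt (fun x => ∑ i ∈ s, (Real.log (4 * δ) - Real.log ‖x - y i‖)) x := by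
    intro s
    induction s using Finset.induction_on with
    | empty => intro _; simp only [Finset.sum_empty]; exact harmonicAt_const 0
    | insert a s ha ih =>
      intro hs
      have h1 := ih fun i hi => hs i (Finset.mem_insert_of_mem hi)
      have h2 := (harmonicAt_const (Real.log (4 * δ))).sub
        (harmonicAt_log_norm_sub (h a (hs a (Finset.mem_insert_self _ _))))
      have h3 := h2.add h1
      convert h3 using 1
      funext z
      rw [Finset.sum_insert ha]
      rfl
  exact (hs (Finset.range N) fun i hi => Finset.mem_range.1 hi).const_smul (c := (N : ℝ)⁻¹)

theorem pot_neg (hN : 0 < N) (hδ : 0 < δ) (hy : ∀ i < N, dist (y i) p ≤ δ)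
    (hx : 6 * δ ≤ dist x p) : pot N y δ x < 0 := by
  have : pot N y δ x ≤ Real.log (4 * δ) - Real.log (5 * δ) := by
    refine pot_le hN fun i hi => ?_
    have h1 : 5 * δ ≤ ‖x - y i‖ := by
      rw [← dist_eq_norm]
      linarith [dist_triangle x (y i) p, hy i hi]
    linarith [Real.log_le_log (by positivity) h1]
  linarith [Real.log_lt_log (show 0 < 4 * δ by positivity) (show 4 * δ < 5 * δ by linarith)]

theorem half_le_pot (hN : 0 < N) (hδ : 0 < δ) (hy : ∀ i < N, dist (y i) p ≤ δ)
    (hxy : ∀ i < N, x ≠ y i) (hx : dist x p ≤ δ) : 1 / 2 ≤ pot N y δ x := by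
  refine le_pot hN fun i hi => ?_
  have h0 : 0 < ‖x - y i‖ := norm_pos_iff.2 (sub_ne_zero.2 (hxy i hi))
  have h1 : ‖x - y i‖ ≤ 2 * δ := by
    rw [← dist_eq_norm]
    linarith [dist_triangle_right x (y i) p, hy i hi]
  have h2 := Real.log_le_log h0 h1
  have h3 : Real.log (4 * δ) = Real.log 2 + Real.log (2 * δ) := by
    rw [← Real.log_mul (by norm_num) (by positivity)]; ring_nf
  linarith [Real.log_two_gt_d9]

theorem pot_pos (hN : 0 < N) (hδ : 0 < δ) (hy : ∀ i < N, dist (y i) p ≤ δ)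
    (hxy : ∀ i < N, x ≠ y i) (hx : dist x p < 3 * δ) : 0 < pot N y δ x := by
  have : Real.log (4 * δ) - Real.log (dist x p + δ) ≤ pot N y δ x := by
    refine le_pot hN fun i hi => ?_
    have h0 : 0 < ‖x - y i‖ := norm_pos_iff.2 (sub_ne_zero.2 (hxy i hi))
    have h1 : ‖x - y i‖ ≤ dist x p + δ := by
      rw [← dist_eq_norm]
      linarith [dist_triangle_right x (y i) p, hy i hi]
    linarith [Real.log_le_log h0 h1]
  have h2 : Real.log (dist x p + δ) < Real.log (4 * δ) :=
    Real.log_lt_log (by positivity) (by linarith)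
  linarith

theorem hasDerivAt_pot_line (h : ∀ i < N, x ≠ y i) (e : Plane) :
    HasDerivAt (fun t : ℝ => pot N y δ (x + t • e))
      ((N : ℝ)⁻¹ * ∑ i ∈ Finset.range N, -(inner ℝ (x - y i) e / ‖x - y i‖ ^ 2)) 0 := by
  unfold pot
  refine HasDerivAt.const_mul _ (HasDerivAt.fun_sum fun i hi => ?_)
  exact (hasDerivAt_log_norm_line (h i (Finset.mem_range.1 hi)) e).const_sub _

/-- The slope of the potential at its zero level. -/
theorem exists_slope_pot (hN : 0 < N) (hδ : 0 < δ) (hy : ∀ i < N, dist (y i) p ≤ δ)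
    (hxy : ∀ i < N, x ≠ y i) (h0 : pot N y δ x = 0) :
    ∃ (e : Plane) (G : ℝ), ‖e‖ = 1 ∧ 1 / (25 * δ) ≤ G ∧
      HasDerivAt (fun t : ℝ => pot N y δ (x + t • e)) G 0 := by
  -- The zero level lies at distance r between 3δ and 6δ from p. In the direction of p each summand
  -- has derivative at least (r - δ)/(r + δ)², which is at least 1/(25δ) in that range.
  have h3 : 3 * δ ≤ dist x p := by
    by_contra! hn
    exact (pot_pos hN hδ hy hxy hn).ne' h0
  have h6 : dist x p < 6 * δ := by
    by_contra! hn
    exact (pot_neg hN hδ hy hn).ne h0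
  set r := dist x p with hr
  have hr0 : 0 < r := by linarith
  have hrn : ‖x - p‖ = r := by rw [← dist_eq_norm]
  refine ⟨-(r⁻¹ • (x - p)), _, ?_, ?_, hasDerivAt_pot_line hxy _⟩
  · rw [norm_neg, norm_smul, norm_inv, Real.norm_of_nonneg hr0.le, hrn, inv_mul_cancel₀ hr0.ne']
  · have hN' : (0 : ℝ) < N := by exact_mod_cast hN
    rw [le_inv_mul_iff₀ hN']
    have hterm : ∀ i ∈ Finset.range N, 1 / (25 * δ) ≤
        -(inner ℝ (x - y i) (-(r⁻¹ • (x - p))) / ‖x - y i‖ ^ 2) := by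
      intro i hi
      rw [Finset.mem_range] at hi
      have hpos : 0 < ‖x - y i‖ := norm_pos_iff.2 (sub_ne_zero.2 (hxy i hi))
      have hle : ‖x - y i‖ ≤ r + δ := by
        rw [← dist_eq_norm]
        linarith [dist_triangle_right x (y i) p, hy i hi]
      have hin : r * (r - δ) ≤ inner ℝ (x - y i) (x - p) := by
        have h1 : x - y i = (x - p) - (y i - p) := by abel
        rw [h1, inner_sub_left, real_inner_self_eq_norm_sq, hrn]
        have h2 := real_inner_le_norm (y i - p) (x - p)
        rw [hrn, ← dist_eq_norm] at h2
        nlinarith [hy i hi]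
      rw [inner_neg_right, inner_smul_right, neg_div, neg_neg, div_le_div_iff₀ (by positivity)
        (by positivity), one_mul]
      have h4 : r - δ ≤ r⁻¹ * inner ℝ (x - y i) (x - p) := by
        rw [le_inv_mul_iff₀ hr0]; exact hin
      have h5 : ‖x - y i‖ ^ 2 ≤ (r + δ) ^ 2 := by gcongr
      have h6' : (r + δ) ^ 2 ≤ (r - δ) * (25 * δ) := by nlinarith
      nlinarith
    have := Finset.card_nsmul_le_sum (Finset.range N) _ _ hterm
    simpa using this

end pot

end FreeBoundary

namespace FreeBoundary

open InnerProductSpace Laplacian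

variable {D : Set Plane} {f g h v w : Plane → ℝ} {lam Lam : ℝ}

local notation "𝓤" => largestSubsolution

/-- A potential of points of `D` near a boundary point. -/
theorem Admissible.exists_pot (A : Admissible D f g h lam Lam) {p : Plane} (hp : p ∈ frontier D) :
    ∃ δ₀ > 0, ∀ δ > 0, δ ≤ δ₀ → ∃ (N : ℕ) (y : ℕ → Plane), 0 < N ∧
      (∀ i < N, y i ∈ D ∧ dist (y i) p ≤ δ) ∧ ∀ x ∉ D, pot N y δ x ≤ 17 := by
  obtain ⟨q, hq⟩ := A.isConnected.nonempty
  have hpD := notMem_of_mem_frontier A.isOpen hp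
  have hqp : 0 < dist q p := dist_pos.2 (by rintro rfl; exact hpD hq)
  refine ⟨dist q p, hqp, fun δ hδ hδ0 => ?_⟩
  obtain ⟨N, y, hN, hy, hb⟩ := exists_spaced_points A.isOpen A.isConnected
    (frontier_subset_closure hp) hq hδ hδ0
  refine ⟨N, y, hN, hy, fun x hx => ?_⟩
  have hN' : (0 : ℝ) < N := by exact_mod_cast hN
  rw [pot, inv_mul_le_iff₀ hN']
  linarith [hb x hx]

theorem ne_of_mem_of_notMem' {N : ℕ} {y : ℕ → Plane} (hy : ∀ i < N, y i ∈ D) {x : Plane}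
    (hx : x ∉ D) : ∀ i < N, x ≠ y i := by
  rintro i hi rfl
  exact hx (hy i hi)

theorem continuousOn_pot {N : ℕ} {y : ℕ → Plane} {δ : ℝ} (hy : ∀ i < N, y i ∈ D) :
    ContinuousOn (pot N y δ) Dᶜ := fun _ hx =>
  (harmonicAt_pot (ne_of_mem_of_notMem' hy hx)).1.continuousAt.continuousWithinAt

theorem harmonicAt_affine_pot {N : ℕ} {y : ℕ → Plane} {δ a b : ℝ} (hy : ∀ i < N, y i ∈ D)
    {x : Plane} (hx : x ∉ D) : HarmonicAt (fun x => a + b * pot N y δ x) x :=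
  (harmonicAt_const a).add ((harmonicAt_pot (ne_of_mem_of_notMem' hy hx)).const_smul (c := b))

theorem mem_nhdsWithin_frontier_iff {p : Plane} {P : Plane → Prop}
    (h : ∀ᶠ x in 𝓝[frontier D] p, P x) :
    ∃ ε > 0, ∀ x ∈ frontier D, dist x p < ε → P x := by
  obtain ⟨ε, hε, hb⟩ := Metric.mem_nhdsWithin_iff.1 h
  exact ⟨ε, hε, fun x hx hd => hb ⟨hd, hx⟩⟩

theorem Admissible.exists_bounds_near (A : Admissible D f g h lam Lam) {p : Plane}
    (hp : p ∈ frontier D) {b : ℝ} (hb : b < g p) :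
    ∃ ε > 0, (∀ x ∈ frontier D, dist x p < ε → b ≤ g x) ∧ ∀ x ∉ D, dist x p < ε → b ≤ h x := by
  obtain ⟨ε1, h1, hb1⟩ := mem_nhdsWithin_frontier_iff
    ((A.g_cont p hp).eventually (lt_mem_nhds hb))
  have hpD := notMem_of_mem_frontier A.isOpen hp
  obtain ⟨ε2, h2, hb2⟩ := Metric.mem_nhdsWithin_iff.1
    ((A.h_cont p hpD).eventually (lt_mem_nhds (hb.trans_le (A.g_le_h p hp))))
  refine ⟨min ε1 ε2, lt_min h1 h2, fun x hx hd => (hb1 x hx (hd.trans_le (min_le_left _ _))).le,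
    fun x hx hd => ?_⟩
  have : x ∈ {x | b < h x} := hb2 ⟨hd.trans_le (min_le_right _ _), hx⟩
  exact le_of_lt this

/-- Multiplied by 25δ√Lam, the potential has slope at least √Lam on its zero level, so its positive
part satisfies the free boundary condition. The bound 17 keeps it below 425√Lam δ, hence below g and
h near p once δ is small. -/
theorem exists_pos_near_frontier (A : Admissible D f g h lam Lam) {p : Plane}
    (hp : p ∈ frontier D) : ∃ δ > 0, ∃ v ∈ Fam D f g h, ∀ x ∉ D, dist x p < δ → 0 < v x := by
  classical
  have hgp := A.g_pos p hp
  obtain ⟨ε, hε, hg, hh⟩ := A.exists_bounds_near hp (half_lt_self hgp)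
  obtain ⟨δ₀, hδ₀, hpot⟩ := A.exists_pot hp
  have hLam : 0 < Lam := A.lam_pos.trans ((A.lam_lt 0).trans (A.lt_Lam 0))
  have hsL : 0 < √Lam := Real.sqrt_pos.2 hLam
  set δ := min δ₀ (min (ε / 7) (g p / 2 / (425 * √Lam))) with hδ
  have hδ0 : 0 < δ := by positivity
  have hδε : δ ≤ ε / 7 := (min_le_right _ _).trans (min_le_left _ _)
  have hδg : 425 * √Lam * δ ≤ g p / 2 := by
    have : δ ≤ g p / 2 / (425 * √Lam) := (min_le_right _ _).trans (min_le_right _ _)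
    rw [le_div_iff₀ (by positivity)] at this
    linarith
  obtain ⟨N, y, hN, hy, hb⟩ := hpot δ hδ0 (min_le_left _ _)
  have hyD := fun i hi => (hy i hi).1
  have hyp := fun i hi => (hy i hi).2
  set a := 25 * δ * √Lam with ha
  have ha0 : 0 < a := by positivity
  set w : Plane → ℝ := fun x => 0 + a * pot N y δ x with hw
  have hwle : ∀ x ∉ D, w x ≤ g p / 2 := by
    intro x hx
    have := hb x hx
    simp only [hw, zero_add]
    nlinarith
  have hdist : ∀ x ∈ ball p (6 * δ), dist x p < ε := by
    intro x hx
    rw [mem_ball] at hx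
    linarith
  have hneg : ∀ x ∈ frontier (ball p (6 * δ)), w x < 0 := by
    intro x hx
    rw [frontier_ball p (by positivity), mem_sphere] at hx
    have := pot_neg hN hδ0 hyp hx.ge
    simp only [hw, zero_add]
    exact mul_neg_of_pos_of_neg ha0 this
  have hmem := glue_mem_Fam (O := ball p (6 * δ)) isOpen_ball (zero_mem_Fam A) (w := w)
    ((continuousOn_const.add (continuousOn_const.mul (continuousOn_pot hyD))).mono fun _ hx => hx.2)
    (fun x hx _ => (hneg x hx).le)
    (fun x hx hxf => (hwle x (notMem_of_mem_frontier A.isOpen hxf)).trans (hg x hxf (hdist x hx)))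
    (fun x hx hxD => (hwle x hxD).trans (hh x hxD (hdist x hx)))
    (viscositySubharmonicOn_of_harmonic fun x hx =>
      harmonicAt_affine_pot hyD fun h => hx.2.1 (subset_closure h))
    (fun x hx _ => Or.inl (hneg x hx))
    (by
      intro x hx hxc _ hx0 _ z s hs hxz _ α hb
      have hxD : x ∉ D := fun h => hxc (subset_closure h)
      have hx0' : pot N y δ x = 0 := by
        simp only [hw, zero_add, mul_eq_zero] at hx0
        exact hx0.resolve_left ha0.ne'
      obtain ⟨e, G, he, hG, hd⟩ := exists_slope_pot hN hδ0 hyp (ne_of_mem_of_notMem' hyD hxD) hx0'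
      have hd' := (hd.const_mul a).const_add 0
      have hGL : √Lam ≤ a * G := by
        have : a * (1 / (25 * δ)) = √Lam := by rw [ha]; field_simp
        rw [← this]; gcongr
      have := hb.hasDerivAt_le (e := e) (G := a * G) (by
        rw [norm_smul, norm_inv, Real.norm_of_nonneg hs.le, ← dist_eq_norm, hxz,
          inv_mul_cancel₀ hs.ne']) he hx0 (hsL.trans_le hGL) hd'
      exact ((Real.sqrt_le_sqrt (A.lt_Lam x).le).trans hGL).trans this)
  refine ⟨3 * δ, by positivity, _, hmem, fun x hxD hx => ?_⟩
  have hxb : x ∈ ball p (6 * δ) := by rw [mem_ball]; linarith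
  simp only [if_pos hxb, lt_max_iff]
  right
  have := pot_pos hN hδ0 hyp (ne_of_mem_of_notMem' hyD hxD) hx
  simp only [hw, zero_add]
  positivity

/-- The potential is at most 17 off D, negative at distance 6δ from p and at least 1/2 near p. If a
deficit S = b (33/34)^k has been reached on a disc, b - S + (S/17) pot may be glued in on a smaller
one; it stays below b and reduces the deficit by S/34 near p. The positivity obtained at k = 0 is
kept throughout, so the gluing creates no free boundary. -/
theorem exists_lower_near_frontier (A : Admissible D f g h lam Lam) {p : Plane}
    (hp : p ∈ frontier D) {b : ℝ} (hb0 : 0 < b) (hb : b < g p) (k : ℕ) :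
    ∃ δ > 0, ∃ v ∈ Fam D f g h, ∀ x ∉ D, dist x p < δ → 0 < v x ∧
      b - b * (33 / 34) ^ k ≤ v x := by
  classical
  induction k with
  | zero =>
    obtain ⟨δ, hδ, v, hv, hv0⟩ := exists_pos_near_frontier A hp
    exact ⟨δ, hδ, v, hv, fun x hx hd => ⟨hv0 x hx hd, by simpa using (hv0 x hx hd).le⟩⟩
  | succ k ih =>
    obtain ⟨δ₁, hδ₁, v, hv, hvb⟩ := ih
    obtain ⟨ε, hε, hg, hh⟩ := A.exists_bounds_near hp hb
    obtain ⟨δ₀, hδ₀, hpot⟩ := A.exists_pot hp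
    set δ := min δ₀ (min (ε / 7) (δ₁ / 7)) with hδ
    have hδ0 : 0 < δ := by positivity
    have hδε : δ ≤ ε / 7 := (min_le_right _ _).trans (min_le_left _ _)
    have hδ1 : δ ≤ δ₁ / 7 := (min_le_right _ _).trans (min_le_right _ _)
    obtain ⟨N, y, hN, hy, hpb⟩ := hpot δ hδ0 (min_le_left _ _)
    have hyD := fun i hi => (hy i hi).1
    have hyp := fun i hi => (hy i hi).2
    set S := b * (33 / 34) ^ k with hS
    have hS0 : 0 < S := by positivity
    set w : Plane → ℝ := fun x => (b - S) + S / 17 * pot N y δ x with hw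
    have hwle : ∀ x ∉ D, w x ≤ b := by
      intro x hx
      have := hpb x hx
      simp only [hw]
      nlinarith
    have hdist : ∀ x ∈ ball p (6 * δ), dist x p < ε := by
      intro x hx
      rw [mem_ball] at hx
      linarith
    have hfr : ∀ x ∈ frontier (ball p (6 * δ)), dist x p < δ₁ ∧ w x < b - S := by
      intro x hx
      rw [frontier_ball p (by positivity), mem_sphere] at hx
      have := pot_neg hN hδ0 hyp hx.ge
      simp only [hw]
      refine ⟨by linarith, ?_⟩
      have := mul_neg_of_pos_of_neg (show 0 < S / 17 by positivity) this
      linarith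
    have hvpos : ∀ x ∉ closure D, dist x p < δ₁ → x ∈ closure (posSet D v) := fun x hx hd =>
      subset_closure ⟨fun h => hx (subset_closure h), (hvb x (fun h => hx (subset_closure h)) hd).1⟩
    have hmem := glue_mem_Fam (O := ball p (6 * δ)) isOpen_ball hv (w := w)
      ((continuousOn_const.add (continuousOn_const.mul (continuousOn_pot hyD))).mono
        fun x hx => hx.2)
      (fun x hx hxD => (hfr x hx).2.le.trans (hvb x hxD (hfr x hx).1).2)
      (fun x hx hxf => (hwle x (notMem_of_mem_frontier A.isOpen hxf)).trans (hg x hxf (hdist x hx)))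
      (fun x hx hxD => (hwle x hxD).trans (hh x hxD (hdist x hx)))
      (viscositySubharmonicOn_of_harmonic fun x hx =>
        harmonicAt_affine_pot hyD fun h => hx.2.1 (subset_closure h))
      (fun x hx hxc => Or.inr (hvpos x hxc (hfr x hx).1))
      (fun x hx hxc hxn => absurd (hvpos x hxc (by rw [mem_ball] at hx; linarith)) hxn)
    refine ⟨δ, by positivity, _, hmem, fun x hxD hx => ?_⟩
    have hxb : x ∈ ball p (6 * δ) := by rw [mem_ball]; linarith
    simp only [if_pos hxb, lt_max_iff, le_max_iff]
    refine ⟨Or.inl (hvb x hxD (by linarith)).1, Or.inr ?_⟩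
    have := half_le_pot hN hδ0 hyp (ne_of_mem_of_notMem' hyD hxD) hx.le
    simp only [hw, pow_succ]
    nlinarith

/-- The mirror iteration, by comparison from above with b + S - (S/17) pot: at least b off D, more
than b + S at distance 6δ, and at most b + (33/34) S near p. The radius δ is the same for all
members, so the bound passes to the supremum. -/
theorem exists_upper_near_frontier (A : Admissible D f g h lam Lam) {p : Plane}
    (hp : p ∈ frontier D) {b B : ℝ} (hb : g p < b) (hB0 : 0 < B) (hB : ∀ x ∉ D, h x ≤ B) (k : ℕ) :
    ∃ δ > 0, ∀ v ∈ Fam D f g h, ∀ x ∉ D, dist x p < δ → v x ≤ b + B * (33 / 34) ^ k := by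
  have hb0 : 0 < b := (A.g_pos p hp).trans hb
  induction k with
  | zero =>
    refine ⟨1, one_pos, fun v hv x hx _ => ?_⟩
    have := (hv.2 x hx).trans (hB x hx)
    simp only [pow_zero, mul_one]
    linarith
  | succ k ih =>
    obtain ⟨δ₁, hδ₁, hvb⟩ := ih
    obtain ⟨ε, hε, hg⟩ := mem_nhdsWithin_frontier_iff ((A.g_cont p hp).eventually (gt_mem_nhds hb))
    obtain ⟨δ₀, hδ₀, hpot⟩ := A.exists_pot hp
    set δ := min δ₀ (min (ε / 7) (δ₁ / 7)) with hδ
    have hδ0 : 0 < δ := by positivity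
    have hδε : δ ≤ ε / 7 := (min_le_right _ _).trans (min_le_left _ _)
    have hδ1 : δ ≤ δ₁ / 7 := (min_le_right _ _).trans (min_le_right _ _)
    obtain ⟨N, y, hN, hy, hpb⟩ := hpot δ hδ0 (min_le_left _ _)
    have hyD := fun i hi => (hy i hi).1
    have hyp := fun i hi => (hy i hi).2
    set S := B * (33 / 34) ^ k with hS
    have hS0 : 0 < S := by positivity
    set w : Plane → ℝ := fun x => (b + S) + -(S / 17) * pot N y δ x with hw
    have hwge : ∀ x ∉ D, b ≤ w x := by
      intro x hx
      have := hpb x hx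
      simp only [hw]
      nlinarith
    refine ⟨δ, hδ0, fun v hv x hxD hx => ?_⟩
    by_cases hxc : x ∈ closure D
    · have hxf := mem_frontier_of A.isOpen hxD hxc
      have h1 := (hv.1.le_boundary x hxf).trans (hg x hxf (by linarith)).le
      have : 0 ≤ B * (33 / 34) ^ (k + 1) := by positivity
      linarith
    set O : Set Plane := ball p (6 * δ) \ closure D with hO
    have hOo : IsOpen O := isOpen_ball.sdiff isClosed_closure
    have hclO : ∀ z ∈ closure O, z ∉ D ∧ dist z p ≤ 6 * δ := by
      intro z hz
      refine ⟨?_, ?_⟩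
      · have : closure O ⊆ Dᶜ := closure_minimal (fun z hz h => hz.2 (subset_closure h))
          A.isOpen.isClosed_compl
        exact this hz
      · exact closure_ball_subset_closedBall (closure_mono sdiff_subset hz)
    have hcmp := ViscositySubharmonicOn.le_of_frontier (O := O) (v := v) (w := w) hOo
      (isBounded_ball.subset sdiff_subset) (hv.1.continuousOn.mono fun z hz => (hclO z hz).1)
      ((continuousOn_const.add (continuousOn_const.mul (continuousOn_pot hyD))).mono
        fun z hz => (hclO z hz).1)
      (hv.1.subharmonic.mono fun z hz => ⟨⟨fun h => hz.1.2 (subset_closure h),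
        (hb0.trans_le (hwge z fun h => hz.1.2 (subset_closure h))).trans hz.2⟩, hz.1.2⟩)
      (fun z hz => (harmonicAt_affine_pot hyD fun h => hz.2 (subset_closure h)).1)
      (fun z hz => (HarmonicAt.laplacian_eq_zero
        (harmonicAt_affine_pot hyD fun h => hz.2 (subset_closure h))).le)
      (by
        intro z hz
        rw [hOo.frontier_eq] at hz
        obtain ⟨hzD, hzd⟩ := hclO z hz.1
        by_cases hzc : z ∈ closure D
        · have hzf := mem_frontier_of A.isOpen hzD hzc
          exact ((hv.1.le_boundary z hzf).trans (hg z hzf (by linarith)).le).trans (hwge z hzD)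
        · have hzs : 6 * δ ≤ dist z p := by
            by_contra! hn
            exact hz.2 ⟨hn, hzc⟩
          have h1 := pot_neg hN hδ0 hyp hzs
          have h2 := hvb v hv z hzD (by linarith)
          have h3 := mul_neg_of_pos_of_neg (show 0 < S / 17 by positivity) h1
          simp only [hw]
          linarith)
    have hxO : x ∈ O := ⟨by rw [mem_ball]; linarith, hxc⟩
    refine (hcmp x (subset_closure hxO)).trans ?_
    have := half_le_pot hN hδ0 hyp (ne_of_mem_of_notMem' hyD hxD) hx.le
    simp only [hw, pow_succ]
    nlinarith

/-- At a point of ∂D the lower and upper iterations squeeze u to the value of g as k grows; away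
from the closure of D continuity is already known. -/
theorem continuousOn_largest (A : Admissible D f g h lam Lam) :
    ContinuousOn (𝓤 D f g h) Dᶜ ∧ ∀ p ∈ frontier D, 𝓤 D f g h p ≤ g p := by
  have hle : ∀ p ∈ frontier D, 𝓤 D f g h p ≤ g p := fun p hp =>
    largest_le A fun v hv => hv.1.le_boundary p hp
  refine ⟨fun p hpD => ?_, hle⟩
  by_cases hpc : p ∈ closure D
  swap
  · exact (continuousAt_largest A hpc).continuousWithinAt
  have hp := mem_frontier_of A.isOpen hpD hpc
  have hgp := A.g_pos p hp
  have hpow : Tendsto (fun k : ℕ => ((33 : ℝ) / 34) ^ k) atTop (𝓝 0) :=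
    tendsto_pow_atTop_nhds_zero_of_lt_one (by norm_num) (by norm_num)
  have hlow : ∀ b, b < g p → ∃ δ > 0, ∀ x ∉ D, dist x p < δ → b < 𝓤 D f g h x := by
    intro b hb
    obtain ⟨b', hb', hb'g⟩ := exists_between (max_lt hb hgp)
    have hb'0 : 0 < b' := (le_max_right _ _).trans_lt hb'
    have hbb' : b < b' := (le_max_left _ _).trans_lt hb'
    have h1 : Tendsto (fun k : ℕ => b' - b' * ((33 : ℝ) / 34) ^ k) atTop (𝓝 (b' - b' * 0)) :=
      (hpow.const_mul b').const_sub b'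
    rw [mul_zero, sub_zero] at h1
    obtain ⟨k, hk⟩ := (h1.eventually (lt_mem_nhds hbb')).exists
    obtain ⟨δ, hδ, v, hv, hvb⟩ := exists_lower_near_frontier A hp hb'0 hb'g k
    exact ⟨δ, hδ, fun x hx hd => (hk.trans_le (hvb x hx hd).2).trans_le (le_largest hv hx)⟩
  have hup : ∀ b, g p < b → ∃ δ > 0, ∀ x ∉ D, dist x p < δ → 𝓤 D f g h x < b := by
    intro b hb
    obtain ⟨b', hb', hb'g⟩ := exists_between hb
    obtain ⟨B, hB⟩ := A.h_bdd
    have h1 : Tendsto (fun k : ℕ => b' + max B 1 * ((33 : ℝ) / 34) ^ k) atTop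
        (𝓝 (b' + max B 1 * 0)) := (hpow.const_mul _).const_add b'
    rw [mul_zero, add_zero] at h1
    obtain ⟨k, hk⟩ := (h1.eventually (gt_mem_nhds hb'g)).exists
    obtain ⟨δ, hδ, hvb⟩ := exists_upper_near_frontier A hp hb' (B := max B 1) (by positivity)
      (fun x hx => (hB x hx).trans (le_max_left _ _)) k
    exact ⟨δ, hδ, fun x hx hd => (largest_le A fun v hv => hvb v hv x hx hd).trans_lt hk⟩
  have hval : 𝓤 D f g h p = g p := by
    refine le_antisymm (hle p hp) (le_of_forall_lt fun b hb => ?_)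
    obtain ⟨δ, hδ, hδb⟩ := hlow b hb
    exact hδb p hpD (by simpa using hδ)
  rw [ContinuousWithinAt, hval, tendsto_order]
  constructor
  · intro b hb
    obtain ⟨δ, hδ, hδb⟩ := hlow b hb
    filter_upwards [self_mem_nhdsWithin, mem_nhdsWithin_of_mem_nhds (ball_mem_nhds p hδ)]
      with x h1 h2 using hδb x h1 h2
  · intro b hb
    obtain ⟨δ, hδ, hδb⟩ := hup b hb
    filter_upwards [self_mem_nhdsWithin, mem_nhdsWithin_of_mem_nhds (ball_mem_nhds p hδ)]
      with x h1 h2 using hδb x h1 h2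

/-! ### The largest subsolution is a subsolution -/

theorem ContDiffAt.continuousAt_laplacian {φ : Plane → ℝ} {x : Plane} (hφ : ContDiffAt ℝ 2 φ x) :
    ContinuousAt (Laplacian.laplacian φ) x := by
  rw [laplacian_eq_iteratedFDeriv_stdOrthonormalBasis]
  have h1 : ContDiffAt ℝ 0 (fderiv ℝ (fderiv ℝ φ)) x :=
    (hφ.fderiv_right (m := 1) (by norm_num)).fderiv_right (by norm_num)
  have h2 := h1.continuousAt
  refine tendsto_finsetSum _ fun i _ => ?_
  simp only [iteratedFDeriv_two_apply]
  exact (h2.clm_apply continuousAt_const).clm_apply continuousAt_const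

/-- Stability of viscosity inequalities under suprema: a test function with negative Laplacian, made
to touch strictly by a quadratic, also touches from above, at a nearby point, any member that nearly
attains u at x. -/
theorem viscositySubharmonicOn_largest (A : Admissible D f g h lam Lam) :
    ViscositySubharmonicOn (𝓤 D f g h) (posSet D (𝓤 D f g h) \ closure D) := by
  set u := 𝓤 D f g h with hu
  rintro x ⟨⟨hxD, hx0⟩, hxc⟩ φ hφ hmax
  by_contra! hneg
  -- The quadratic contributes 4η = -Δφ(x)/2, so the Laplacian at x remains negative, while φ is
  -- raised by η(r/2)² on the circle of radius r/2.
  set η := -Laplacian.laplacian φ x / 8 with hη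
  have hη0 : 0 < η := by rw [hη]; linarith
  set ψ : Plane → ℝ := φ + fun z => η • ‖z - x‖ ^ 2 with hψ
  have hq : ∀ z, ContDiffAt ℝ 2 (fun z : Plane => η • ‖z - x‖ ^ 2) z := fun z =>
    ((contDiff_norm_sub_sq x).const_smul η).contDiffAt
  have hψc : ContDiffAt ℝ 2 ψ x := hφ.add (hq x)
  have hψΔ : Laplacian.laplacian ψ x < 0 := by
    rw [hψ, hφ.laplacian_add (hq x)]
    have := laplacian_smul η (contDiff_norm_sub_sq x).contDiffAt (x := x)
    rw [laplacian_norm_sub_sq] at this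
    have h4 : Laplacian.laplacian (fun z : Plane => η • ‖z - x‖ ^ 2) x = η • 4 := this
    rw [h4, smul_eq_mul, hη]
    linarith
  obtain ⟨v0, hv0, hv00⟩ := exists_lt_of_lt_largest A hx0
  have hev := ((hψc.eventually (by simp)).and
    ((ContDiffAt.continuousAt_laplacian hψc).eventually (gt_mem_nhds hψΔ))).and
    ((eventually_mem_posSet hv0.1.continuousOn hxc hv00).and
      (hmax.and (isClosed_closure.isOpen_compl.mem_nhds hxc)))
  obtain ⟨r, hr, hball⟩ := Metric.eventually_nhds_iff_ball.1 hev
  have hsub : closedBall x (r / 2) ⊆ ball x r := closedBall_subset_ball (by linarith)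
  obtain ⟨v1, hv1, hv1x⟩ := exists_lt_of_lt_largest A
    (show u x - η * (r / 2) ^ 2 < 𝓤 D f g h x by have : 0 < η * (r / 2) ^ 2 := by positivity
                                                 linarith)
  -- Joining v0 makes the member positive on the whole disc, so its subharmonicity is available
  -- wherever the contact point falls.
  have hv := max_mem_Fam hv0 hv1
  set v : Plane → ℝ := fun z => max (v0 z) (v1 z) with hvdef
  have hnD : ∀ z ∈ closedBall x (r / 2), z ∉ D := fun z hz => (hball z (hsub hz)).2.1.1
  obtain ⟨y, hy, hymax⟩ := (isCompact_closedBall x (r / 2)).exists_isMaxOn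
    ⟨x, mem_closedBall_self (by positivity)⟩ (f := fun z => v z - ψ z) (by
      refine ContinuousOn.sub (hv.1.continuousOn.mono hnD) fun z hz => ?_
      exact ((hball z (hsub hz)).1.1.continuousAt).continuousWithinAt)
  have hyx : v x - ψ x ≤ v y - ψ y := hymax (mem_closedBall_self (by positivity))
  have hyb := hball y (hsub hy)
  have hyint : y ∈ ball x (r / 2) := by
    by_contra hn
    have hys : dist y x = r / 2 := le_antisymm hy (not_lt.1 hn)
    have h1 := hyb.2.2.1
    have h2 : v y ≤ u y := le_largest hv (hnD y hy)
    have h3 : v1 x ≤ v x := le_max_right _ _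
    have h4 : ψ y = φ y + η * (r / 2) ^ 2 := by
      simp only [hψ, Pi.add_apply, smul_eq_mul, ← dist_eq_norm, hys]
    have h5 : ψ x = φ x := by simp [hψ]
    linarith
  have h0 := hv.1.subharmonic y ⟨⟨hnD y hy, hyb.2.1.2.trans_le (le_max_left _ _)⟩, hyb.2.2.2⟩ ψ
    hyb.1.1 (by
      filter_upwards [isOpen_ball.mem_nhds hyint] with z hz
      exact hymax (ball_subset_closedBall hz))
  linarith [hyb.1.2]

theorem norm_sub_sq_expand (x q z : Plane) {σ : ℝ} (hσ : 0 < σ) (hqz : dist q z = σ) :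
    ‖x - z‖ ^ 2 = ‖x - q‖ ^ 2 + 2 * σ * inner ℝ (x - q) (σ⁻¹ • (q - z)) + σ ^ 2 := by
  have h1 : x - z = (x - q) + (q - z) := by abel
  rw [h1, norm_add_sq_real, inner_smul_right, ← dist_eq_norm q z, hqz]
  field_simp

/-- By ln t ≤ t - 1 the logarithm is at most B(|x - z|/σ - 1), and |x - z| - σ exceeds its linear
part by at most |x - q|²/(2σ). -/
theorem belowPlane_of_le_log {q z : Plane} {σ B : ℝ} (hσ : 0 < σ) (hB : 0 ≤ B)
    (hqz : dist q z = σ)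
    (hv : ∀ᶠ x in 𝓝 q, v x ≤ 0 ∨ x ≠ z ∧ v x ≤ B * (Real.log ‖x - z‖ - Real.log σ)) :
    BelowPlane v q (σ⁻¹ • (q - z)) (B / σ) := by
  intro ε hε
  have hsmall : ∀ᶠ x in 𝓝 q, B / (2 * σ ^ 2) * ‖x - q‖ < ε := by
    have hc : Continuous fun x : Plane => B / (2 * σ ^ 2) * ‖x - q‖ := by fun_prop
    have := hc.tendsto q
    simp only [sub_self, norm_zero, mul_zero] at this
    exact this.eventually (gt_mem_nhds hε)
  filter_upwards [hv, hsmall] with x hx hxs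
  set b := inner ℝ (x - q) (σ⁻¹ • (q - z)) with hb
  have hb0 : (0 : ℝ) ≤ max b 0 := le_max_right _ _
  have hr0 := norm_nonneg (x - q)
  rcases hx with hx | ⟨hxz, hx⟩
  · refine hx.trans ?_
    positivity
  · have hpos : 0 < ‖x - z‖ := norm_pos_iff.2 (sub_ne_zero.2 hxz)
    have h1 : Real.log ‖x - z‖ - Real.log σ ≤ ‖x - z‖ / σ - 1 := by
      rw [← Real.log_div hpos.ne' hσ.ne']
      exact Real.log_le_sub_one_of_pos (by positivity)
    have h2 : ‖x - z‖ / σ - 1 ≤ (b + ‖x - q‖ ^ 2 / (2 * σ)) / σ := by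
      have h3 := norm_sub_sq_expand x q z hσ hqz
      rw [← hb] at h3
      rw [div_sub_one hσ.ne']
      gcongr
      have h4 : ‖x - z‖ ≤ (‖x - z‖ ^ 2 + σ ^ 2) / (2 * σ) := by
        rw [le_div_iff₀ (by positivity)]
        nlinarith [sq_nonneg (‖x - z‖ - σ)]
      rw [h3] at h4
      have h5 : (‖x - q‖ ^ 2 + 2 * σ * b + σ ^ 2 + σ ^ 2) / (2 * σ) =
          ‖x - q‖ ^ 2 / (2 * σ) + b + σ := by field_simp; ring
      linarith
    have h6 : v x ≤ B * ((b + ‖x - q‖ ^ 2 / (2 * σ)) / σ) :=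
      hx.trans (mul_le_mul_of_nonneg_left (h1.trans h2) hB)
    have h7 : B * ((b + ‖x - q‖ ^ 2 / (2 * σ)) / σ) =
        B / σ * b + B / (2 * σ ^ 2) * ‖x - q‖ * ‖x - q‖ := by field_simp
    have h8 : B / σ * b ≤ B / σ * max b 0 := by
      gcongr
      exact le_max_left _ _
    nlinarith

/-- A logarithm that lies above a subsolution and touches its positivity set from outside has
slope at least `√f` at the touching point. -/
theorem sqrt_le_of_touching (hv : v ∈ Fam D f g h) {x₀ z q : Plane} {κ σ B : ℝ}
    (hσ : 0 < σ) (hB : 0 ≤ B) (hdisj : Disjoint (ball z σ) (posSet D v))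
    (hq : q ∈ closure (posSet D v)) (hqz : dist q z = σ) (hqκ : q ∈ ball x₀ κ)
    (hD : Disjoint (closedBall x₀ κ) (closure D))
    (hle : ∀ x, dist x x₀ = κ → σ ≤ dist x z → v x ≤ B * (Real.log ‖x - z‖ - Real.log σ)) :
    √(f q) ≤ B / σ := by
  have hnc : ∀ x ∈ closedBall x₀ κ, x ∉ closure D := fun x hx h => hD.ne_of_mem hx h rfl
  have hnD : ∀ x ∈ closedBall x₀ κ, x ∉ D := fun x hx h => hnc x hx (subset_closure h)
  have hzero : ∀ x ∈ closedBall x₀ κ, dist x z ≤ σ → v x ≤ 0 := by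
    intro x hx hxσ
    by_contra! hpos
    have h1 := eventually_mem_posSet hv.1.continuousOn (hnc x hx) hpos
    have h2 : x ∈ closure (ball z σ) := by rw [closure_ball z hσ.ne']; exact hxσ
    rw [mem_closure_iff_frequently] at h2
    obtain ⟨y, hy1, hy2⟩ := (h2.and_eventually h1).exists
    exact hdisj.ne_of_mem hy1 hy2 rfl
  have hqc := hnc q (ball_subset_closedBall hqκ)
  have hqfr : q ∈ frontier (posSet D v) := by
    refine ⟨hq, fun hi => ?_⟩
    have := (interior_subset hi).2
    linarith [hzero q (ball_subset_closedBall hqκ) hqz.le]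
  refine hv.1.freeBoundary q ⟨hqfr, hqc⟩ z σ hσ hqz hdisj _ (belowPlane_of_le_log hσ hB hqz ?_)
  set O : Set Plane := ball x₀ κ \ closedBall z σ with hO
  have hOo : IsOpen O := isOpen_ball.sdiff isClosed_closedBall
  have hclO : ∀ x ∈ closure O, x ∈ closedBall x₀ κ ∧ σ ≤ dist x z := by
    intro x hx
    refine ⟨closure_ball_subset_closedBall (closure_mono sdiff_subset hx), ?_⟩
    have : closure O ⊆ (ball z σ)ᶜ := closure_minimal (fun y hy h => hy.2 (ball_subset_closedBall h))
      isOpen_ball.isClosed_compl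
    exact not_lt.1 (this hx)
  have hne : ∀ x, σ ≤ dist x z → x ≠ z := by
    rintro x hx rfl
    rw [dist_self] at hx; linarith
  have hlog : ∀ x, σ ≤ dist x z → 0 ≤ B * (Real.log ‖x - z‖ - Real.log σ) := by
    intro x hx
    rw [dist_eq_norm] at hx
    exact mul_nonneg hB (sub_nonneg.2 (Real.log_le_log hσ hx))
  have hharm : ∀ x, σ ≤ dist x z →
      HarmonicAt (fun x => B * (Real.log ‖x - z‖ - Real.log σ)) x := fun x hx =>
    ((harmonicAt_log_norm_sub (hne x hx)).sub (harmonicAt_const (Real.log σ))).const_smul (c := B)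
  -- Comparison in the part of the disc outside the ball: v vanishes on the circle about z, and
  -- `hle` handles the outer circle. The logarithm then caps the slope of v at q.
  have hcmp := ViscositySubharmonicOn.le_of_frontier (O := O) (v := v)
    (w := fun x => B * (Real.log ‖x - z‖ - Real.log σ)) hOo
    (isBounded_ball.subset sdiff_subset) (hv.1.continuousOn.mono fun x hx => hnD x (hclO x hx).1)
    (fun x hx => (hharm x (hclO x hx).2).1.continuousAt.continuousWithinAt)
    (hv.1.subharmonic.mono fun x hx => ⟨⟨hnD x (hclO x (subset_closure hx.1)).1,
      (hlog x (hclO x (subset_closure hx.1)).2).trans_lt hx.2⟩,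
      hnc x (hclO x (subset_closure hx.1)).1⟩)
    (fun x hx => (hharm x (hclO x (subset_closure hx)).2).1)
    (fun x hx => (HarmonicAt.laplacian_eq_zero (hharm x (hclO x (subset_closure hx)).2)).le)
    (by
      intro x hx
      rw [hOo.frontier_eq] at hx
      obtain ⟨h1, h2⟩ := hclO x hx.1
      by_cases hxκ : dist x x₀ = κ
      · exact hle x hxκ h2
      · have hxz : dist x z ≤ σ := by
          by_contra! hn
          exact hx.2 ⟨lt_of_le_of_ne h1 hxκ, not_le.2 hn⟩
        exact (hzero x h1 hxz).trans (hlog x h2))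
  filter_upwards [isOpen_ball.mem_nhds hqκ] with x hx
  by_cases hxσ : dist x z ≤ σ
  · exact Or.inl (hzero x (ball_subset_closedBall hx) hxσ)
  · have hxO : x ∈ O := ⟨hx, hxσ⟩
    exact Or.inr ⟨hne x (not_le.1 hxσ).le, hcmp x (subset_closure hxO)⟩

/-- A nearly flat disc lies below the logarithm of a slightly larger slope on small circles. -/
theorem slope_le_log {L β θ X : ℝ} (hL : 1 ≤ L) (hβ : -(1 / (4 * L)) ≤ β) (hβ1 : β ≤ 1)
    (hθ : θ = 1 / (1 + 3 / (2 * L))) (hX : X = 1 / L ^ 2 + 2 * β / L) :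
    θ * (1 / (2 * L) + β) ≤ L * (1 / 2 * Real.log (1 + X)) ∧ 0 ≤ X := by
  have hL0 : 0 < L := by linarith
  have hX0 : 0 ≤ X := by
    have : -(1 / (4 * L)) * (2 / L) ≤ β * (2 / L) := by gcongr
    have h2 : -(1 / (4 * L)) * (2 / L) = - (1 / (2 * L ^ 2)) := by field_simp; ring
    have h3 : 1 / L ^ 2 - 1 / (2 * L ^ 2) = 1 / (2 * L ^ 2) := by field_simp; ring
    have h4 : 0 < 1 / (2 * L ^ 2) := by positivity
    have h5 : 2 * β / L = β * (2 / L) := by ring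
    rw [hX, h5]; linarith
  refine ⟨?_, hX0⟩
  -- In ln(1 + X) ≥ 2X/(X + 2), the bound X ≤ 3/L turns the denominator into the constant behind θ.
  have hX3 : X ≤ 3 / L := by
    have h1 : 1 / L ^ 2 ≤ 1 / L := by
      apply one_div_le_one_div_of_le hL0; nlinarith
    have h2 : 2 * β / L ≤ 2 / L := by gcongr; linarith
    have h3 : 1 / L + 2 / L = 3 / L := by ring
    rw [hX]; linarith
  have hlog := Real.le_log_one_add_of_nonneg hX0
  have h1 : θ * (1 / (2 * L) + β) = L * (1 / 2 * (2 * X / (3 / L + 2))) := by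
    rw [hθ, hX]; field_simp; ring
  have h2 : 2 * X / (3 / L + 2) ≤ 2 * X / (X + 2) := by gcongr
  rw [h1]
  have := h2.trans hlog
  gcongr

set_option maxHeartbeats 1600000 in
-- Suppose α < α' < √(f x₀). A logarithm of slope α' on a circle through x₀, tangent there to B_s(y)
-- from inside, lies above u with a margin on a small circle about x₀. The condition is then tested
-- on a member v positive near x₀ rather than on u: the point q of the closure of Ω(v) nearest to
-- the centre z is close to x₀, the logarithm with its zero circle moved out to q still lies above
-- v, and `sqrt_le_of_touching` gives √(f q) ≤ α', against the continuity of f.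
theorem freeBoundary_largest (A : Admissible D f g h lam Lam) {x₀ y : Plane} {s α : ℝ}
    (hfr : x₀ ∈ frontier (posSet D (𝓤 D f g h))) (hc : x₀ ∉ closure D) (hs : 0 < s)
    (hxy : dist x₀ y = s) (hdisj : Disjoint (ball y s) (posSet D (𝓤 D f g h)))
    (hb : BelowPlane (𝓤 D f g h) x₀ (s⁻¹ • (x₀ - y)) α) : √(f x₀) ≤ α := by
  by_contra! hlt
  set u := 𝓤 D f g h with hu
  set ν := s⁻¹ • (x₀ - y) with hν
  have hνn : ‖ν‖ = 1 := by
    rw [hν, norm_smul, norm_inv, Real.norm_of_nonneg hs.le, ← dist_eq_norm, hxy,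
      inv_mul_cancel₀ hs.ne']
  have hsf : 0 < √(f x₀) := Real.sqrt_pos.2 (A.lam_pos.trans (A.lam_lt x₀))
  set α₀ := max α 0 with hα₀
  have hb₀ : BelowPlane u x₀ ν α₀ := hb.mono_slope (le_max_left _ _)
  have hα00 : 0 ≤ α₀ := le_max_right _ _
  obtain ⟨α', hα'1, hα'2⟩ := exists_between (max_lt hlt hsf)
  have hα'0 : 0 < α' := hα00.trans_lt hα'1
  -- choice of the ratio `L`
  obtain ⟨L, hL1, hLα⟩ : ∃ L : ℝ, 1 ≤ L ∧ α₀ * (1 + 3 / (2 * L)) ≤ α' := by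
    refine ⟨max 1 (3 * α₀ / (2 * (α' - α₀))), le_max_left _ _, ?_⟩
    have hd : 0 < α' - α₀ := sub_pos.2 hα'1
    have h1 : 3 * α₀ / (2 * (α' - α₀)) ≤ max 1 (3 * α₀ / (2 * (α' - α₀))) := le_max_right _ _
    set L := max 1 (3 * α₀ / (2 * (α' - α₀)))
    have hL0 : 0 < L := lt_of_lt_of_le one_pos (le_max_left _ _)
    rw [div_le_iff₀ (by positivity)] at h1
    have h2 : α₀ * (3 / (2 * L)) ≤ α' - α₀ := by
      rw [mul_div_assoc', div_le_iff₀ (by positivity)]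
      linarith
    linarith
  have hL0 : 0 < L := by linarith
  set θ := 1 / (1 + 3 / (2 * L)) with hθ
  have hθ0 : 0 < θ := by positivity
  have hαθ : α₀ ≤ α' * θ := by
    rw [hθ, mul_one_div, le_div_iff₀ (by positivity)]; exact hLα
  set ε := α' * θ / (8 * L) with hε
  have hε0 : 0 < ε := by positivity
  -- choice of the radius `κ`
  have hfc : ∀ᶠ x in 𝓝 x₀, α' < √(f x) :=
    (Real.continuous_sqrt.comp A.f_cont).continuousAt.eventually (lt_mem_nhds hα'2)
  obtain ⟨κ₀, hκ₀, hκb⟩ := Metric.eventually_nhds_iff_ball.1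
    ((hb₀ ε hε0).and (hfc.and (isClosed_closure.isOpen_compl.mem_nhds hc)))
  set κ := min (κ₀ / 2) (s / (2 * L)) with hκ
  have hκ0 : 0 < κ := by positivity
  have hκκ : κ < κ₀ := (min_le_left _ _).trans_lt (by linarith)
  have hκs : 2 * L * κ ≤ s := by
    have : κ ≤ s / (2 * L) := min_le_right _ _
    rw [le_div_iff₀ (by positivity)] at this
    linarith
  set σ₀ := L * κ with hσ₀
  have hσ₀0 : 0 < σ₀ := by positivity
  set z := x₀ - σ₀ • ν with hz
  have hx₀z : dist x₀ z = σ₀ := by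
    rw [dist_eq_norm, hz, sub_sub_cancel, norm_smul, hνn, mul_one, Real.norm_of_nonneg hσ₀0.le]
  have hνz : σ₀⁻¹ • (x₀ - z) = ν := by
    rw [hz, sub_sub_cancel, smul_smul, inv_mul_cancel₀ hσ₀0.ne', one_smul]
  have hexz : ∀ x : Plane, ‖x - z‖ ^ 2 = ‖x - x₀‖ ^ 2 + 2 * σ₀ * inner ℝ (x - x₀) ν + σ₀ ^ 2 :=
    fun x => by rw [norm_sub_sq_expand x x₀ z hσ₀0 hx₀z, hνz]
  have hexy : ∀ x : Plane, ‖x - y‖ ^ 2 = ‖x - x₀‖ ^ 2 + 2 * s * inner ℝ (x - x₀) ν + s ^ 2 :=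
    fun x => norm_sub_sq_expand x x₀ y hs hxy
  have hinner : ∀ x, x ∉ ball y s → -‖x - x₀‖ ^ 2 ≤ 2 * s * inner ℝ (x - x₀) ν := by
    intro x hx
    have h1 : s ≤ ‖x - y‖ := by
      rw [← dist_eq_norm]; exact not_lt.1 hx
    have := hexy x
    nlinarith
  -- Since σ₀ ≤ s/2, points outside B_s(y) move away from the smaller tangent ball quadratically.
  -- This confines the nearly touching points to a neighbourhood of x₀.
  have hfar : ∀ x, x ∉ ball y s → ‖x - x₀‖ ^ 2 / 2 + σ₀ ^ 2 ≤ ‖x - z‖ ^ 2 := by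
    intro x hx
    have h1 := hinner x hx
    rw [hexz x]
    have h2 : σ₀ / s ≤ 1 / 2 := by rw [div_le_div_iff₀ hs two_pos]; linarith
    have h3 : 2 * σ₀ * inner ℝ (x - x₀) ν = σ₀ / s * (2 * s * inner ℝ (x - x₀) ν) := by
      field_simp
    rw [h3]
    have h4 : σ₀ / s * (-‖x - x₀‖ ^ 2) ≤ σ₀ / s * (2 * s * inner ℝ (x - x₀) ν) := by gcongr
    nlinarith [sq_nonneg ‖x - x₀‖]
  -- the logarithm lies strictly above `u` on the circle of radius `κ`
  have habove : ∀ x, dist x x₀ = κ → x ∉ ball y s →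
      u x + ε * κ ≤ α' * σ₀ * (Real.log ‖x - z‖ - Real.log σ₀) := by
    intro x hx hxy'
    have hxn : ‖x - x₀‖ = κ := by rw [← dist_eq_norm, hx]
    have hu1 := (hκb x (by rw [mem_ball, hx]; exact hκκ)).1
    rw [hxn] at hu1
    set b := inner ℝ (x - x₀) ν with hbdef
    have hbκ : b ≤ κ := by
      have := real_inner_le_norm (x - x₀) ν
      rw [hνn, hxn, mul_one] at this
      exact this
    have hin := hinner x hxy'
    rw [hxn, ← hbdef] at hin
    have hβ : -(1 / (4 * L)) ≤ b / κ := by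
      rw [le_div_iff₀ hκ0]
      have h3 : -(1 / (4 * L)) * κ = -κ / (4 * L) := by ring
      rw [h3, div_le_iff₀ (by positivity)]
      have h4 : -κ ^ 2 ≤ 2 * s * b := hin
      by_cases hb0 : 0 ≤ b
      · nlinarith [mul_nonneg hb0 hL0.le]
      · push Not at hb0
        nlinarith
    obtain ⟨hlog, hX0⟩ := slope_le_log (θ := θ) hL1 hβ ((div_le_one hκ0).2 hbκ) hθ rfl
    have hX : ‖x - z‖ ^ 2 = σ₀ ^ 2 * (1 + (1 / L ^ 2 + 2 * (b / κ) / L)) := by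
      rw [hexz x, hxn, hσ₀]
      field_simp
      ring
    have hxz0 : 0 < ‖x - z‖ := by
      have := hfar x hxy'
      have h5 : 0 < ‖x - z‖ ^ 2 := by nlinarith [sq_nonneg ‖x - x₀‖]
      exact lt_of_le_of_ne (norm_nonneg _) fun h => by rw [← h] at h5; norm_num at h5
    have hlogeq : Real.log ‖x - z‖ - Real.log σ₀ =
        1 / 2 * Real.log (1 + (1 / L ^ 2 + 2 * (b / κ) / L)) := by
      have h6 : Real.log (‖x - z‖ ^ 2) = Real.log (σ₀ ^ 2) +
          Real.log (1 + (1 / L ^ 2 + 2 * (b / κ) / L)) := by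
        rw [hX, Real.log_mul (by positivity) (by positivity)]
      rw [Real.log_pow, Real.log_pow] at h6
      push_cast at h6
      linarith
    rw [hlogeq]
    have h7 : α' * κ * (θ * (1 / (2 * L) + b / κ)) ≤
        α' * κ * (L * (1 / 2 * Real.log (1 + (1 / L ^ 2 + 2 * (b / κ) / L)))) := by gcongr
    have h8 : α' * κ * (θ * (1 / (2 * L) + b / κ)) = 4 * ε * κ + α' * θ * b := by
      rw [hε]; field_simp; ring
    have h9 : α' * κ * (L * (1 / 2 * Real.log (1 + (1 / L ^ 2 + 2 * (b / κ) / L)))) =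
        α' * σ₀ * (1 / 2 * Real.log (1 + (1 / L ^ 2 + 2 * (b / κ) / L))) := by rw [hσ₀]; ring
    rw [← h9]
    refine le_trans ?_ h7
    rw [h8]
    by_cases hb0 : 0 ≤ b
    · rw [max_eq_left hb0] at hu1
      nlinarith
    · push Not at hb0
      rw [max_eq_right hb0.le] at hu1
      have h10 : -(2 * ε * κ) ≤ α' * θ * b := by
        have h11 : α' * θ * (-(1 / (4 * L)) * κ) ≤ α' * θ * b := by
          rw [le_div_iff₀ hκ0] at hβ
          gcongr
        have h12 : α' * θ * (-(1 / (4 * L)) * κ) = -(2 * ε * κ) := by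
          rw [hε]; field_simp; ring
        linarith
      linarith
  -- choice of the gap `η`
  set η := min (σ₀ / 2) (min (ε * κ / α') (κ ^ 2 / (12 * σ₀))) with hη
  have hη0 : 0 < η := by positivity
  have hη1 : η ≤ σ₀ / 2 := min_le_left _ _
  have hη2 : α' * η ≤ ε * κ := by
    have : η ≤ ε * κ / α' := (min_le_right _ _).trans (min_le_left _ _)
    rw [le_div_iff₀ hα'0] at this
    linarith
  have hη3 : 12 * σ₀ * η ≤ κ ^ 2 := by
    have : η ≤ κ ^ 2 / (12 * σ₀) := (min_le_right _ _).trans (min_le_right _ _)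
    rw [le_div_iff₀ (by positivity)] at this
    linarith
  have hclose : ∀ x, x ∉ ball y s → dist x z ≤ σ₀ + η → dist x x₀ < κ := by
    intro x hx hxz
    have h1 := hfar x hx
    rw [dist_eq_norm] at hxz ⊢
    have h2 : ‖x - z‖ ^ 2 ≤ (σ₀ + η) ^ 2 := by gcongr
    have h3 : ‖x - x₀‖ ^ 2 < κ ^ 2 := by nlinarith
    exact lt_of_pow_lt_pow_left₀ 2 hκ0.le h3
  obtain ⟨z₁, hz₁, hz₁d⟩ := Metric.mem_closure_iff.1 hfr.1 (min η κ) (by positivity)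
  obtain ⟨v, hv, hvz⟩ := exists_lt_of_lt_largest A hz₁.2
  have hvu := posSet_subset_largest hv
  have hz₁v : z₁ ∈ posSet D v := ⟨hz₁.1, hvz⟩
  have hPne : (closure (posSet D v)).Nonempty := ⟨z₁, subset_closure hz₁v⟩
  obtain ⟨q, hq, hqd⟩ := isClosed_closure.exists_infDist_eq_dist hPne z
  rw [infDist_closure] at hqd
  have hvdisj : Disjoint (ball y s) (posSet D v) := hdisj.mono_right hvu
  have hnb : ∀ x ∈ closure (posSet D v), x ∉ ball y s := fun x hx hxb =>
    (hvdisj.closure_right isOpen_ball).ne_of_mem hxb hx rfl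
  set σ := dist z q with hσ
  have hσle : σ ≤ σ₀ + η := by
    rw [← hqd]
    refine (infDist_le_dist_of_mem hz₁v).trans ?_
    have := dist_triangle z x₀ z₁
    rw [dist_comm z x₀, hx₀z] at this
    linarith [hz₁d.trans_le (min_le_left η κ)]
  have hσge : σ₀ ≤ σ := by
    have h1 := hfar q (hnb q hq)
    have h2 : σ₀ ^ 2 ≤ σ ^ 2 := by
      rw [hσ, dist_comm, dist_eq_norm]; nlinarith [sq_nonneg ‖q - x₀‖]
    exact le_of_sq_le_sq h2 dist_nonneg
  have hqκ : q ∈ ball x₀ κ := hclose q (hnb q hq) (by rw [dist_comm]; exact hσle)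
  have hcb : ∀ x ∈ closedBall x₀ κ, x ∈ ball x₀ κ₀ := fun x hx => (mem_closedBall.1 hx).trans_lt hκκ
  have hσ0 : 0 < σ := hσ₀0.trans_le hσge
  have htouch := sqrt_le_of_touching hv (x₀ := x₀) (z := z) (q := q) (κ := κ) (σ := σ)
    (B := α' * σ₀) hσ0 (by positivity)
    (disjoint_left.2 fun x hx hxv => by
      have := infDist_le_dist_of_mem (x := z) hxv
      rw [hqd, dist_comm z x] at this
      exact absurd hx (not_lt.2 this)) hq (dist_comm _ _) hqκ
    (disjoint_left.2 fun x hx => (hκb x (hcb x hx)).2.2)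
    (fun x hx hxσ => by
      have hxc := (hκb x (by rw [mem_ball, hx]; exact hκκ)).2.2
      have hxD : x ∉ D := fun h => hxc (subset_closure h)
      rw [dist_eq_norm] at hxσ
      by_cases hxv : x ∈ posSet D v
      · have h1 := habove x hx (hnb x (subset_closure hxv))
        have h2 := le_largest hv hxD
        have h3 : Real.log σ - Real.log σ₀ ≤ η / σ₀ := by
          rw [← Real.log_div hσ0.ne' hσ₀0.ne']
          refine (Real.log_le_sub_one_of_pos (by positivity)).trans ?_
          rw [div_sub_one hσ₀0.ne']
          gcongr
          linarith
        have h4 : α' * σ₀ * (Real.log σ - Real.log σ₀) ≤ α' * σ₀ * (η / σ₀) := by gcongr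
        have h5 : α' * σ₀ * (η / σ₀) = α' * η := by field_simp
        have h6 : u x = 𝓤 D f g h x := rfl
        nlinarith
      · have h1 : v x ≤ 0 := not_lt.1 fun h => hxv ⟨hxD, h⟩
        refine h1.trans (mul_nonneg (by positivity) (sub_nonneg.2 (Real.log_le_log hσ0 hxσ))))
  have hfq := (hκb q (hcb q (ball_subset_closedBall hqκ))).2.1
  have : α' * σ₀ / σ ≤ α' := by
    rw [div_le_iff₀ hσ0]; gcongr
  linarith

theorem largest_mem_Fam (A : Admissible D f g h lam Lam) : 𝓤 D f g h ∈ Fam D f g h :=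
  ⟨⟨(continuousOn_largest A).1, fun _ hx => largest_nonneg A hx, viscositySubharmonicOn_largest A,
    (continuousOn_largest A).2, fun _ hx _ _ hs hxy hd _ hb =>
      freeBoundary_largest A hx.1 hx.2 hs hxy hd hb⟩, fun _ hx => largest_le_barrier A hx⟩

end FreeBoundary

/-! ### Integrated circular averages and the counting of disjoint balls -/

namespace FreeBoundary

/-- The bump `((4s² - |y - x|²)⁺)²`, supported in the ball of radius `2s`. -/
noncomputable def bump (x : Plane) (s : ℝ) (y : Plane) : ℝ :=
  max (4 * s ^ 2 - ‖y - x‖ ^ 2) 0 ^ 2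

theorem continuous_bump (x : Plane) (s : ℝ) : Continuous (bump x s) := by
  unfold bump; fun_prop

theorem bump_nonneg (x : Plane) (s : ℝ) (y : Plane) : 0 ≤ bump x s y := sq_nonneg _

theorem bump_eq_zero {x y : Plane} {s : ℝ} (hs : 0 ≤ s) (h : 2 * s ≤ ‖y - x‖) :
    bump x s y = 0 := by
  have : (2 * s) ^ 2 ≤ ‖y - x‖ ^ 2 := by gcongr
  rw [bump, max_eq_right (by linarith)]
  simp

theorem le_bump {x y : Plane} {s : ℝ} (h : ‖y - x‖ ≤ s) : 9 * s ^ 4 ≤ bump x s y := by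
  have h1 : ‖y - x‖ ^ 2 ≤ s ^ 2 := by gcongr
  have h2 : 3 * s ^ 2 ≤ max (4 * s ^ 2 - ‖y - x‖ ^ 2) 0 := le_max_of_le_left (by linarith)
  calc 9 * s ^ 4 = (3 * s ^ 2) ^ 2 := by ring
    _ ≤ _ := by unfold bump; gcongr

/-- For c ≤ 0 each of the two shifted positive parts is at most |a|. For c ≥ 0, dropping the
positive parts leaves 2a² + 2k² - 4ck. -/
theorem sq_max_add_sq_max_le (c a k : ℝ) (hk : 0 ≤ k) :
    max (c - a - k) 0 ^ 2 + max (c + a - k) 0 ^ 2 - 2 * max c 0 ^ 2 ≤ 2 * (a ^ 2 + k ^ 2) := by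
  have key : ∀ r : ℝ, max r 0 ^ 2 ≤ r ^ 2 := fun r => by
    rcases le_total r 0 with h | h
    · rw [max_eq_right h, zero_pow two_ne_zero]; exact sq_nonneg r
    · rw [max_eq_left h]
  rcases le_total c 0 with hc | hc
  · have h1 : max (c - a - k) 0 ^ 2 ≤ a ^ 2 := by
      rw [← sq_abs a]
      have : max (c - a - k) 0 ≤ |a| := max_le (by linarith [neg_abs_le a]) (abs_nonneg a)
      gcongr
    have h2 : max (c + a - k) 0 ^ 2 ≤ a ^ 2 := by
      rw [← sq_abs a]
      have : max (c + a - k) 0 ≤ |a| := max_le (by linarith [le_abs_self a]) (abs_nonneg a)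
      gcongr
    nlinarith [sq_nonneg (max c 0), sq_nonneg k]
  · rw [max_eq_left hc]
    nlinarith [key (c - a - k), key (c + a - k)]

theorem bump_add_add_bump_sub (x y e : Plane) (s : ℝ) :
    bump x s (y + e) + bump x s (y - e) - 2 * bump x s y ≤
      2 * (2 * ‖y - x‖ * ‖e‖ + ‖e‖ ^ 2) ^ 2 := by
  have h1 : ‖y + e - x‖ ^ 2 = ‖y - x‖ ^ 2 + 2 * inner ℝ (y - x) e + ‖e‖ ^ 2 := by
    rw [add_sub_right_comm, norm_add_sq_real]
  have h2 : ‖y - e - x‖ ^ 2 = ‖y - x‖ ^ 2 - 2 * inner ℝ (y - x) e + ‖e‖ ^ 2 := by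
    rw [sub_right_comm, norm_sub_sq_real]
  have h3 := sq_max_add_sq_max_le (4 * s ^ 2 - ‖y - x‖ ^ 2) (2 * inner ℝ (y - x) e) (‖e‖ ^ 2)
    (sq_nonneg _)
  have h4 : (2 * inner ℝ (y - x) e) ^ 2 ≤ (2 * ‖y - x‖ * ‖e‖) ^ 2 := by
    rw [← sq_abs]
    have : |2 * inner ℝ (y - x) e| ≤ 2 * ‖y - x‖ * ‖e‖ := by
      rw [abs_mul, abs_two, mul_assoc]
      gcongr
      exact abs_real_inner_le_norm _ _
    gcongr
  unfold bump
  rw [h1, h2]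
  have h5 : 4 * s ^ 2 - (‖y - x‖ ^ 2 + 2 * inner ℝ (y - x) e + ‖e‖ ^ 2) =
    4 * s ^ 2 - ‖y - x‖ ^ 2 - 2 * inner ℝ (y - x) e - ‖e‖ ^ 2 := by ring
  have h6 : 4 * s ^ 2 - (‖y - x‖ ^ 2 - 2 * inner ℝ (y - x) e + ‖e‖ ^ 2) =
    4 * s ^ 2 - ‖y - x‖ ^ 2 + 2 * inner ℝ (y - x) e - ‖e‖ ^ 2 := by ring
  rw [h5, h6]
  have h7 : 0 ≤ 2 * ‖y - x‖ * ‖e‖ * ‖e‖ ^ 2 := by positivity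
  nlinarith

/-- 98 = 2 · 7²: within 3s of x one has 2|y - x|t + t² ≤ 7st, and farther out both shifted bumps
vanish because t ≤ s. -/
theorem bump_second_difference_le {x y e : Plane} {s t : ℝ} (hs : 0 < s) (hts : t ≤ s)
    (he : ‖e‖ = t) :
    bump x s (y - e) + bump x s (y + e) - 2 * bump x s y ≤
      (closedBall x (3 * s)).indicator (fun _ => 98 * (s * t) ^ 2) y := by
  have ht : 0 ≤ t := he ▸ norm_nonneg e
  by_cases hy : y ∈ closedBall x (3 * s)
  · rw [indicator_of_mem hy]
    rw [mem_closedBall, dist_eq_norm] at hy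
    have h1 := bump_add_add_bump_sub x y e s
    rw [he] at h1
    have h2 : 2 * ‖y - x‖ * t + t ^ 2 ≤ 7 * (s * t) := by nlinarith
    have h3 : 2 * (2 * ‖y - x‖ * t + t ^ 2) ^ 2 ≤ 2 * (7 * (s * t)) ^ 2 := by gcongr
    linarith
  · rw [indicator_of_notMem hy]
    rw [mem_closedBall, dist_eq_norm, not_le] at hy
    have h1 : bump x s (y - e) = 0 := bump_eq_zero hs.le (by
      have := norm_sub_norm_le (y - x) e
      rw [sub_right_comm]; linarith)
    have h2 : bump x s (y + e) = 0 := bump_eq_zero hs.le (by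
      have := norm_sub_norm_le (y - x) (-e)
      rw [norm_neg, sub_neg_eq_add] at this
      rw [add_sub_right_comm]; linarith)
    rw [h1, h2]
    linarith [bump_nonneg x s y]

theorem hasCompactSupport_bump_mul (x : Plane) {s : ℝ} (hs : 0 ≤ s) (w : Plane → ℝ) :
    HasCompactSupport fun y => bump x s y * w y :=
  HasCompactSupport.intro (isCompact_closedBall x (2 * s)) fun y hy => by
    rw [mem_closedBall, dist_eq_norm, not_le] at hy
    simp [bump_eq_zero hs hy.le]

theorem integrable_bump_mul (x : Plane) {s : ℝ} (hs : 0 ≤ s) {w : Plane → ℝ}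
    (hw : Continuous w) : Integrable fun y => bump x s y * w y :=
  ((continuous_bump x s).mul hw).integrable_of_hasCompactSupport (hasCompactSupport_bump_mul x hs w)

theorem continuous_circAvg {u : Plane → ℝ} (hu : Continuous u) (t : ℝ) :
    Continuous fun y => circAvg u y t := by
  unfold circAvg
  refine continuous_const.mul (intervalIntegral.continuous_parametric_intervalIntegral_of_continuous'
    (f := fun y θ => u (y + t • dir θ)) ?_ _ _)
  have := continuous_dir
  fun_prop

theorem integral_bump_mul_circAvg (x : Plane) {s : ℝ} (hs : 0 ≤ s) {u : Plane → ℝ}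
    (hu : Continuous u) (t : ℝ) :
    ∫ y, bump x s y * circAvg u y t =
      (2 * Real.pi)⁻¹ * ∫ θ in (0 : ℝ)..2 * Real.pi, ∫ y, bump x s y * u (y + t • dir θ) := by
  have hd := continuous_dir
  have hb := continuous_bump x s
  set K := closedBall x (2 * s) with hK
  have hz : ∀ w : Plane → ℝ, ∫ y, bump x s y * w y = ∫ y in K, bump x s y * w y := fun w => by
    refine (setIntegral_eq_integral_of_forall_compl_eq_zero fun y hy => ?_).symm
    rw [hK, mem_closedBall, dist_eq_norm, not_le] at hy
    simp [bump_eq_zero hs hy.le]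
  simp_rw [hz]
  have hpi : (0 : ℝ) ≤ 2 * Real.pi := by positivity
  have h1 : ∀ y, bump x s y * circAvg u y t =
      (2 * Real.pi)⁻¹ * ∫ θ in Ioc (0 : ℝ) (2 * Real.pi), bump x s y * u (y + t • dir θ) := by
    intro y
    rw [circAvg, intervalIntegral.integral_of_le hpi, integral_const_mul]
    ring
  simp_rw [h1]
  rw [integral_const_mul, intervalIntegral.integral_of_le hpi]
  congr 1
  refine integral_integral_swap (f := fun y θ => bump x s y * u (y + t • dir θ)) ?_
  rw [Measure.prod_restrict]
  have hc : Continuous (Function.uncurry fun (y : Plane) (θ : ℝ) =>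
      bump x s y * u (y + t • dir θ)) := by
    unfold Function.uncurry; fun_prop
  exact (hc.continuousOn.integrableOn_compact
    ((isCompact_closedBall x (2 * s)).prod (isCompact_Icc (a := 0) (b := 2 * Real.pi)))).mono_set
    (prod_mono le_rfl Ioc_subset_Icc_self)

/-- Fubini and translation move the averaging from u to the bump. Pairing the directions θ and θ + π
leaves second differences of the bump, of order s²t² on a disc of area 9πs²; the constant is 441 = 9
· 98/2. No regularity of u beyond continuity is used. -/
theorem integral_bump_mul_circAvg_sub_le (x : Plane) {s t m : ℝ} (hs : 0 < s) (ht : 0 ≤ t)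
    (hts : t ≤ s) {u : Plane → ℝ} (hu : Continuous u) (h0 : ∀ y, 0 ≤ u y) (hm : ∀ y, u y ≤ m) :
    ∫ y, bump x s y * (circAvg u y t - u y) ≤ 441 * Real.pi * m * s ^ 4 * t ^ 2 := by
  have hd := continuous_dir
  have hb := continuous_bump x s
  set G : ℝ → ℝ := fun θ => ∫ y, bump x s y * u (y + t • dir θ) with hG
  set J := ∫ y, bump x s y * u y with hJ
  have hIeq : ∫ y, bump x s y * (circAvg u y t - u y) =
      (2 * Real.pi)⁻¹ * (∫ θ in (0 : ℝ)..2 * Real.pi, G θ) - J := by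
    rw [← integral_bump_mul_circAvg x hs.le hu t, ← integral_sub
      (integrable_bump_mul x hs.le (continuous_circAvg hu t)) (integrable_bump_mul x hs.le hu)]
    simp_rw [mul_sub]
  have hGc : Continuous G := by
    have : G = fun θ => ∫ y in closedBall x (2 * s), bump x s y * u (y + t • dir θ) := by
      funext θ
      refine (setIntegral_eq_integral_of_forall_compl_eq_zero fun y hy => ?_).symm
      rw [mem_closedBall, dist_eq_norm, not_le] at hy
      simp [bump_eq_zero hs.le hy.le]
    rw [this]
    refine continuous_parametric_integral_of_continuous
      (f := fun θ y => bump x s y * u (y + t • dir θ)) ?_ (isCompact_closedBall x (2 * s))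
    unfold Function.uncurry; fun_prop
  have hshift : ∀ e : Plane, ∫ y, bump x s y * u (y + e) = ∫ y, bump x s (y - e) * u y := fun e => by
    rw [← integral_add_right_eq_self (fun y => bump x s (y - e) * u y) e]
    simp
  have hi : ∀ e : Plane, Integrable fun y => bump x s (y - e) * u y := fun e => by
    have := (integrable_bump_mul x hs.le (w := fun y => u (y + e)) (by fun_prop)).comp_sub_right e
    simpa using this
  set κ := 98 * (s * t) ^ 2 with hκ
  have hpair : ∀ θ, G θ + G (θ + Real.pi) ≤ 2 * J + 9 * Real.pi * s ^ 2 * (κ * m) := by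
    intro θ
    set e := t • dir θ with he
    have hen : ‖e‖ = t := by rw [he, norm_smul, norm_dir, mul_one, Real.norm_of_nonneg ht]
    have e1 : G θ = ∫ y, bump x s (y - e) * u y := hshift e
    have e2 : G (θ + Real.pi) = ∫ y, bump x s (y + e) * u y := by
      rw [hG]; dsimp only
      rw [dir_add_pi, smul_neg, hshift (-e)]
      simp
    have hi2 : Integrable fun y => bump x s (y + e) * u y := by simpa using hi (-e)
    have e3 : G θ + G (θ + Real.pi) - 2 * J =
        ∫ y, (bump x s (y - e) + bump x s (y + e) - 2 * bump x s y) * u y := by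
      have hi3 : Integrable fun y => bump x s (y - e) * u y + bump x s (y + e) * u y :=
        (hi e).add hi2
      rw [e1, e2, hJ, ← integral_const_mul, ← integral_add (hi e) hi2,
        ← integral_sub hi3 ((integrable_bump_mul x hs.le hu).const_mul 2)]
      congr 1; funext y; ring
    have hvol : volume.real (closedBall x (3 * s)) = 9 * Real.pi * s ^ 2 := by
      rw [Measure.real, EuclideanSpace.volume_closedBall_fin_two]
      rw [ENNReal.toReal_mul, ENNReal.toReal_pow, ENNReal.toReal_ofReal (by positivity),
        ENNReal.toReal_ofReal Real.pi_pos.le]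
      ring
    have e4 : ∫ y, (bump x s (y - e) + bump x s (y + e) - 2 * bump x s y) * u y ≤
        ∫ y, (closedBall x (3 * s)).indicator (fun _ => κ * m) y := by
      refine integral_mono ?_ ?_ fun y => ?_
      · have := ((hi e).add hi2).sub ((integrable_bump_mul x hs.le hu).const_mul 2)
        refine this.congr (Eventually.of_forall fun y => ?_)
        simp only [Pi.add_apply, Pi.sub_apply]; ring
      · exact (integrable_indicator_iff measurableSet_closedBall).2
          (continuousOn_const.integrableOn_compact (isCompact_closedBall _ _))
      · have h1 := mul_le_mul_of_nonneg_right
          (bump_second_difference_le (x := x) (y := y) hs hts hen) (h0 y)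
        refine h1.trans ?_
        by_cases hy : y ∈ closedBall x (3 * s)
        · simp only [indicator_of_mem hy]
          exact mul_le_mul_of_nonneg_left (hm y) (by positivity)
        · simp [indicator_of_notMem hy]
    rw [integral_indicator measurableSet_closedBall, setIntegral_const, hvol, smul_eq_mul] at e4
    linarith
  have hper : ∫ θ in (0 : ℝ)..2 * Real.pi, G (θ + Real.pi) = ∫ θ in (0 : ℝ)..2 * Real.pi, G θ := by
    have hp : Function.Periodic G (2 * Real.pi) := fun θ => by
      have : dir (θ + 2 * Real.pi) = dir θ := by
        rw [show θ + 2 * Real.pi = θ + Real.pi + Real.pi by ring, dir_add_pi, dir_add_pi, neg_neg]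
      rw [hG]; simp only [this]
    rw [intervalIntegral.integral_comp_add_right,
      show 2 * Real.pi + Real.pi = 0 + Real.pi + 2 * Real.pi by ring,
      hp.intervalIntegral_add_eq (0 + Real.pi) 0, zero_add]
  have hsum : 2 * ∫ θ in (0 : ℝ)..2 * Real.pi, G θ ≤
      2 * Real.pi * (2 * J + 9 * Real.pi * s ^ 2 * (κ * m)) := by
    have h1 : ∫ θ in (0 : ℝ)..2 * Real.pi, (G θ + G (θ + Real.pi)) ≤
        ∫ θ in (0 : ℝ)..2 * Real.pi, (2 * J + 9 * Real.pi * s ^ 2 * (κ * m)) := by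
      refine intervalIntegral.integral_mono_on (by positivity) ?_ ?_ fun θ _ => hpair θ
      · exact Continuous.intervalIntegrable (by fun_prop) _ _
      · exact Continuous.intervalIntegrable (by fun_prop) _ _
    rw [intervalIntegral.integral_add (hGc.intervalIntegrable _ _)
      (Continuous.intervalIntegrable (by fun_prop) _ _), hper, intervalIntegral.integral_const,
      smul_eq_mul, sub_zero] at h1
    linarith
  rw [hIeq]
  have hpi := Real.pi_pos
  have h2 : (2 * Real.pi)⁻¹ * (2 * ∫ θ in (0 : ℝ)..2 * Real.pi, G θ) ≤
      (2 * Real.pi)⁻¹ * (2 * Real.pi * (2 * J + 9 * Real.pi * s ^ 2 * (κ * m))) := by gcongr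
  rw [inv_mul_cancel_left₀ (by positivity)] at h2
  rw [hκ] at h2
  nlinarith

/-- The number of disjoint balls on which the circular averages of a function exceed its values
is controlled by the supremum of the function. -/
theorem card_mul_le_of_circAvg_sub (x : Plane) {s t m τ b : ℝ} (hs : 0 < s) (ht : 0 ≤ t)
    (hts : t ≤ s) (hτ : 0 ≤ τ) {u : Plane → ℝ} (hu : ContinuousOn u (closedBall x (3 * s)))
    (h0 : ∀ y ∈ closedBall x (3 * s), 0 ≤ u y) (hm : ∀ y ∈ closedBall x (3 * s), u y ≤ m)
    (hsub : ∀ y ∈ ball x (2 * s), u y ≤ circAvg u y t)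
    {F : Finset Plane} (hdisj : (F : Set Plane).PairwiseDisjoint fun z => ball z τ)
    (hF : ∀ z ∈ F, ball z τ ⊆ closedBall x s)
    (hb : ∀ z ∈ F, ∀ y ∈ ball z τ, b ≤ circAvg u y t - u y) :
    F.card * τ ^ 2 * b ≤ 49 * m * t ^ 2 := by
  -- The integral estimate is global, so u is extended from the closed ball to a continuous function
  -- with values in [0, m]. Circles of radius t ≤ s about points of the ball of radius 2s do not see
  -- the extension.
  obtain ⟨g, hg, hgu⟩ := ContinuousMap.exists_extension_forall_mem_of_isClosedEmbedding
    (⟨(closedBall x (3 * s)).domRestrict u, hu.domRestrict⟩ : C(closedBall x (3 * s), ℝ))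
    (t := Icc 0 m) (e := Subtype.val) (fun y => ⟨h0 y y.2, hm y y.2⟩)
    ⟨u x, h0 x (mem_closedBall_self (by positivity)), hm x (mem_closedBall_self (by positivity))⟩
    isClosed_closedBall.isClosedEmbedding_subtypeVal
  have hgu' : ∀ y ∈ closedBall x (3 * s), g y = u y := fun y hy => congr_fun hgu ⟨y, hy⟩
  have havg : ∀ y ∈ ball x (2 * s), circAvg g y t = circAvg u y t := fun y hy =>
    circAvg_congr ht fun z hz => hgu' z (by
      rw [mem_closedBall]
      have := dist_triangle z y x
      rw [mem_sphere] at hz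
      rw [mem_ball] at hy
      linarith)
  have hgc : Continuous g := g.continuous
  have key := integral_bump_mul_circAvg_sub_le x hs ht hts hgc (fun y => (hg y).1) (fun y => (hg y).2)
  have hsub' : ∀ y ∈ ball x (2 * s), circAvg g y t - g y = circAvg u y t - u y := fun y hy => by
    rw [havg y hy, hgu' y (ball_subset_closedBall (ball_subset_ball (by linarith) hy))]
  have hnn : ∀ y, 0 ≤ bump x s y * (circAvg g y t - g y) := fun y => by
    by_cases hy : y ∈ ball x (2 * s)
    · refine mul_nonneg (bump_nonneg _ _ _) ?_
      rw [hsub' y hy]; linarith [hsub y hy]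
    · rw [mem_ball, dist_eq_norm, not_lt] at hy
      rw [bump_eq_zero hs.le hy, zero_mul]
  have hint := integrable_bump_mul x hs.le (w := fun y => circAvg g y t - g y)
    ((continuous_circAvg hgc t).sub hgc)
  have hvol : ∀ z, volume.real (ball z τ) = Real.pi * τ ^ 2 := fun z => by
    rw [Measure.real, EuclideanSpace.volume_ball_fin_two]
    rw [ENNReal.toReal_mul, ENNReal.toReal_pow, ENNReal.toReal_ofReal hτ,
      ENNReal.toReal_ofReal Real.pi_pos.le]
    ring
  have h1 : ∑ z ∈ F, ∫ y in ball z τ, bump x s y * (circAvg g y t - g y) ≤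
      ∫ y, bump x s y * (circAvg g y t - g y) := by
    rw [← integral_biUnion_finset F (fun z _ => measurableSet_ball) hdisj
      (fun z _ => hint.integrableOn)]
    exact setIntegral_le_integral hint (Eventually.of_forall hnn)
  have h2 : ∀ z ∈ F, Real.pi * τ ^ 2 * (9 * s ^ 4 * b) ≤
      ∫ y in ball z τ, bump x s y * (circAvg g y t - g y) := by
    intro z hz
    have : ∫ y in ball z τ, (9 * s ^ 4 * b) ≤
        ∫ y in ball z τ, bump x s y * (circAvg g y t - g y) := by
      refine setIntegral_mono_on ?_ hint.integrableOn measurableSet_ball fun y hy => ?_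
      · exact integrableOn_const (measure_ball_lt_top.ne)
      · have hys := hF z hz hy
        have hys2 : y ∈ ball x (2 * s) := closedBall_subset_ball (by linarith) hys
        rw [hsub' y hys2]
        rw [mem_closedBall, dist_eq_norm] at hys
        have e1 := le_bump hys
        have e2 := hb z hz y hy
        have e3 := hsub y hys2
        calc 9 * s ^ 4 * b ≤ 9 * s ^ 4 * (circAvg u y t - u y) := by gcongr
          _ ≤ _ := by gcongr
    rwa [setIntegral_const, hvol, smul_eq_mul] at this
  have h3 := (Finset.card_nsmul_le_sum F _ _ h2).trans (h1.trans key)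
  rw [nsmul_eq_mul] at h3
  -- The bump is at least 9s⁴ on the ball of radius s, whence 49 = 441/9.
  have h4 : 9 * Real.pi * s ^ 4 * (F.card * τ ^ 2 * b) ≤ 9 * Real.pi * s ^ 4 * (49 * m * t ^ 2) := by
    linarith
  exact le_of_mul_le_mul_left h4 (by positivity)

end FreeBoundary

/-! ### Nondegeneracy of the largest subsolution at its free boundary -/

namespace FreeBoundary

open InnerProductSpace Laplacian

variable {D : Set Plane} {f g h v w : Plane → ℝ} {lam Lam : ℝ}

local notation "𝓤" => largestSubsolution

/-- The free boundary of `v`: the part of the boundary of the positivity set away from `D`. -/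
def freeBoundarySet (D : Set Plane) (v : Plane → ℝ) : Set Plane :=
  frontier (posSet D v) \ closure D

/-- At a zero of h, the exterior ball and the plane of slope √lam above h serve v ≤ h as well; the
free boundary condition would then give √f ≤ √lam, against lam < f. -/
theorem barrier_pos_of_mem_freeBoundarySet (A : Admissible D f g h lam Lam) (hv : v ∈ Fam D f g h)
    {x : Plane} (hx : x ∈ freeBoundarySet D v) : 0 < h x := by
  refine lt_of_le_of_ne (A.h_nonneg x) fun h0 => ?_
  obtain ⟨y, s, hs, hxy, hdisj, hb⟩ := A.h_slope x hx.2 h0.symm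
  have h1 := hv.1.freeBoundary x hx y s hs hxy
    (hdisj.mono_right fun z hz => hz.2.trans_le (hv.2 z hz.1)) _
    (hb.mono (by
      filter_upwards [compl_mem_nhds_of_notMem_closure hx.2] with z hz
      exact hv.2 z hz))
  have h2 := Real.sqrt_lt_sqrt A.lam_pos.le (A.lam_lt x)
  linarith

theorem eq_zero_of_mem_freeBoundarySet (hv : v ∈ Fam D f g h) {x : Plane}
    (hx : x ∈ freeBoundarySet D v) : v x = 0 := by
  have hxD : x ∉ D := fun hD => hx.2 (subset_closure hD)
  by_contra hne
  exact notMem_posSet_of_mem_frontier hv.1.continuousOn hx.2 hx.1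
    ⟨hxD, lt_of_le_of_ne (hv.1.nonneg x hxD) (Ne.symm hne)⟩

/-- Closedness holds because u is positive off D near ∂D, which keeps the free boundary away from D;
boundedness holds because h vanishes far out. -/
theorem isCompact_freeBoundarySet (A : Admissible D f g h lam Lam) :
    IsCompact (freeBoundarySet D (𝓤 D f g h)) := by
  have hsub : freeBoundarySet D (𝓤 D f g h) ⊆ Dᶜ := fun x hx hD => hx.2 (subset_closure hD)
  refine Metric.isCompact_of_isClosed_isBounded (isClosed_of_closure_subset fun x hx => ?_) ?_
  · refine ⟨closure_minimal (fun y hy => hy.1) isClosed_frontier hx, fun hxc => ?_⟩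
    have hxD : x ∉ D := closure_minimal hsub A.isOpen.isClosed_compl hx
    obtain ⟨δ, hδ, v, hv, hpos⟩ := exists_pos_near_frontier A (mem_frontier_of A.isOpen hxD hxc)
    obtain ⟨y, hy, hyx⟩ := Metric.mem_closure_iff.1 hx δ hδ
    have hyD : y ∉ D := hsub hy
    exact notMem_posSet_of_mem_frontier (continuousOn_largest A).1 hy.2 hy.1
      (posSet_subset_largest hv ⟨hyD, hpos y hyD (by rwa [dist_comm])⟩)
  · obtain ⟨R, hR⟩ := A.h_supp
    refine (isBounded_closedBall (x := (0 : Plane)) (r := R)).subset fun x hx => ?_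
    refine closure_minimal (fun y hy => ?_) isClosed_closedBall hx.1.1
    rw [mem_closedBall_zero_iff]
    by_contra! hn
    have h1 := hy.2.trans_le (largest_le_barrier A hy.1)
    rw [hR y hn.le] at h1
    exact lt_irrefl _ h1

/-- Uniform control of the largest subsolution in discs centred on the free boundary. -/
theorem exists_uniform_scale (A : Admissible D f g h lam Lam) :
    ∃ s₀ > 0, ∃ C > 0, ∀ p ∈ freeBoundarySet D (𝓤 D f g h), ∀ y ∈ closedBall p s₀,
      y ∉ closure D ∧ 0 < h y ∧
      ∀ z ∉ posSet D (𝓤 D f g h), dist y z ≤ s₀ → 𝓤 D f g h y ≤ C * dist y z := by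
  set S := freeBoundarySet D (𝓤 D f g h) with hS
  have hSc : IsCompact S := isCompact_freeBoundarySet A
  have hUo : IsOpen {y | y ∉ closure D ∧ 0 < h y} := by
    rw [isOpen_iff_mem_nhds]
    intro y hy
    have h1 := compl_mem_nhds_of_notMem_closure hy.1
    filter_upwards [isClosed_closure.isOpen_compl.mem_nhds hy.1,
      (A.h_cont.continuousAt h1).eventually (lt_mem_nhds hy.2)] with z h2 h3
    exact ⟨h2, h3⟩
  obtain ⟨δ, hδ, hδU⟩ := hSc.exists_cthickening_subset_open hUo fun x hx =>
    ⟨hx.2, barrier_pos_of_mem_freeBoundarySet A (largest_mem_Fam A) hx⟩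
  obtain ⟨m, hm, hmh⟩ : ∃ m > 0, ∀ y ∈ cthickening δ S, m ≤ h y := by
    rcases (cthickening δ S).eq_empty_or_nonempty with he | hne
    · exact ⟨1, one_pos, by simp [he]⟩
    · obtain ⟨y, hy, hmin⟩ := hSc.cthickening.exists_isMinOn hne
        (A.h_cont.mono fun y hy hD => (hδU hy).1 (subset_closure hD))
      exact ⟨h y, (hδU hy).2, fun z hz => hmin hz⟩
  have hLam : 0 < Lam := A.lam_pos.trans ((A.lam_lt 0).trans (A.lt_Lam 0))
  have hsL : 0 < √Lam := Real.sqrt_pos.2 hLam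
  refine ⟨min (δ / 5) (m / (6 * √Lam)), by positivity, 10 * √Lam, by positivity, ?_⟩
  set s₀ := min (δ / 5) (m / (6 * √Lam)) with hs₀
  have hs1 : 5 * s₀ ≤ δ := by linarith [min_le_left (δ / 5) (m / (6 * √Lam))]
  have hs2 : 6 * √Lam * s₀ ≤ m := by
    have := min_le_right (δ / 5) (m / (6 * √Lam))
    rw [← hs₀, le_div_iff₀ (by positivity)] at this
    linarith
  have hs00 : 0 < s₀ := by positivity
  intro p hp y hy
  have hin : ∀ x, dist x p ≤ δ → x ∈ cthickening δ S := fun x hx =>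
    mem_cthickening_of_dist_le x p δ S hp hx
  rw [mem_closedBall] at hy
  obtain ⟨h1, h2⟩ := hδU (hin y (by linarith))
  refine ⟨h1, h2, fun z hz hyz => largest_le_dist A hz ?_ (fun hD => h1 (subset_closure hD)) ?_⟩
  · refine disjoint_left.2 fun x hx hxD => (hδU (hin x ?_)).1 (subset_closure hxD)
    have := dist_triangle x y p
    rw [mem_ball] at hx
    linarith
  · intro x hx
    refine le_trans ?_ (hmh x (hin x ?_))
    · refine le_trans ?_ hs2
      gcongr
    · have := dist_triangle x y p
      rw [mem_ball] at hx
      linarith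

theorem largest_le_circAvg (A : Admissible D f g h lam Lam) {y w : Plane} {R : ℝ} (hR : 0 < R)
    (hD : Disjoint (closedBall y R) (closure D)) (hw : w ∈ ball y R) :
    𝓤 D f g h w ≤ (R + dist w y) / (R - dist w y) * circAvg (𝓤 D f g h) y R := by
  have hn : ∀ x ∈ closedBall y R, x ∉ closure D := fun x hx hxc => hD.ne_of_mem hx hxc rfl
  have hnD : ∀ x ∈ closedBall y R, x ∉ D := fun x hx hxD => hn x hx (subset_closure hxD)
  exact subharmonic_le_circAvg hR ((continuousOn_largest A).1.mono hnD)
    (fun x hx => largest_nonneg A (hnD x hx))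
    ((viscositySubharmonicOn_largest A).mono fun x hx =>
      ⟨⟨hnD x (ball_subset_closedBall hx.1), hx.2⟩, hn x (ball_subset_closedBall hx.1)⟩) hw

theorem circAvg_nonneg {u : Plane → ℝ} {y : Plane} {R : ℝ} (hR : 0 ≤ R)
    (h0 : ∀ x ∈ sphere y R, 0 ≤ u x) : 0 ≤ circAvg u y R := by
  rw [circAvg]
  exact mul_nonneg (by positivity) (intervalIntegral.integral_nonneg (by positivity)
    fun θ _ => h0 _ (add_smul_dir_mem_sphere y hR θ))

/-- A subsolution that is small on a circle around a disc of zeros vanishes on a larger disc. -/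
theorem disjoint_ball_posSet_of_small (A : Admissible D f g h lam Lam) (hv : v ∈ Fam D f g h)
    {z : Plane} {τ : ℝ} (hτ : 0 < τ) (hD : Disjoint (closedBall z (7 / 4 * τ)) (closure D))
    (h0 : Disjoint (ball z τ) (posSet D v))
    (hs : ∀ x ∈ sphere z (7 / 4 * τ), v x ≤ √lam / 8 * τ) :
    Disjoint (ball z (3 / 2 * τ)) (posSet D v) := by
  by_contra hnd
  obtain ⟨x, hx, hxv⟩ := not_disjoint_iff.1 hnd
  obtain ⟨q, hq, hqd⟩ := isClosed_closure.exists_infDist_eq_dist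
    (⟨x, subset_closure hxv⟩ : (closure (posSet D v)).Nonempty) z
  rw [infDist_closure] at hqd
  set σ := dist q z with hσ
  rw [dist_comm, ← hσ] at hqd
  have hσ1 : σ < 3 / 2 * τ := by
    rw [← hqd]
    refine (infDist_le_dist_of_mem hxv).trans_lt ?_
    rwa [dist_comm]
  have hσ2 : τ ≤ σ := by
    rw [← hqd]
    refine (le_infDist ⟨x, hxv⟩).2 fun y hy => ?_
    by_contra! hlt
    exact h0.ne_of_mem (mem_ball'.2 hlt) hy rfl
  have hσ0 : 0 < σ := hτ.trans_le hσ2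
  have hl : 0 < √lam := Real.sqrt_pos.2 A.lam_pos
  -- The logarithm with coefficient (7/8)√lam τ that vanishes on the first circle to reach Ω(v) is
  -- at least √lam τ/8 at radius 7τ/4, by ln(7/6) ≥ 1/7. It thus lies above v, with slope at most
  -- (7/8)√lam at the touching point, too small for the free boundary condition.
  have hlog : 1 / 7 ≤ Real.log (7 / 4 * τ) - Real.log σ := by
    rw [← Real.log_div (by positivity) hσ0.ne']
    have h1 : (7 : ℝ) / 6 ≤ 7 / 4 * τ / σ := by rw [le_div_iff₀ hσ0]; linarith
    have h2 := Real.one_sub_inv_le_log_of_pos (show (0 : ℝ) < 7 / 6 by norm_num)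
    have h3 := Real.log_le_log (by norm_num) h1
    norm_num at h2
    linarith
  have htouch := sqrt_le_of_touching hv (x₀ := z) (z := z) (q := q) (κ := 7 / 4 * τ) (σ := σ)
    (B := 7 / 8 * √lam * τ) hσ0 (by positivity)
    (disjoint_left.2 fun y hy hyv => by
      have := infDist_le_dist_of_mem (x := z) hyv
      rw [hqd, dist_comm] at this
      exact absurd hy (not_lt.2 this)) hq rfl (by rw [mem_ball]; linarith) hD
    (fun y hy _ => by
      refine (hs y hy).trans ?_
      rw [← dist_eq_norm, hy]
      have : 7 / 8 * √lam * τ * (1 / 7) ≤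
        7 / 8 * √lam * τ * (Real.log (7 / 4 * τ) - Real.log σ) := by gcongr
      linarith)
  have h2 := Real.sqrt_lt_sqrt A.lam_pos.le (A.lam_lt q)
  have h3 : 7 / 8 * √lam * τ / σ ≤ 7 / 8 * √lam := by
    rw [div_le_iff₀ hσ0]; gcongr
  linarith

/-- Circular averages are large around points at distance `τ` from the positivity set. -/
theorem le_circAvg_of_infDist_eq (A : Admissible D f g h lam Lam) {z y : Plane} {τ : ℝ}
    (hτ : 0 < τ) (hD : Disjoint (closedBall z (5 * τ)) (closure D))
    (hne : (posSet D (𝓤 D f g h)).Nonempty)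
    (hz : infDist z (posSet D (𝓤 D f g h)) = τ) (hy : y ∈ ball z (τ / 2)) :
    √lam / 32 * τ ≤ circAvg (𝓤 D f g h) y (4 * τ) - 𝓤 D f g h y := by
  set u := 𝓤 D f g h with hu
  have hn : ∀ x ∈ closedBall z (5 * τ), x ∉ closure D := fun x hx hxc => hD.ne_of_mem hx hxc rfl
  have hdisj : Disjoint (ball z τ) (posSet D u) := disjoint_left.2 fun x hx hxu => by
    have := infDist_le_dist_of_mem (x := z) hxu
    rw [hz, dist_comm] at this
    exact absurd hx (not_lt.2 this)
  have hyz : dist y z < τ / 2 := hy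
  have hyD : y ∉ D := fun h => hn y (by rw [mem_closedBall]; linarith) (subset_closure h)
  have huy : u y = 0 := by
    by_contra h
    exact hdisj.ne_of_mem (by rw [mem_ball]; linarith)
      (⟨hyD, lt_of_le_of_ne (largest_nonneg A hyD) (Ne.symm h)⟩ : y ∈ posSet D u) rfl
  -- Otherwise Ω(u) would avoid the disc of radius 3τ/2, although its distance from z is exactly τ.
  obtain ⟨x, hx, hxu⟩ : ∃ x ∈ sphere z (7 / 4 * τ), √lam / 8 * τ < u x := by
    by_contra! hs
    have h1 := disjoint_ball_posSet_of_small A (largest_mem_Fam A) hτ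
      (hD.mono_left (closedBall_subset_closedBall (by linarith))) hdisj hs
    have h2 : 3 / 2 * τ ≤ infDist z (posSet D u) := (le_infDist hne).2 fun q hq => by
      by_contra! hlt
      exact h1.ne_of_mem (mem_ball'.2 hlt) hq rfl
    linarith
  have hxy : dist x y ≤ 9 / 4 * τ := by
    have := dist_triangle x z y
    rw [mem_sphere.1 hx, dist_comm z y] at this
    linarith
  have h1 := largest_le_circAvg A (y := y) (w := x) (R := 4 * τ) (by positivity)
    (hD.mono_left (closedBall_subset_closedBall' (by linarith))) (by rw [mem_ball]; linarith)
  have hav : 0 ≤ circAvg u y (4 * τ) := circAvg_nonneg (by positivity) fun q hq =>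
    largest_nonneg A fun hqD => hn q (by
      have := dist_triangle q y z
      rw [mem_sphere.1 hq] at this
      rw [mem_closedBall]; linarith) (subset_closure hqD)
  -- At distance at most 9τ/4 in a disc of radius 4τ the Harnack factor is at most 25/7 < 4, so the
  -- average is at least a quarter of √lam τ/8.
  have h2 : (4 * τ + dist x y) / (4 * τ - dist x y) ≤ 4 := by
    rw [div_le_iff₀ (by linarith)]; linarith
  have h3 : (4 * τ + dist x y) / (4 * τ - dist x y) * circAvg u y (4 * τ) ≤
      4 * circAvg u y (4 * τ) := by gcongr
  rw [huy]
  linarith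

theorem largest_le_circAvg_self (A : Admissible D f g h lam Lam) {y : Plane} {R : ℝ} (hR : 0 < R)
    (hD : Disjoint (closedBall y R) (closure D)) :
    𝓤 D f g h y ≤ circAvg (𝓤 D f g h) y R := by
  have := largest_le_circAvg A hR hD (mem_ball_self hR)
  rwa [dist_self, add_zero, sub_zero, div_self hR.ne', one_mul] at this

/-- Around a free boundary point the circular averages are positive. -/
theorem circAvg_pos_of_mem_freeBoundarySet (A : Admissible D f g h lam Lam) {p : Plane}
    (hp : p ∈ freeBoundarySet D (𝓤 D f g h)) {R : ℝ} (hR : 0 < R)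
    (hD : Disjoint (closedBall p R) (closure D)) : 0 < circAvg (𝓤 D f g h) p R := by
  obtain ⟨w, hw, hwp⟩ := Metric.mem_closure_iff.1 hp.1.1 R hR
  rw [dist_comm] at hwp
  have h1 := hw.2.trans_le (largest_le_circAvg A hR hD hwp)
  exact pos_of_mul_pos_right h1 (div_nonneg (add_nonneg hR.le dist_nonneg) (sub_nonneg.2 hwp.le))

/-- Every small circle around a free boundary point leaves the closure of the positivity set. -/
theorem exists_mem_sphere_notMem_closure (A : Admissible D f g h lam Lam) {p : Plane}
    (hp : p ∈ freeBoundarySet D (𝓤 D f g h)) {R : ℝ} (hR : 0 < R)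
    (hD : Disjoint (closedBall p R) (closure D)) (hh : ∀ y ∈ closedBall p R, 0 < h y) :
    ∃ z ∈ sphere p R, z ∉ closure (posSet D (𝓤 D f g h)) := by
  by_contra! hcl
  -- If the whole circle lay in the closure of Ω(u), the replacement would be a member whose value
  -- at p is at least the positive average of u, while u p = 0.
  obtain ⟨v, hv, -, h2, h3, h4, h5⟩ :=
    exists_harmonic_replacement A (largest_mem_Fam A) hR hD hh hcl
  have hpD : p ∉ D := fun h => hp.2 (subset_closure h)
  have h6 := (harnack h2 h3 (fun x hx => hv.1.nonneg x fun hxD =>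
    hD.ne_of_mem (sphere_subset_closedBall hx) (subset_closure hxD) rfl) (mem_ball_self hR)).1
  rw [dist_self, sub_zero, add_zero, div_self hR.ne', one_mul, h5] at h6
  have h7 := circAvg_pos_of_mem_freeBoundarySet A hp hR hD
  have h8 := le_largest hv hpD
  have h9 := eq_zero_of_mem_freeBoundarySet (largest_mem_Fam A) hp
  linarith

theorem isConnected_sphere_plane (p : Plane) {R : ℝ} (hR : 0 ≤ R) : IsConnected (sphere p R) :=
  isConnected_sphere (by
    rw [← Module.finrank_eq_rank, finrank_euclideanSpace_fin]; norm_num) p hR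

/-- Circles of all radii in a compact interval meet every small level of the distance to the
positivity set. -/
theorem exists_mem_sphere_infDist_eq (A : Admissible D f g h lam Lam) {p : Plane}
    (hp : p ∈ freeBoundarySet D (𝓤 D f g h)) {a b : ℝ} (ha : 0 < a)
    (hD : ∀ y ∈ closedBall p b, y ∉ closure D ∧ 0 < h y) :
    ∃ τ₀ > 0, ∀ τ ∈ Icc 0 τ₀, ∀ R ∈ Icc a b, ∃ z ∈ sphere p R,
      infDist z (posSet D (𝓤 D f g h)) = τ := by
  set P := posSet D (𝓤 D f g h) with hP
  have hne : P.Nonempty := closure_nonempty_iff.1 ⟨p, hp.1.1⟩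
  have hdisj : ∀ R ≤ b, Disjoint (closedBall p R) (closure D) := fun R hR =>
    disjoint_left.2 fun x hx => (hD x (closedBall_subset_closedBall hR hx)).1
  -- Every circle has a point off the closure of P. The sets of radii for which some such point is
  -- farther than 1/(n + 1) from P are open and increase with n, so one n serves all of [a, b].
  obtain ⟨n, hn⟩ := (isCompact_Icc (a := a) (b := b)).elim_directed_cover
    (fun n : ℕ => ⋃ e ∈ sphere (0 : Plane) 1, {R : ℝ | 1 / ((n : ℝ) + 1) < infDist (p + R • e) P})
    (fun n => isOpen_biUnion fun e _ => by
      have : Continuous fun R : ℝ => infDist (p + R • e) P :=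
        (continuous_infDist_pt P).comp (by fun_prop)
      exact isOpen_lt continuous_const this)
    (fun R hR => by
      have hR0 : 0 < R := ha.trans_le hR.1
      obtain ⟨z, hz, hzP⟩ := exists_mem_sphere_notMem_closure A hp hR0 (hdisj R hR.2)
        fun y hy => (hD y (closedBall_subset_closedBall hR.2 hy)).2
      have hpos : 0 < infDist z P := by
        rw [← infDist_closure]
        exact (isClosed_closure.notMem_iff_infDist_pos hne.closure).1 hzP
      obtain ⟨n, hn⟩ := exists_nat_one_div_lt hpos
      simp only [mem_iUnion]
      refine ⟨n, R⁻¹ • (z - p), ?_, ?_⟩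
      · rw [mem_sphere_zero_iff_norm, norm_smul, ← dist_eq_norm, mem_sphere.1 hz, norm_inv,
          Real.norm_of_nonneg hR0.le, inv_mul_cancel₀ hR0.ne']
      · rw [mem_ofPred_eq, smul_smul, mul_inv_cancel₀ hR0.ne', one_smul, add_sub_cancel]
        exact hn)
    (directed_of_isDirected_le fun m n hmn => iUnion₂_mono fun e _ R hR => by
      rw [mem_ofPred_eq] at hR ⊢
      exact (Nat.one_div_le_one_div hmn).trans_lt hR)
  refine ⟨1 / ((n : ℝ) + 1), by positivity, fun τ hτ R hR => ?_⟩
  have hR0 : 0 < R := ha.trans_le hR.1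
  have h1 := hn hR
  simp only [mem_iUnion] at h1
  obtain ⟨e, he, hlt⟩ := h1
  rw [mem_sphere_zero_iff_norm] at he
  have hz1 : p + R • e ∈ sphere p R := by
    rw [mem_sphere, dist_eq_norm, add_sub_cancel_left, norm_smul, he, mul_one,
      Real.norm_of_nonneg hR0.le]
  obtain ⟨q, hq, hqP⟩ : ∃ q ∈ sphere p R, q ∈ P := by
    by_contra! hno
    have h0 : circAvg (𝓤 D f g h) p R = circAvg (fun _ => 0) p R :=
      circAvg_congr hR0.le fun y hy => by
        have hyD : y ∉ D := fun h =>
          (hdisj R hR.2).ne_of_mem (sphere_subset_closedBall hy) (subset_closure h) rfl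
        by_contra hy0
        exact hno y hy ⟨hyD, lt_of_le_of_ne (largest_nonneg A hyD) (Ne.symm hy0)⟩
    have h1 := circAvg_pos_of_mem_freeBoundarySet A hp hR0 (hdisj R hR.2)
    rw [h0] at h1
    simp [circAvg] at h1
  obtain ⟨z, hz, hzτ⟩ := (isConnected_sphere_plane p hR0.le).isPreconnected.intermediate_value
    hq hz1 (continuous_infDist_pt P).continuousOn
    (show τ ∈ Icc (infDist q P) (infDist (p + R • e) P) from
      ⟨by rw [infDist_zero_of_mem hqP]; exact hτ.1, hτ.2.trans hlt.le⟩)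
  exact ⟨z, hz, hzτ⟩

/-- Nondegeneracy: the largest subsolution grows linearly away from its free boundary. -/
theorem exists_lt_largest (A : Admissible D f g h lam Lam) {p : Plane}
    (hp : p ∈ freeBoundarySet D (𝓤 D f g h)) {s : ℝ} (hs : 0 < s)
    (hD : ∀ y ∈ closedBall p (3 * s), y ∉ closure D ∧ 0 < h y) :
    ∃ y ∈ closedBall p (3 * s), √lam / 500000 * s < 𝓤 D f g h y := by
  by_contra! hsmall
  set u := 𝓤 D f g h with hu
  have hne : (posSet D u).Nonempty := closure_nonempty_iff.1 ⟨p, hp.1.1⟩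
  have hnD : ∀ y ∈ closedBall p (3 * s), y ∉ D := fun y hy h => (hD y hy).1 (subset_closure h)
  have hdisj : ∀ y R, dist y p + R ≤ 3 * s → Disjoint (closedBall y R) (closure D) :=
    fun y R hR => disjoint_left.2 fun x hx => (hD x (closedBall_subset_closedBall'
      (by linarith) hx)).1
  obtain ⟨τ₀, hτ₀, hcirc⟩ := exists_mem_sphere_infDist_eq A hp (a := s / 2) (b := 3 * s)
    (by positivity) hD
  -- The circles of radii s/2 + jτ with j < N and Nτ = s/4 carry points at distance τ from Ω(u),
  -- which their radii keep τ-separated. Choosing N this large makes τ ≤ τ₀ and 8τ ≤ s.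
  obtain ⟨N, hN⟩ := exists_nat_gt (max 2 (s / (4 * τ₀)))
  have hN2 : (2 : ℝ) < N := (le_max_left _ _).trans_lt hN
  have hN0 : (0 : ℝ) < N := by linarith
  set τ := s / (4 * N) with hτ
  have hτ0 : 0 < τ := by positivity
  have hNτ : N * τ = s / 4 := by rw [hτ]; field_simp
  have hττ₀ : τ ≤ τ₀ := by
    have h1 := (le_max_right 2 (s / (4 * τ₀))).trans_lt hN
    rw [div_lt_iff₀ (by positivity)] at h1
    rw [hτ, div_le_iff₀ (by positivity)]
    linarith
  have hτs : 8 * τ ≤ s := by nlinarith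
  have hr : ∀ j : ℕ, j < N → s / 2 + j * τ ∈ Icc (s / 2) (3 * s) ∧ s / 2 + j * τ ≤ 3 / 4 * s := by
    intro j hj
    have h1 : (j : ℝ) * τ ≤ N * τ := by gcongr
    have h2 : 0 ≤ (j : ℝ) * τ := by positivity
    exact ⟨⟨by linarith, by linarith⟩, by linarith⟩
  have hex : ∀ j : ℕ, ∃ z, j < N → dist z p = s / 2 + j * τ ∧ infDist z (posSet D u) = τ := by
    intro j
    by_cases hj : j < N
    · obtain ⟨z, hz, hzτ⟩ := hcirc τ ⟨hτ0.le, hττ₀⟩ _ (hr j hj).1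
      exact ⟨z, fun _ => ⟨hz, hzτ⟩⟩
    · exact ⟨p, fun h => absurd h hj⟩
  choose z hz using hex
  have hsep : ∀ i < N, ∀ j < N, i < j → τ ≤ dist (z i) (z j) := by
    intro i hi j hj hij
    have h1 := dist_triangle (z j) (z i) p
    rw [(hz i hi).1, (hz j hj).1, dist_comm (z j)] at h1
    have h2 : ((i : ℝ) + 1) * τ ≤ j * τ := by
      gcongr
      exact_mod_cast hij
    linarith
  have hsep' : ∀ i < N, ∀ j < N, i ≠ j → τ ≤ dist (z i) (z j) := fun i hi j hj hij => by
    rcases lt_or_gt_of_ne hij with h | h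
    · exact hsep i hi j hj h
    · rw [dist_comm]; exact hsep j hj i hi h
  have hinj : Set.InjOn z (Finset.range N : Set ℕ) := by
    intro i hi j hj hij
    by_contra hne
    have := hsep' i (by simpa using hi) j (by simpa using hj) hne
    rw [hij, dist_self] at this
    linarith
  have hcard : ((Finset.range N).image z).card = N := by
    rw [Finset.card_image_of_injOn hinj, Finset.card_range]
  -- With m the assumed bound for u, counting gives N(τ/2)²(√lam/32)τ ≤ 49m(4τ)², that is √lam s/512
  -- ≤ 784m, which fails for m = √lam s/500000.
  have key := card_mul_le_of_circAvg_sub p (s := s) (t := 4 * τ) (m := √lam / 500000 * s)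
    (τ := τ / 2) (b := √lam / 32 * τ) hs (by positivity) (by linarith) (by positivity) (u := u)
    ((continuousOn_largest A).1.mono hnD) (fun y hy => largest_nonneg A (hnD y hy)) hsmall
    (fun y hy => largest_le_circAvg_self A (by positivity) (hdisj y _ (by
      rw [mem_ball] at hy; linarith)))
    (F := (Finset.range N).image z)
    (by
      intro a ha b hb hab
      simp only [Finset.coe_image, mem_image, Finset.coe_range, mem_Iio] at ha hb
      obtain ⟨i, hi, rfl⟩ := ha
      obtain ⟨j, hj, rfl⟩ := hb
      exact ball_disjoint_ball (by
        have := hsep' i hi j hj (fun h => hab (by rw [h]))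
        linarith))
    (by
      intro a ha
      simp only [Finset.mem_image, Finset.mem_range] at ha
      obtain ⟨i, hi, rfl⟩ := ha
      refine ball_subset_closedBall.trans (closedBall_subset_closedBall' ?_)
      rw [(hz i hi).1]
      linarith [(hr i hi).2])
    (by
      intro a ha y hy
      simp only [Finset.mem_image, Finset.mem_range] at ha
      obtain ⟨i, hi, rfl⟩ := ha
      exact le_circAvg_of_infDist_eq A hτ0 (hdisj _ _ (by
        rw [(hz i hi).1]; linarith [(hr i hi).2])) hne (hz i hi).2 hy)
  rw [hcard] at key
  have hl : 0 < √lam := Real.sqrt_pos.2 A.lam_pos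
  have h1 : N * (τ / 2) ^ 2 * (√lam / 32 * τ) = (N * τ) * (√lam * τ ^ 2 / 128) := by ring
  rw [h1, hNτ] at key
  have h2 : 0 < √lam * τ ^ 2 * s := by positivity
  nlinarith

/-! ### Separated sets and finite length of the free boundary -/

open scoped ENNReal

/-- Take a separated subset of largest cardinality: a point not covered by the balls could be added
to it. -/
theorem exists_finset_cover_of_card_le {X : Type*} [PseudoMetricSpace X] {T : Set X} {t : ℝ}
    (ht : 0 < t) {B : ℕ}
    (hB : ∀ F : Finset X, (F : Set X) ⊆ T → (F : Set X).Pairwise (fun x y => t ≤ dist x y) →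
      F.card ≤ B) :
    ∃ F : Finset X, F.card ≤ B ∧ T ⊆ ⋃ z ∈ F, closedBall z t := by
  classical
  set N : Set ℕ := {n | ∃ F : Finset X, (F : Set X) ⊆ T ∧
    (F : Set X).Pairwise (fun x y => t ≤ dist x y) ∧ F.card = n} with hN
  have hb : BddAbove N := ⟨B, by rintro n ⟨F, h1, h2, rfl⟩; exact hB F h1 h2⟩
  obtain ⟨F, h1, h2, h3⟩ := Nat.sSup_mem (s := N) ⟨0, ∅, by simp, by simp, rfl⟩ hb
  refine ⟨F, hB F h1 h2, fun x hx => ?_⟩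
  by_contra hno
  simp only [mem_iUnion, mem_closedBall, not_exists, not_le] at hno
  have hxF : x ∉ F := fun h => by
    have := hno x h
    rw [dist_self] at this
    linarith
  have h4 : (insert x F).card ≤ sSup N := by
    refine le_csSup hb ⟨insert x F, ?_, ?_, rfl⟩
    · rw [Finset.coe_insert]; exact insert_subset hx h1
    · rw [Finset.coe_insert]
      exact pairwise_insert.2
        ⟨h2, fun y hy _ => ⟨(hno y hy).le, by rw [dist_comm]; exact (hno y hy).le⟩⟩
  rw [Finset.card_insert_of_notMem hxF] at h4
  omega

/-- A set whose `t`-separated subsets have at most `C / t` points has finite length. -/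
theorem hausdorffMeasure_one_lt_top_of_card_le {X : Type*} [MetricSpace X] [MeasurableSpace X]
    [BorelSpace X] {T : Set X} {C t₀ : ℝ} (ht₀ : 0 < t₀)
    (hC : ∀ t, 0 < t → t ≤ t₀ → ∀ F : Finset X, (F : Set X) ⊆ T →
      (F : Set X).Pairwise (fun x y => t ≤ dist x y) → F.card * t ≤ C) :
    Measure.hausdorffMeasure 1 T < ⊤ := by
  have hC0 : 0 ≤ C := by simpa using hC t₀ ht₀ le_rfl ∅ (by simp) (by simp)
  set r : ℕ → ℝ := fun n => t₀ / (n + 1) with hr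
  have hr0 : ∀ n, 0 < r n := fun n => by positivity
  have hrt : ∀ n, r n ≤ t₀ := fun n => by
    rw [hr]; exact div_le_self ht₀.le (by linarith [(Nat.cast_nonneg n : (0 : ℝ) ≤ n)])
  have hex : ∀ n, ∃ F : Finset X, F.card * r n ≤ C ∧ T ⊆ ⋃ z ∈ F, closedBall z (r n) := by
    intro n
    obtain ⟨F, h1, h2⟩ := exists_finset_cover_of_card_le (hr0 n) (B := ⌊C / r n⌋₊)
      fun F hF hsep => Nat.le_floor (by
        rw [le_div_iff₀ (hr0 n)]; exact hC _ (hr0 n) (hrt n) F hF hsep)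
    refine ⟨F, ?_, h2⟩
    rw [← le_div_iff₀ (hr0 n)]
    exact (Nat.cast_le.2 h1).trans (Nat.floor_le (by have := hr0 n; positivity))
  choose F hF1 hF2 using hex
  have hdiam : ∀ n (z : X), ediam (closedBall z (r n)) ≤ ENNReal.ofReal (2 * r n) := fun n z => by
    refine ediam_le fun a ha b hb => ?_
    rw [edist_dist]
    refine ENNReal.ofReal_le_ofReal ((dist_triangle_right a b z).trans ?_)
    rw [mem_closedBall] at ha hb
    linarith
  have hlim : Tendsto (fun n => ENNReal.ofReal (2 * r n)) atTop (𝓝 0) := by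
    rw [← ENNReal.ofReal_zero]
    refine ENNReal.tendsto_ofReal ?_
    have h1 := (tendsto_const_div_atTop_nhds_zero_nat t₀).comp (tendsto_add_atTop_nat 1)
    have h2 := h1.const_mul 2
    simpa [hr, Function.comp_def] using h2
  have key := Measure.hausdorffMeasure_le_liminf_sum (β := ℕ) (ι := fun n => F n) 1 T
    (l := atTop) (fun n => ENNReal.ofReal (2 * r n)) hlim
    (fun n z => closedBall (z : X) (r n)) (Eventually.of_forall fun n z => hdiam n z)
    (Eventually.of_forall fun n => (hF2 n).trans (iUnion₂_subset fun z hz =>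
      subset_iUnion (fun z : F n => closedBall (z : X) (r n)) ⟨z, hz⟩))
  refine key.trans_lt (lt_of_le_of_lt (liminf_le_of_le (by isBoundedDefault)
    (a := ENNReal.ofReal (2 * C)) fun b hb => ?_) ENNReal.ofReal_lt_top)
  obtain ⟨n, hn⟩ := hb.exists
  refine hn.trans ?_
  calc ∑ z : F n, ediam (closedBall (z : X) (r n)) ^ (1 : ℝ)
      ≤ ∑ z : F n, ENNReal.ofReal (2 * r n) := Finset.sum_le_sum fun z _ => by
        rw [ENNReal.rpow_one]; exact hdiam n z
    _ = ENNReal.ofReal ((F n).card * (2 * r n)) := by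
        rw [Finset.sum_const, nsmul_eq_mul, Finset.card_univ, Fintype.card_coe,
          ENNReal.ofReal_mul (Nat.cast_nonneg _), ENNReal.ofReal_natCast]
    _ ≤ ENNReal.ofReal (2 * C) := ENNReal.ofReal_le_ofReal (by linarith [hF1 n])

/-- At every scale, circular averages of the largest subsolution around points near its free
boundary exceed the values by a fixed multiple of the scale. -/
theorem le_circAvg_sub_of_mem_freeBoundarySet (A : Admissible D f g h lam Lam) {x : Plane}
    (hx : x ∈ freeBoundarySet D (𝓤 D f g h)) {t δ C : ℝ} (ht : 0 < t) (hC : 0 < C)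
    (hδ : δ ≤ 1 / 2) (hδC : 42000000 * C * δ ≤ √lam)
    (hD : ∀ y ∈ closedBall x (5 * t), y ∉ closure D ∧ 0 < h y ∧
      ∀ z ∉ posSet D (𝓤 D f g h), dist y z ≤ 5 * t → 𝓤 D f g h y ≤ C * dist y z)
    {y : Plane} (hy : y ∈ ball x (δ * t)) :
    C * δ * t ≤ circAvg (𝓤 D f g h) y (4 * t) - 𝓤 D f g h y := by
  set u := 𝓤 D f g h with hu
  have hδt : δ * t ≤ t / 2 := by nlinarith
  have hyx : dist y x < δ * t := hy
  have hxu := notMem_posSet_of_mem_frontier (continuousOn_largest A).1 hx.2 hx.1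
  have huy : u y ≤ C * (δ * t) :=
    ((hD y (by rw [mem_closedBall]; linarith)).2.2 x hxu (by linarith)).trans (by gcongr)
  have hdisj : Disjoint (closedBall y (4 * t)) (closure D) := disjoint_left.2 fun q hq =>
    (hD q (closedBall_subset_closedBall' (by linarith) hq)).1
  obtain ⟨q, hq, hqu⟩ := exists_lt_largest A hx (s := t) ht fun q hq =>
    have := hD q (closedBall_subset_closedBall (by linarith) hq)
    ⟨this.1, this.2.1⟩
  have hqy : dist q y ≤ 7 / 2 * t := by
    have := dist_triangle q x y
    rw [mem_closedBall] at hq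
    rw [dist_comm x y] at this
    linarith
  have h1 := largest_le_circAvg A (y := y) (w := q) (R := 4 * t) (by positivity) hdisj
    (by rw [mem_ball]; linarith)
  have hav : 0 ≤ circAvg u y (4 * t) := circAvg_nonneg (by positivity) fun q hq =>
    largest_nonneg A fun hqD => hdisj.ne_of_mem (sphere_subset_closedBall hq) (subset_closure hqD) rfl
  -- The Harnack factor is at most (4 + 7/2)/(4 - 7/2) = 15, so the average exceeds √lam t/7500000.
  -- By `hδC` this is more than 5Cδt, while u y ≤ Cδt.
  have h2 : (4 * t + dist q y) / (4 * t - dist q y) ≤ 15 := by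
    rw [div_le_iff₀ (by linarith)]; linarith
  have h3 : (4 * t + dist q y) / (4 * t - dist q y) * circAvg u y (4 * t) ≤
      15 * circAvg u y (4 * t) := by gcongr
  have h4 : 42000000 * C * δ * t ≤ √lam * t := by gcongr
  linarith

/-- The free boundary of the largest subsolution has finite length. -/
theorem hausdorffMeasure_freeBoundarySet_lt_top (A : Admissible D f g h lam Lam) :
    Measure.hausdorffMeasure 1 (freeBoundarySet D (𝓤 D f g h)) < ⊤ := by
  set u := 𝓤 D f g h with hu
  set S := freeBoundarySet D u with hS
  obtain ⟨s₀, hs₀, C, hC, hsc⟩ := exists_uniform_scale A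
  have hl : 0 < √lam := Real.sqrt_pos.2 A.lam_pos
  refine (isCompact_freeBoundarySet A).measure_lt_top_of_nhdsWithin fun p hp => ?_
  set s := s₀ / 3 with hs
  have hs0 : 0 < s := by positivity
  refine ⟨S ∩ closedBall p (s / 2), inter_mem_nhdsWithin S (closedBall_mem_nhds p (by positivity)), ?_⟩
  set δ := min (1 / 2) (√lam / (42000000 * C)) with hδ
  have hδ0 : 0 < δ := by positivity
  have hδ1 : δ ≤ 1 / 2 := min_le_left _ _
  have hδ2 : 42000000 * C * δ ≤ √lam := by
    have := min_le_right (1 / 2) (√lam / (42000000 * C))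
    rw [← hδ, le_div_iff₀ (by positivity)] at this
    linarith
  refine hausdorffMeasure_one_lt_top_of_card_le (C := 49 * (3 * C * s) * 16 / (δ ^ 3 * C))
    (t₀ := s / 4) (by positivity) fun t ht hts F hF hsep => ?_
  have hgood := hsc p hp
  have hs3 : 3 * s = s₀ := by rw [hs]; ring
  have hnD : ∀ y ∈ closedBall p (3 * s), y ∉ D := fun y hy h =>
    (hgood y (hs3 ▸ hy)).1 (subset_closure h)
  have hpu := notMem_posSet_of_mem_frontier (continuousOn_largest A).1 hp.2 hp.1
  have hδt : δ * t ≤ t / 2 := by nlinarith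
  -- Excess Cδt on balls of radius δt makes the left side of order card F · t³, against t² on the
  -- right, which is the bound C/t on separated sets. The supremum 3Cs comes from linear growth
  -- measured from p.
  have key := card_mul_le_of_circAvg_sub p (s := s) (t := 4 * t) (m := 3 * C * s) (τ := δ * t)
    (b := C * δ * t) hs0 (by positivity) (by linarith) (by positivity) (u := u)
    ((continuousOn_largest A).1.mono hnD) (fun y hy => largest_nonneg A (hnD y hy))
    (fun y hy => by
      have h1 : dist y p ≤ 3 * s := hy
      refine ((hgood y (hs3 ▸ hy)).2.2 p hpu (by linarith)).trans ?_
      have : C * dist y p ≤ C * (3 * s) := by gcongr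
      linarith)
    (fun y hy => largest_le_circAvg_self A (by positivity) (disjoint_left.2 fun q hq =>
      (hgood q (closedBall_subset_closedBall' (by rw [mem_ball] at hy; linarith) hq)).1))
    (F := F)
    (fun a ha b hb hab => ball_disjoint_ball (by linarith [hsep ha hb hab]))
    (fun a ha => ball_subset_closedBall.trans (closedBall_subset_closedBall' (by
      have := (hF ha).2
      rw [mem_closedBall] at this
      linarith)))
    (fun a ha y hy => le_circAvg_sub_of_mem_freeBoundarySet A (hF ha).1 ht hC hδ1 hδ2
      (fun q hq => by
        obtain ⟨h1, h2, h3⟩ := hsc a (hF ha).1 q (closedBall_subset_closedBall (by linarith) hq)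
        exact ⟨h1, h2, fun z hz hqz => h3 z hz (by linarith)⟩) hy)
  rw [le_div_iff₀ (by positivity)]
  have h1 : F.card * (δ * t) ^ 2 * (C * δ * t) = (F.card * t * (δ ^ 3 * C)) * t ^ 2 := by ring
  have h2 : 49 * (3 * C * s) * (4 * t) ^ 2 = 49 * (3 * C * s) * 16 * t ^ 2 := by ring
  rw [h1, h2] at key
  exact le_of_mul_le_mul_right key (by positivity)

end FreeBoundary

namespace FreeBoundary

open InnerProductSpace Laplacian

/-! ### The logarithmic barrier -/

variable {lam ρ M : ℝ}

/-- Taking square roots, the condition on R reads M < √lam R ln(R/ρ). It persists as ≤ at the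
infimum by continuity, and the right side vanishes at R = ρ, so the infimum exceeds ρ. The
inequality says that h has slope at most √lam on its zero circle. -/
theorem barrierRadius_spec (hlam : 0 < lam) (hρ : 0 < ρ) (hM : 0 < M) :
    ρ < barrierRadius lam ρ M ∧
      M ≤ √lam * (barrierRadius lam ρ M * Real.log (barrierRadius lam ρ M / ρ)) := by
  have hl : 0 < √lam := Real.sqrt_pos.2 hlam
  set Φ : ℝ → ℝ := fun R => √lam * (R * Real.log (R / ρ)) with hΦ
  have hset : {R : ℝ | ρ < R ∧ M ^ 2 / (R ^ 2 * Real.log (ρ / R) ^ 2) < lam} =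
      {R : ℝ | ρ < R ∧ M < Φ R} := by
    ext R
    simp only [mem_ofPred_eq]
    refine and_congr_right fun hR => ?_
    have hR0 : 0 < R := hρ.trans hR
    have hlog : 0 < Real.log (R / ρ) := Real.log_pos ((one_lt_div hρ).2 hR)
    have h1 : Real.log (ρ / R) = -Real.log (R / ρ) := by rw [← Real.log_inv, inv_div]
    rw [h1, neg_sq, div_lt_iff₀ (by positivity), hΦ]
    have h2 : lam * (R ^ 2 * Real.log (R / ρ) ^ 2) = (√lam * (R * Real.log (R / ρ))) ^ 2 := by
      rw [mul_pow, mul_pow, Real.sq_sqrt hlam.le]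
    rw [h2, sq_lt_sq₀ hM.le (by positivity)]
  set T := {R : ℝ | ρ < R ∧ M < Φ R} with hT
  have hR₀ : barrierRadius lam ρ M = sInf T := by rw [barrierRadius, hset]
  have hbdd : BddBelow T := ⟨ρ, fun R hR => hR.1.le⟩
  have hne : T.Nonempty := by
    refine ⟨max (Real.exp 1 * ρ) (M / √lam + 1), ?_, ?_⟩
    · refine lt_of_lt_of_le ?_ (le_max_left _ _)
      nlinarith [Real.exp_one_gt_two]
    · set R := max (Real.exp 1 * ρ) (M / √lam + 1)
      have h1 : Real.exp 1 ≤ R / ρ := (le_div_iff₀ hρ).2 (le_max_left _ _)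
      have h2 : 1 ≤ Real.log (R / ρ) :=
        (Real.le_log_iff_exp_le ((Real.exp_pos 1).trans_le h1)).2 h1
      have h3 : M / √lam < R := lt_of_lt_of_le (lt_add_one _) (le_max_right _ _)
      rw [div_lt_iff₀ hl] at h3
      have hR : 0 < R := lt_max_of_lt_left (by positivity)
      rw [hΦ]; dsimp only
      have h4 : √lam * (R * 1) ≤ √lam * (R * Real.log (R / ρ)) := by gcongr
      linarith
  have hmem := csInf_mem_closure hne hbdd
  rw [← hR₀] at hmem
  set R₀ := barrierRadius lam ρ M
  have hle : ρ ≤ R₀ := by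
    rw [hR₀]; exact le_csInf hne fun R hR => hR.1.le
  have hΦc : ContinuousOn Φ (Ici ρ) := by
    have : ContinuousOn (fun R : ℝ => Real.log (R / ρ)) (Ici ρ) :=
      ContinuousOn.log (by fun_prop) fun R hR => (div_pos (hρ.trans_le hR) hρ).ne'
    exact continuousOn_const.mul (continuousOn_id.mul this)
  have hcl : M ≤ Φ R₀ := by
    have h1 : (R₀, Φ R₀) ∈ closure ((fun R => (R, Φ R)) '' T) :=
      ((continuousOn_id.prodMk hΦc).continuousWithinAt hle).mono
        (fun R hR => hR.1.le) |>.mem_closure_image hmem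
    have h2 : IsClosed {q : ℝ × ℝ | M ≤ q.2} := isClosed_le continuous_const continuous_snd
    exact closure_minimal (by rintro _ ⟨R, hR, rfl⟩; exact hR.2.le) h2 h1
  refine ⟨lt_of_le_of_ne hle fun h => ?_, hcl⟩
  rw [← h, hΦ] at hcl
  simp only [div_self hρ.ne', Real.log_one, mul_zero] at hcl
  linarith

theorem barrier_eq (hρ : 0 < ρ) (hR : ρ < barrierRadius lam ρ M) {x : Plane} (hx : x ≠ 0) :
    barrier lam ρ M x = M / Real.log (barrierRadius lam ρ M / ρ) *
      max (Real.log (barrierRadius lam ρ M) - Real.log ‖x‖) 0 := by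
  set R := barrierRadius lam ρ M
  have hR0 : 0 < R := hρ.trans hR
  have hlog : 0 < Real.log (R / ρ) := Real.log_pos ((one_lt_div hρ).2 hR)
  have h1 : Real.log (ρ / R) = -Real.log (R / ρ) := by rw [← Real.log_inv, inv_div]
  have h2 : Real.log (‖x‖ / R) / Real.log (ρ / R) =
      (Real.log R - Real.log ‖x‖) / Real.log (R / ρ) := by
    rw [h1, Real.log_div (norm_ne_zero_iff.2 hx) hR0.ne', div_neg, ← neg_div, neg_sub]
  have h3 : max ((Real.log R - Real.log ‖x‖) / Real.log (R / ρ)) 0 =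
      max (Real.log R - Real.log ‖x‖) 0 / Real.log (R / ρ) := by
    rw [max_div_div_right hlog.le _ _ |>.symm, zero_div]
  rw [barrier, h2, h3]
  ring

/-- Outside a circle centred at the origin, logarithms of slope at most `G` on that circle lie
below the plane of slope `G`. -/
theorem belowPlane_log_norm {x : Plane} (hx : x ≠ 0) {c G : ℝ} (hG : 0 < G)
    (hcG : c ≤ G * ‖x‖) {w : Plane → ℝ}
    (hw : ∀ᶠ z in 𝓝 x, w z ≤ c * max (Real.log ‖x‖ - Real.log ‖z‖) 0) :
    BelowPlane w x (-(‖x‖⁻¹ • x)) G := by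
  intro ε hε
  have hx0 : 0 < ‖x‖ := norm_pos_iff.2 hx
  have hlim : Tendsto (fun z : Plane => ‖x‖ ^ 2 / ‖z‖ ^ 2) (𝓝 x) (𝓝 1) := by
    have : ContinuousAt (fun z : Plane => ‖x‖ ^ 2 / ‖z‖ ^ 2) x :=
      ContinuousAt.div (by fun_prop) (by fun_prop) (by positivity)
    simpa [ContinuousAt, div_self (pow_ne_zero 2 hx0.ne')] using this
  have h1 : (1 : ℝ) < 1 + ε / G := by have : 0 < ε / G := by positivity
                                      linarith
  filter_upwards [hw, hlim.eventually (gt_mem_nhds h1), isOpen_ne.mem_nhds hx] with z hz hlt hz0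
  have hz0' : 0 < ‖z‖ := norm_pos_iff.2 hz0
  set b := inner ℝ (z - x) (-(‖x‖⁻¹ • x)) with hb
  have hin : ‖z‖ ^ 2 = ‖x‖ ^ 2 - 2 * ‖x‖ * b + ‖z - x‖ ^ 2 := by
    have e1 := norm_add_sq_real (z - x) x
    rw [sub_add_cancel] at e1
    have e2 : b = -(‖x‖⁻¹ * inner ℝ (z - x) x) := by
      rw [hb, inner_neg_right, real_inner_smul_right]
    rw [e1, e2]
    field_simp
    ring
  -- This is ln t ≤ t - 1 at t = |x|²/|z|², with |x|² - |z|² = 2|x|b - |z - x|².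
  have hlog : Real.log ‖x‖ - Real.log ‖z‖ ≤ max b 0 / ‖x‖ * (‖x‖ ^ 2 / ‖z‖ ^ 2) := by
    have e1 := Real.log_le_sub_one_of_pos (show 0 < ‖x‖ ^ 2 / ‖z‖ ^ 2 by positivity)
    rw [Real.log_div (by positivity) (by positivity), Real.log_pow, Real.log_pow] at e1
    push_cast at e1
    have e2 : ‖x‖ ^ 2 / ‖z‖ ^ 2 - 1 = (2 * ‖x‖ * b - ‖z - x‖ ^ 2) / ‖z‖ ^ 2 := by
      rw [div_sub_one (by positivity)]
      congr 1
      linarith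
    have e3 : (2 * ‖x‖ * b - ‖z - x‖ ^ 2) / ‖z‖ ^ 2 ≤ 2 * ‖x‖ * max b 0 / ‖z‖ ^ 2 := by
      gcongr
      have : ‖x‖ * b ≤ ‖x‖ * max b 0 := by gcongr; exact le_max_left _ _
      nlinarith [sq_nonneg ‖z - x‖]
    have e4 : max b 0 / ‖x‖ * (‖x‖ ^ 2 / ‖z‖ ^ 2) = 1 / 2 * (2 * ‖x‖ * max b 0 / ‖z‖ ^ 2) := by
      field_simp
    rw [e4]
    linarith
  have hb0 : 0 ≤ max b 0 := le_max_right _ _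
  have hbn : max b 0 ≤ ‖z - x‖ := by
    refine max_le ((real_inner_le_norm _ _).trans ?_) (norm_nonneg _)
    rw [norm_neg, norm_smul, norm_inv, norm_norm, inv_mul_cancel₀ hx0.ne', mul_one]
  calc w z ≤ c * max (Real.log ‖x‖ - Real.log ‖z‖) 0 := hz
    _ ≤ (G * ‖x‖) * (max b 0 / ‖x‖ * (1 + ε / G)) := by
        have e5 : max (Real.log ‖x‖ - Real.log ‖z‖) 0 ≤ max b 0 / ‖x‖ * (1 + ε / G) :=
          max_le (hlog.trans (by gcongr)) (by positivity)
        gcongr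
    _ = G * max b 0 + ε * max b 0 := by field_simp
    _ ≤ G * max b 0 + ε * ‖z - x‖ := by gcongr

theorem admissible_barrier {D : Set Plane} {f g : Plane → ℝ} {Lam : ℝ} (hD_open : IsOpen D)
    (hD_conn : IsConnected D) (hD_zero : (0 : Plane) ∈ D) (hlam : 0 < lam) (hf_cont : Continuous f)
    (hf_bound : ∀ x, lam < f x ∧ f x < Lam) (hg_cont : ContinuousOn g (frontier D))
    (hg_pos : ∀ x ∈ frontier D, 0 < g x) (hM : 0 < M) (hDρ : D ⊆ ball (0 : Plane) ρ)
    (hgM : ∀ x ∈ frontier D, g x ≤ barrier lam ρ M x) :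
    Admissible D f g (barrier lam ρ M) lam Lam := by
  have hρ : 0 < ρ := pos_of_mem_ball (hDρ hD_zero)
  obtain ⟨hR, hMR⟩ := barrierRadius_spec hlam hρ hM
  have heq : ∀ x : Plane, x ≠ 0 → _ := fun x hx => barrier_eq (M := M) (lam := lam) hρ hR hx
  set R := barrierRadius lam ρ M with hRdef
  have hR0 : 0 < R := hρ.trans hR
  have hlog : 0 < Real.log (R / ρ) := Real.log_pos ((one_lt_div hρ).2 hR)
  set c := M / Real.log (R / ρ) with hc
  have hc0 : 0 < c := by positivity
  have hcR : c ≤ √lam * R := by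
    rw [hc, div_le_iff₀ hlog]; linarith
  have hne : ∀ x ∉ D, x ≠ 0 := fun x hx h => hx (h ▸ hD_zero)
  have hnec : ∀ x ∉ closure D, x ≠ 0 := fun x hx => hne x fun h => hx (subset_closure h)
  have hzero : ∀ x : Plane, R ≤ ‖x‖ → barrier lam ρ M x = 0 := fun x hx => by
    have hx0 : x ≠ 0 := norm_pos_iff.1 (hR0.trans_le hx)
    rw [heq x hx0, max_eq_right (sub_nonpos.2 (Real.log_le_log hR0 hx)), mul_zero]
  have hpos : ∀ x : Plane, x ≠ 0 → 0 < barrier lam ρ M x → ‖x‖ < R := fun x _ h => by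
    by_contra! hn
    rw [hzero x hn] at h
    exact lt_irrefl _ h
  refine ⟨hD_open, hD_conn, hlam, hf_cont, fun x => (hf_bound x).1,
    fun x => (hf_bound x).2, hg_cont, hg_pos, hgM, fun x => mul_nonneg hM.le (le_max_right _ _),
    ?_, ?_, ?_, ⟨R, hzero⟩, ?_⟩
  · refine ContinuousOn.congr (f := fun x : Plane => c * max (Real.log R - Real.log ‖x‖) 0) ?_
      fun x hx => heq x (hne x hx)
    have : ContinuousOn (fun x : Plane => Real.log ‖x‖) Dᶜ :=
      continuous_norm.continuousOn.log fun x hx => norm_ne_zero_iff.2 (hne x hx)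
    exact continuousOn_const.mul ((continuousOn_const.sub this).sup continuousOn_const)
  · intro x hx h0
    have hx0 := hnec x hx
    have hxR := hpos x hx0 h0
    have h1 : HarmonicAt (fun y : Plane => c • (Real.log R - Real.log ‖y - 0‖)) x :=
      ((harmonicAt_const (Real.log R)).sub (harmonicAt_log_norm_sub hx0)).const_smul
    refine (harmonicAt_congr_nhds ?_).2 h1
    filter_upwards [isOpen_ne.mem_nhds hx0,
      continuous_norm.continuousAt.eventually (gt_mem_nhds hxR)] with y hy hyR
    rw [heq y hy, sub_zero, smul_eq_mul, max_eq_left (sub_nonneg.2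
      (Real.log_le_log (norm_pos_iff.2 hy) hyR.le))]
  · obtain ⟨ε, hε, hεD⟩ := Metric.isOpen_iff.1 hD_open 0 hD_zero
    refine ⟨c * max (Real.log R - Real.log ε) 0, fun x hx => ?_⟩
    rw [heq x (hne x hx)]
    have : ε ≤ ‖x‖ := by
      by_contra! h
      exact hx (hεD (mem_ball_zero_iff.2 h))
    have h2 := Real.log_le_log hε this
    gcongr
  · intro x hx h0
    have hx0 := hnec x hx
    have hxn : 0 < ‖x‖ := norm_pos_iff.2 hx0
    have hxR : R ≤ ‖x‖ := by
      by_contra! h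
      rw [heq x hx0, max_eq_left (sub_nonneg.2 (Real.log_le_log hxn h.le))] at h0
      have := Real.log_lt_log hxn h
      rcases mul_eq_zero.1 h0 with h1 | h1 <;> linarith
    -- The ball of radius |x| about 2x touches the circle |z| = |x| from outside at x, and h
    -- vanishes on it because |x| ≥ R. This covers every zero of h, not only those on the circle of
    -- radius R.
    refine ⟨(2 : ℝ) • x, ‖x‖, hxn, ?_, disjoint_left.2 fun z hz hz0 => ?_, ?_⟩
    · rw [dist_eq_norm, two_smul, sub_add_cancel_left, norm_neg]
    · rw [mem_ball, dist_eq_norm, norm_sub_rev] at hz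
      have h1 := norm_sub_norm_le ((2 : ℝ) • x) z
      rw [norm_smul, Real.norm_ofNat] at h1
      rw [mem_ofPred_eq, hzero z (by linarith)] at hz0
      exact lt_irrefl _ hz0
    · have h1 : ‖x‖⁻¹ • (x - (2 : ℝ) • x) = -(‖x‖⁻¹ • x) := by
        rw [two_smul, sub_add_cancel_left, smul_neg]
      rw [h1]
      refine belowPlane_log_norm hx0 (Real.sqrt_pos.2 hlam)
        (hcR.trans (by gcongr)) ?_
      filter_upwards [isOpen_ne.mem_nhds hx0] with z hz
      rw [heq z hz]
      have := Real.log_le_log hR0 hxR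
      gcongr

end FreeBoundary

/-! ### Boundaries of components of the normalized positivity set -/

namespace FreeBoundary

/-- Components of an open set are open here. If a frontier point lay in W, its own component would
meet the given one, hence equal it, and the point would be interior. -/
theorem mem_of_mem_frontier_connectedComponentIn {X : Type*} [TopologicalSpace X]
    [LocallyConnectedSpace X] {W : Set X} (hW : IsOpen W) {y z : X}
    (hz : z ∈ frontier (connectedComponentIn W y)) : z ∉ W := by
  intro hzW
  have ho := hW.connectedComponentIn (x := y)
  obtain ⟨q, hq1, hq2⟩ := mem_closure_iff.1 hz.1 _ (hW.connectedComponentIn (x := z))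
    (mem_connectedComponentIn hzW)
  rw [ho.frontier_eq] at hz
  apply hz.2
  rw [connectedComponentIn_eq hq2, ← connectedComponentIn_eq hq1]
  exact mem_connectedComponentIn hzW

theorem hausdorffMeasure_sphere_lt_top :
    Measure.hausdorffMeasure 1 (sphere (0 : Plane) 1) < ⊤ := by
  have hL : LipschitzWith (1 * Real.nnabs 1) fun θ : ℝ => toPlane (circleMap 0 1 θ) :=
    toPlane.lipschitz.comp (lipschitzWith_circleMap 0 1)
  have hsub : sphere (0 : Plane) 1 ⊆
      (fun θ : ℝ => toPlane (circleMap 0 1 θ)) '' Icc (-Real.pi) Real.pi := by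
    intro x hx
    refine ⟨(toPlane.symm x).arg, ⟨(Complex.neg_pi_lt_arg _).le, Complex.arg_le_pi _⟩, ?_⟩
    have h1 := Complex.norm_mul_exp_arg_mul_I (toPlane.symm x)
    rw [LinearIsometryEquiv.norm_map, mem_sphere_zero_iff_norm.1 hx] at h1
    have h2 : circleMap 0 1 (toPlane.symm x).arg = toPlane.symm x := by
      rw [circleMap, zero_add]; exact h1
    dsimp only
    rw [h2, LinearIsometryEquiv.apply_symm_apply]
  refine (measure_mono hsub).trans_lt ((hL.hausdorffMeasure_image_le zero_le_one _).trans_lt ?_)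
  rw [hausdorffMeasure_real]
  exact ENNReal.mul_lt_top (by simp) (isCompact_Icc.measure_lt_top)

theorem mem_freeBoundarySet_of_mem_closure {D W : Set Plane} {u : Plane → ℝ} {x₀ z : Plane} {r : ℝ}
    (hDc : Disjoint (ball x₀ r) (closure D)) (hr : 0 < r)
    (hWP : ∀ x ∈ W, x₀ - r • x ∈ posSet D u) (hz : z ∈ closure W) (hz1 : z ∈ ball (0 : Plane) 1)
    (hzP : x₀ - r • z ∉ posSet D u) : x₀ - r • z ∈ freeBoundarySet D u := by
  have hc : Continuous fun x : Plane => x₀ - r • x := by fun_prop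
  refine ⟨⟨map_mem_closure (f := fun x : Plane => x₀ - r • x) hc hz hWP,
    fun hi => hzP (interior_subset hi)⟩,
    fun hcl => hDc.ne_of_mem ?_ hcl rfl⟩
  rw [mem_ball_zero_iff] at hz1
  rw [mem_ball, dist_eq_norm, sub_sub_cancel_left, norm_neg, norm_smul, Real.norm_of_nonneg hr.le]
  nlinarith

/-- The boundary of each component of the positivity set of the normalized largest subsolution has
finite length. -/
theorem hausdorffMeasure_frontier_component_lt_top {D : Set Plane} {f g h u : Plane → ℝ}
    {lam Lam : ℝ} (A : Admissible D f g h lam Lam)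
    (hu : ∀ x ∉ D, u x = largestSubsolution D f g h x) {x₀ : Plane} {r : ℝ} (hr : 0 < r)
    (hrD : Disjoint (ball x₀ r) D) (y : Plane) :
    Measure.hausdorffMeasure 1
      (frontier (connectedComponentIn {x ∈ ball (0 : Plane) 1 | 0 < normalize u x₀ r x} y)) < ⊤ := by
  set w := largestSubsolution D f g h with hw
  have hDc : Disjoint (ball x₀ r) (closure D) := hrD.closure_right isOpen_ball
  set W := {x ∈ ball (0 : Plane) 1 | 0 < normalize u x₀ r x} with hW
  have hmem : ∀ x ∈ ball (0 : Plane) 1, x₀ - r • x ∈ ball x₀ r := fun x hx => by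
    rw [mem_ball_zero_iff] at hx
    rw [mem_ball, dist_eq_norm, sub_sub_cancel_left, norm_neg, norm_smul, Real.norm_of_nonneg hr.le]
    nlinarith
  have hWP : ∀ x, x ∈ W ↔ x ∈ ball (0 : Plane) 1 ∧ x₀ - r • x ∈ posSet D w := fun x => by
    refine and_congr_right fun hx => ?_
    have hxD : x₀ - r • x ∉ D := fun h => hrD.ne_of_mem (hmem x hx) h rfl
    rw [normalize, hu _ hxD, div_pos_iff_of_pos_right hr]
    exact ⟨fun h => ⟨hxD, h⟩, fun h => h.2⟩
  have hWo : IsOpen W := by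
    rw [isOpen_iff_mem_nhds]
    intro x hx
    have h1 := (hWP x).1 hx
    have hc : ContinuousAt (fun x : Plane => x₀ - r • x) x := by fun_prop
    filter_upwards [isOpen_ball.mem_nhds h1.1, hc.eventually (eventually_mem_posSet_largest A
      (fun h => hDc.ne_of_mem (hmem x h1.1) h rfl) h1.2.2)] with z h2 h3
    exact (hWP z).2 ⟨h2, h3⟩
  -- A frontier point of the component is in the closure of W but not in W: it is on the unit
  -- circle, or its image is in the closure of the positivity set but not in the set.
  have hsub : frontier (connectedComponentIn W y) ⊆ sphere (0 : Plane) 1 ∪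
      (fun q : Plane => r⁻¹ • (x₀ - q)) '' freeBoundarySet D w := by
    intro z hz
    have hzW := mem_of_mem_frontier_connectedComponentIn hWo hz
    have hzcl : z ∈ closure W := closure_mono (connectedComponentIn_subset W y) hz.1
    have hzb : z ∈ closedBall (0 : Plane) 1 :=
      closure_minimal (fun x hx => ball_subset_closedBall hx.1) isClosed_closedBall hzcl
    by_cases hzs : z ∈ sphere (0 : Plane) 1
    · exact Or.inl hzs
    · have hzb' : z ∈ ball (0 : Plane) 1 := lt_of_le_of_ne hzb hzs
      refine Or.inr ⟨x₀ - r • z, mem_freeBoundarySet_of_mem_closure hDc hr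
        (fun x hx => ((hWP x).1 hx).2) hzcl hzb' fun h => hzW ((hWP z).2 ⟨hzb', h⟩), ?_⟩
      simp [smul_smul, inv_mul_cancel₀ hr.ne']
  have hLip : LipschitzWith (Real.nnabs r⁻¹) fun q : Plane => r⁻¹ • (x₀ - q) := by
    refine LipschitzWith.of_dist_le_mul fun a b => ?_
    rw [dist_smul₀, dist_sub_left]
    simp
  refine (measure_mono hsub).trans_lt ((measure_union_le _ _).trans_lt (ENNReal.add_lt_top.2
    ⟨hausdorffMeasure_sphere_lt_top, (hLip.hausdorffMeasure_image_le zero_le_one _).trans_lt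
      (ENNReal.mul_lt_top (by simp) (hausdorffMeasure_freeBoundarySet_lt_top A))⟩))

end FreeBoundary

theorem lemma4p6
    (D : Set Plane) (hD_open : IsOpen D) (hD_conn : IsConnected D)
    (hD_zero : (0 : Plane) ∈ D)
    (f g : Plane → ℝ) (lam Lam : ℝ) (hlam : 0 < lam)
    (hf_cont : Continuous f) (hf_bound : ∀ x, lam < f x ∧ f x < Lam)
    (hg_cont : ContinuousOn g (frontier D)) (hg_pos : ∀ x ∈ frontier D, 0 < g x)
    (ρ M : ℝ) (hM : 0 < M) (hDρ : D ⊆ ball (0 : Plane) ρ)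
    (hgM : ∀ x ∈ frontier D, g x ≤ FreeBoundary.barrier lam ρ M x)
    (u : Plane → ℝ)
    (hu : ∀ x ∉ D, u x =
      FreeBoundary.largestSubsolution D f g (FreeBoundary.barrier lam ρ M) x)
    (x₀ : Plane) (hx₀ : x₀ ∈ frontier (FreeBoundary.posSet D u))
    (r : ℝ) (hr : 0 < r) (hrD : Disjoint (ball x₀ r) D)
    (Γ : Set Plane)
    (hΓ : ∃ y ∈ {x ∈ ball (0 : Plane) 1 | 0 < FreeBoundary.normalize u x₀ r x},
      Γ = connectedComponentIn
        {x ∈ ball (0 : Plane) 1 | 0 < FreeBoundary.normalize u x₀ r x} y) :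
    Measure.hausdorffMeasure 1 (frontier Γ) < ⊤ := by
  obtain ⟨y, -, rfl⟩ := hΓ
  exact FreeBoundary.hausdorffMeasure_frontier_component_lt_top
    (FreeBoundary.admissible_barrier hD_open hD_conn hD_zero hlam hf_cont hf_bound hg_cont hg_pos hM
      hDρ hgM) hu hr hrD y
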